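/- Let $\alpha,\beta>-1$ and $\omega(x)=(1-x)^{\alpha}(1+x)^{\beta}$. Let $$P_k^{(\alpha,\beta)}(x)=\frac{(\alpha+1)_k}{k!}\,{}_2F_1\!\left(-k,\;k+\alpha+\beta+1;\;\alpha+1;\;\tfrac{1-x}{2}\right)$$ be the Jacobi polynomials, and let $$a_k^{(\alpha,\beta)}=\frac1{h_k}\int_{-1}^{1}f(x)\,P_k^{(\alpha,\beta)}(x)\,\omega(x)\,dx,\qquad h_k=\frac{2^{\alpha+\beta+1}\,\Gamma(k+\alpha+1)\,\Gamma(k+\beta+1)}{(2k+\alpha+\beta+1)\,\Gamma(k+1)\,\Gamma(k+\alpha+\beta+1)}$$ be the Jacobi coefficients of a function $f$, where for $k=0$ the product $(\alpha+\beta+1)\,\Gamma(\alpha+\beta+1)$ is read as $\Gamma(\alpha+\beta+2)$. Let $f(x)=|x-\xi|^{\sigma}g(x)$, where $\xi\in[-1,1]$, $\sigma\in\mathbb R$ and $g$ is a real-valued function that is analytic in a neighborhood of $[-1,1]$. Then the following hold as $k\to\infty$; in each case the integrals defining the $a_k^{(\alpha,\beta)}$ converge absolutely. (i) If $\xi\in(-1,1)$,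 $\sigma>-1$ and $\sigma$ is not an even integer, then $$a_k^{(\alpha,\beta)}=\mathcal A\,\frac{\cos\bigl(k\arccos\xi-\psi_{\alpha,\beta}(\xi)\bigr)}{k^{\sigma+1/2}}+O\!\left(\frac1{k^{\sigma+3/2}}\right),$$ where $\psi_{\alpha,\beta}(x)=\frac{(2\alpha+1)\pi}{4}-\frac{(\alpha+\beta+1)\arccos x}{2}$ and $$\mathcal A=\frac{\Gamma(\sigma+1)\,(1-\xi)^{\frac{\sigma+\alpha}{2}+\frac14}\,(1+\xi)^{\frac{\sigma+\beta}{2}+\frac14}}{2^{\frac{\alpha+\beta-3}{2}}\sqrt{\pi}}\,\cos\!\left(\frac{\sigma+1}{2}\pi\right)g(\xi).$$ (ii) If $\xi=-1$, $\sigma>-\beta-1$ and $\sigma$ is not an integer, then $$a_k^{(\alpha,\beta)}=\frac{(-1)^k\,\mathcal B^{L}}{k^{2\sigma+\beta+1}}+O\!\left(\frac1{k^{2\sigma+\beta+2}}\right),\qquad \mathcal B^{L}=\frac{2^{\sigma+1}\,\Gamma(\sigma+\beta+1)}{\Gamma(-\sigma)}\,g(-1).$$ If $\xi=1$, $\sigma>-\alpha-1$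 and $\sigma$ is not an integer, then $$a_k^{(\alpha,\beta)}=\frac{\mathcal B^{R}}{k^{2\sigma+\alpha+1}}+O\!\left(\frac1{k^{2\sigma+\alpha+2}}\right),\qquad \mathcal B^{R}=\frac{2^{\sigma+1}\,\Gamma(\sigma+\alpha+1)}{\Gamma(-\sigma)}\,g(1).$$ -/

import Mathlib

open Filter Asymptotics

noncomputable section

/-- The Jacobi polynomial `P_n^{(α,β)}(x)`, written with the Gauss hypergeometric function (the
series terminates because its first parameter is `-n`). -/
def jacobiP (α β : ℝ) (n : ℕ) (x : ℝ) : ℝ :=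
  (ascPochhammer ℝ n).eval (α + 1) / (n.factorial : ℝ) *
    ordinaryHypergeometric (-(n : ℝ)) ((n : ℝ) + α + β + 1) (α + 1) ((1 - x) / 2)

/-- The Jacobi weight `(1 - x)^α (1 + x)^β`. -/
def jacobiWeight (α β x : ℝ) : ℝ := (1 - x) ^ α * (1 + x) ^ β

/-- The inner product `∫_{-1}^{1} f g w` for the Jacobi weight `w`. -/
def jacobiInner (α β : ℝ) (f g : ℝ → ℝ) : ℝ :=
  ∫ x in (-1 : ℝ)..1, f x * g x * jacobiWeight α β x

/-- The squared norm `h_n` of the `n`-th Jacobi polynomial. For `n = 0` the factor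
`(2n + α + β + 1) Γ(n + α + β + 1)` is written as `Γ(α + β + 2)`, which also gives the correct
value when `α + β = -1`. -/
def jacobiH (α β : ℝ) (n : ℕ) : ℝ :=
  if n = 0 then
    2 ^ (α + β + 1) * Real.Gamma (α + 1) * Real.Gamma (β + 1) / Real.Gamma (α + β + 2)
  else
    2 ^ (α + β + 1) * Real.Gamma (n + α + 1) * Real.Gamma (n + β + 1) /
      ((2 * n + α + β + 1) * Real.Gamma (n + 1) * Real.Gamma (n + α + β + 1))

/-- The `k`-th Jacobi coefficient of `f`. -/
def jacobiCoeff (α β : ℝ) (f : ℝ → ℝ) (k : ℕ) : ℝ :=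
  jacobiInner α β f (jacobiP α β k) / jacobiH α β k

/-- The integrals that define the Jacobi coefficients of `f` converge absolutely. -/
def HasJacobiCoeffs (α β : ℝ) (f : ℝ → ℝ) : Prop :=
  ∀ k : ℕ, IntervalIntegrable (fun x => f x * jacobiP α β k x * jacobiWeight α β x)
    MeasureTheory.volume (-1) 1

/-- The model function `|x - ξ|^σ g(x)`. -/
def modelFun (σ ξ : ℝ) (g : ℝ → ℝ) (x : ℝ) : ℝ := |x - ξ| ^ σ * g x

/-- The phase `ψ_{α,β}(x)`. -/
def psiPhase (α β x : ℝ) : ℝ :=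
  (2 * α + 1) * Real.pi / 4 - (α + β + 1) * Real.arccos x / 2

/-- The amplitude for an interior singularity. -/
def ampInterior (α β σ ξ : ℝ) (g : ℝ → ℝ) : ℝ :=
  Real.Gamma (σ + 1) * (1 - ξ) ^ ((σ + α) / 2 + 1 / 4) * (1 + ξ) ^ ((σ + β) / 2 + 1 / 4) /
      (2 ^ ((α + β - 3) / 2) * Real.sqrt Real.pi) *
    Real.cos ((σ + 1) / 2 * Real.pi) * g ξ

/-- The amplitude for a singularity at the left endpoint. -/
def ampLeft (β σ : ℝ) (g : ℝ → ℝ) : ℝ :=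
  2 ^ (σ + 1) * Real.Gamma (σ + β + 1) / Real.Gamma (-σ) * g (-1)

/-- The amplitude for a singularity at the right endpoint. -/
def ampRight (α σ : ℝ) (g : ℝ → ℝ) : ℝ :=
  2 ^ (σ + 1) * Real.Gamma (σ + α + 1) / Real.Gamma (-σ) * g 1

end

open scoped Topology

/-! Everything rests on one relation: up to the factor `-2 (n + 1)`, the product of the weight and
`P_(n+1)` is the derivative of the product of weight and `P_n` with both parameters raised by one
(`hasDerivAt_weight_mul_jacobiP`). Integrating by parts `n` times therefore trades `P_n` against the
weight for the `n`-th derivative of `f` against the weight with exponents `α + n`, `β + n`.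

Smooth functions. After `m` such steps a bound for the weighted `L¹` norm of `P_k`, uniform in `k`,
gives `O(k ^ (1 - m))` for the coefficients of a `C^m` function
(`jacobiCoeff_isBigO_of_contDiffOn`). So `g` may be replaced by a Taylor polynomial at the
singularity: the singular factor times a high-order remainder is as smooth as desired.

Endpoints. For `(1 - x) ^ s` the integrations by parts end in a beta integral
(`integral_jacobi_one_sub_rpow`), so the coefficient is an explicit quotient of Gamma functions.
Raising `s` by one costs two powers of `k`; only the constant Taylor term survives. The left
endpoint follows by `x ↦ -x`.

Interior. With `ξ = cos θ`, each term `|x - ξ| ^ σ (x - ξ) ^ j` is, away from `ξ`, the real part of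
the boundary value at `ζ = x - ξ`, from the upper half plane, of `ζ ^ τ (p + q log ζ)` with `τ = σ +
j`. For `n > τ` its `n`-th derivative is a multiple of `ζ ^ (τ - n)`, and integration by parts
leaves the `n`-th power of `(1 - z²) / (z - ξ)` times a fixed amplitude. This function has the
saddle point `e ^ (iθ)`, with value `-2 e ^ (iθ)`; on the path `saddlePath` it equals `-2 e ^ (iθ)
(1 - t²)`. Deforming the contour to that path is exact (`integral_jacobi_boundary_values`), and
Laplace's method for `(1 - t²) ^ n` gives the leading term with relative error `O(1 / n)`. The
factor `e ^ (inθ)` is the oscillation, the modulus and argument of the amplitude at the saddle give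
`𝒜` and `ψ`. -/

/-! ### Jacobi polynomials: coefficients, derivative, raising relation, reflection. -/

/-- The coefficient of `((1 - x) / 2) ^ j` in the Jacobi polynomial of degree `n`. -/
noncomputable def jacobiCf (α β : ℝ) (n j : ℕ) : ℝ :=
  (ascPochhammer ℝ n).eval (α + 1) / (n.factorial : ℝ) *
    ((j.factorial : ℝ)⁻¹ * (ascPochhammer ℝ j).eval (-(n : ℝ)) *
      (ascPochhammer ℝ j).eval ((n : ℝ) + α + β + 1) * ((ascPochhammer ℝ j).eval (α + 1))⁻¹)

theorem jacobiCf_eq_zero (α β : ℝ) {n j : ℕ} (h : n < j) : jacobiCf α β n j = 0 := by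
  rw [jacobiCf, ascPochhammer_eval_neg_coe_nat_of_lt h]; simp

theorem jacobiP_eq_sum (α β : ℝ) (n : ℕ) (x : ℝ) :
    jacobiP α β n x = ∑ j ∈ Finset.range (n + 1), jacobiCf α β n j * ((1 - x) / 2) ^ j := by
  rw [jacobiP, ordinaryHypergeometric_eq_tsum]
  simp only [smul_eq_mul]
  rw [tsum_eq_sum (s := Finset.range (n + 1)), Finset.mul_sum]
  · refine Finset.sum_congr rfl fun j _ => ?_
    simp only [jacobiCf]; ring
  · intro j hj
    rw [ascPochhammer_eval_neg_coe_nat_of_lt (by simpa using hj)]; simp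

theorem ascPochhammer_eval_succ_left (n : ℕ) (x : ℝ) :
    (ascPochhammer ℝ (n + 1)).eval x = x * (ascPochhammer ℝ n).eval (x + 1) := by
  rw [ascPochhammer_succ_left]; simp

/-- The term ratio of the hypergeometric series, with denominators cleared so that it remains valid
at `j = n`, where the series stops. -/
theorem jacobiCf_succ {α : ℝ} (β : ℝ) (hα : -1 < α) (n j : ℕ) :
    (α + 1 + j) * (j + 1) * jacobiCf α β n (j + 1) =
      (j - n) * (j + n + α + β + 1) * jacobiCf α β n j := by
  have h1 : (ascPochhammer ℝ j).eval (α + 1) ≠ 0 := (ascPochhammer_pos j _ (by linarith)).ne'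
  have h2 : α + 1 + j ≠ 0 := by
    have : (0 : ℝ) ≤ j := j.cast_nonneg
    linarith
  simp only [jacobiCf, ascPochhammer_succ_eval, Nat.factorial_succ]
  push_cast
  field_simp
  ring

/-- Each Pochhammer symbol splits off its first factor, which shifts every hypergeometric parameter
by one; this is the derivative formula read on coefficients. -/
theorem jacobiCf_succ_succ {α : ℝ} (β : ℝ) (hα : -1 < α) (n j : ℕ) :
    (j + 1) * jacobiCf α β (n + 1) (j + 1) =
      -(n + α + β + 2) * jacobiCf (α + 1) (β + 1) n j := by
  have h1 : (ascPochhammer ℝ j).eval (α + 1 + 1) ≠ 0 := (ascPochhammer_pos j _ (by linarith)).ne'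
  have h2 : α + 1 ≠ 0 := by linarith
  simp only [jacobiCf, ascPochhammer_eval_succ_left, Nat.factorial_succ]
  push_cast
  rw [show -((n : ℝ) + 1) + 1 = -n by ring,
    show (n : ℝ) + (α + 1) + (β + 1) + 1 = n + 1 + α + β + 1 + 1 by ring]
  field_simp
  ring

theorem jacobiP_zero (α β x : ℝ) : jacobiP α β 0 x = 1 := by
  simp [jacobiP_eq_sum, jacobiCf]

theorem continuous_jacobiP (α β : ℝ) (n : ℕ) : Continuous (jacobiP α β n) := by
  have : jacobiP α β n = fun x => ∑ j ∈ Finset.range (n + 1), jacobiCf α β n j * ((1 - x) / 2) ^ j :=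
    funext fun x => jacobiP_eq_sum α β n x
  rw [this]; fun_prop

theorem hasDerivAt_jacobiP_sum (α β : ℝ) (n : ℕ) (x : ℝ) :
    HasDerivAt (jacobiP α β n)
      (-(1 / 2) * ∑ j ∈ Finset.range n, (j + 1) * jacobiCf α β n (j + 1) * ((1 - x) / 2) ^ j) x := by
  have : jacobiP α β n = fun x => ∑ j ∈ Finset.range (n + 1), jacobiCf α β n j * ((1 - x) / 2) ^ j :=
    funext fun x => jacobiP_eq_sum α β n x
  rw [this]
  have h1 : HasDerivAt (fun x : ℝ => (1 - x) / 2) (-1 / 2) x :=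
    ((hasDerivAt_id x).const_sub 1).div_const 2
  have h2 := HasDerivAt.fun_sum (u := Finset.range (n + 1)) fun j _ =>
    (h1.pow j).const_mul (jacobiCf α β n j)
  refine h2.congr_deriv ?_
  rw [Finset.sum_range_succ', Finset.mul_sum]
  simp only [CharP.cast_eq_zero, zero_mul, mul_zero, add_zero]
  refine Finset.sum_congr rfl fun j _ => ?_
  simp only [Nat.add_sub_cancel]; push_cast; ring

theorem hasDerivAt_jacobiP {α : ℝ} (β : ℝ) (hα : -1 < α) (n : ℕ) (x : ℝ) :
    HasDerivAt (jacobiP α β (n + 1)) ((n + α + β + 2) / 2 * jacobiP (α + 1) (β + 1) n x) x := by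
  refine (hasDerivAt_jacobiP_sum α β (n + 1) x).congr_deriv ?_
  rw [jacobiP_eq_sum, Finset.mul_sum, Finset.mul_sum]
  refine Finset.sum_congr rfl fun j _ => ?_
  rw [jacobiCf_succ_succ β hα]; ring

/-- Compare coefficients in powers of `y = (1 - x) / 2`, where `1 - x² = 4 y (1 - y)`. The two
coefficient recurrences above express both sides through the same sequence. -/
theorem jacobiP_raising {α β : ℝ} (hα : -1 < α) (hβ : -1 < β) (n : ℕ) (x : ℝ) :
    ∃ D, HasDerivAt (jacobiP (α + 1) (β + 1) n) D x ∧
      ((β + 1) * (1 - x) - (α + 1) * (1 + x)) * jacobiP (α + 1) (β + 1) n x + (1 - x ^ 2) * D =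
        -2 * (n + 1) * jacobiP α β (n + 1) x := by
  refine ⟨_, hasDerivAt_jacobiP_sum (α + 1) (β + 1) n x, ?_⟩
  have hb : (n : ℝ) + α + β + 2 ≠ 0 := by
    have : (0 : ℝ) ≤ n := n.cast_nonneg
    linarith
  obtain ⟨y, rfl⟩ : ∃ y, x = 1 - 2 * y := ⟨(1 - x) / 2, by ring⟩
  simp only [jacobiP_eq_sum, show (1 - (1 - 2 * y)) / 2 = y by ring]
  set q := jacobiCf (α + 1) (β + 1) n with hq
  set c := jacobiCf α β (n + 1) with hc
  have hqc : ∀ j : ℕ, (j + 1) * c (j + 1) = -(n + α + β + 2) * q j := jacobiCf_succ_succ β hα n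
  have hcc : ∀ j : ℕ, (α + 1 + j) * (j + 1) * c (j + 1) =
      (j - (n + 1)) * (j + (n + 1) + α + β + 1) * c j := by
    intro j; have := jacobiCf_succ β hα (n + 1) j; push_cast at this; exact this
  -- `h0` and `hj` are the coefficients of `y ^ 0` and `y ^ (j + 1)` in the claim divided by `-2`;
  -- each is proved after multiplication by the nonzero `n + α + β + 2`.
  have h0 : (α + 1) * q 0 = (n + 1) * c 0 := by
    have h1 := hqc 0
    have h2 := hcc 0
    apply mul_left_cancel₀ hb
    push_cast at h1 h2
    linear_combination (α + 1) * h1 - h2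
  have hj : ∀ j : ℕ, (α + 2 + j) * q (j + 1) - (α + β + 2 + j) * q j = (n + 1) * c (j + 1) := by
    intro j
    have h1 := hqc j
    have h2 := hqc (j + 1)
    have h3 := hcc (j + 1)
    apply mul_left_cancel₀ hb
    push_cast at h1 h2 h3
    linear_combination (α + 2 + j) * h2 - h3 - (α + β + 2 + j) * h1
  have hQ : ∑ j ∈ Finset.range (n + 1), q j * y ^ j =
      ∑ j ∈ Finset.range (n + 1), q (j + 1) * y ^ (j + 1) + q 0 := by
    have := Finset.sum_range_succ' (fun j => q j * y ^ j) (n + 1)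
    rw [Finset.sum_range_succ, hq, jacobiCf_eq_zero _ _ (Nat.lt_succ_self n), ← hq] at this
    simpa using this
  have hS : ∑ j ∈ Finset.range n, ((j : ℝ) + 1) * q (j + 1) * y ^ j =
      ∑ j ∈ Finset.range (n + 1), ((j : ℝ) + 1) * q (j + 1) * y ^ j := by
    rw [Finset.sum_range_succ, hq, jacobiCf_eq_zero _ _ (Nat.lt_succ_self n)]; simp
  have hyS : y * ∑ j ∈ Finset.range n, ((j : ℝ) + 1) * q (j + 1) * y ^ j =
      ∑ j ∈ Finset.range (n + 1), (j : ℝ) * q j * y ^ j := by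
    rw [Finset.sum_range_succ', Finset.mul_sum]
    simp only [CharP.cast_eq_zero, zero_mul, add_zero]
    refine Finset.sum_congr rfl fun j _ => ?_
    push_cast; ring
  have hP : ∑ j ∈ Finset.range (n + 1 + 1), c j * y ^ j =
      ∑ j ∈ Finset.range (n + 1), c (j + 1) * y ^ (j + 1) + c 0 := by
    simpa using Finset.sum_range_succ' (fun j => c j * y ^ j) (n + 1)
  have key : (α + 1) * (∑ j ∈ Finset.range (n + 1), q (j + 1) * y ^ (j + 1) + q 0) +
      y * ∑ j ∈ Finset.range (n + 1), ((j : ℝ) + 1) * q (j + 1) * y ^ j -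
      y * ((α + β + 2) * ∑ j ∈ Finset.range (n + 1), q j * y ^ j +
        ∑ j ∈ Finset.range (n + 1), (j : ℝ) * q j * y ^ j) =
      (n + 1) * (∑ j ∈ Finset.range (n + 1), c (j + 1) * y ^ (j + 1) + c 0) := by
    rw [mul_add, mul_add, h0, ← sub_eq_zero]
    have : ∑ j ∈ Finset.range (n + 1), ((α + 1) * (q (j + 1) * y ^ (j + 1)) +
        y * (((j : ℝ) + 1) * q (j + 1) * y ^ j) - y * ((α + β + 2) * (q j * y ^ j) +
        (j : ℝ) * q j * y ^ j) - (n + 1) * (c (j + 1) * y ^ (j + 1))) = 0 := by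
      refine Finset.sum_eq_zero fun j _ => ?_
      linear_combination y ^ (j + 1) * hj j
    rw [Finset.sum_sub_distrib, Finset.sum_sub_distrib, Finset.sum_add_distrib, ← Finset.mul_sum,
      ← Finset.mul_sum, ← Finset.mul_sum, ← Finset.mul_sum, Finset.sum_add_distrib,
      ← Finset.mul_sum] at this
    linear_combination this
  rw [← hQ, ← hS, ← hyS, ← hP] at key
  linear_combination (-2) * key

theorem hasDerivAt_jacobiWeight (α β : ℝ) {x : ℝ} (hx : x ∈ Set.Ioo (-1 : ℝ) 1) :
    HasDerivAt (jacobiWeight (α + 1) (β + 1))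
      (((β + 1) * (1 - x) - (α + 1) * (1 + x)) * jacobiWeight α β x) x := by
  have h1 : 0 < 1 - x := by linarith [hx.2]
  have h2 : 0 < 1 + x := by linarith [hx.1]
  have e1 := ((hasDerivAt_id x).const_sub 1).rpow_const (p := α + 1) (Or.inl h1.ne')
  have e2 := ((hasDerivAt_id x).const_add 1).rpow_const (p := β + 1) (Or.inl h2.ne')
  refine (e1.mul e2).congr_deriv ?_
  simp only [id, add_sub_cancel_right, jacobiWeight, Real.rpow_add_one h1.ne',
    Real.rpow_add_one h2.ne']
  ring

theorem jacobiWeight_add_one (α β : ℝ) {x : ℝ} (hx : x ∈ Set.Ioo (-1 : ℝ) 1) :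
    jacobiWeight (α + 1) (β + 1) x = (1 - x ^ 2) * jacobiWeight α β x := by
  have h1 : 0 < 1 - x := by linarith [hx.2]
  have h2 : 0 < 1 + x := by linarith [hx.1]
  simp only [jacobiWeight, Real.rpow_add_one h1.ne', Real.rpow_add_one h2.ne']
  ring

/-- The raising relation `(w P)' = -2 (n + 1) w P` between consecutive Jacobi weights. -/
theorem hasDerivAt_weight_mul_jacobiP {α β : ℝ} (hα : -1 < α) (hβ : -1 < β) (n : ℕ) {x : ℝ}
    (hx : x ∈ Set.Ioo (-1 : ℝ) 1) :
    HasDerivAt (fun x => jacobiWeight (α + 1) (β + 1) x * jacobiP (α + 1) (β + 1) n x)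
      (-2 * (n + 1) * (jacobiWeight α β x * jacobiP α β (n + 1) x)) x := by
  obtain ⟨D, hD, h⟩ := jacobiP_raising hα hβ n x
  refine ((hasDerivAt_jacobiWeight α β hx).mul hD).congr_deriv ?_
  rw [jacobiWeight_add_one α β hx]
  linear_combination jacobiWeight α β x * h

theorem jacobiWeight_pos (α β : ℝ) {x : ℝ} (hx : x ∈ Set.Ioo (-1 : ℝ) 1) :
    0 < jacobiWeight α β x :=
  mul_pos (Real.rpow_pos_of_pos (by linarith [hx.2]) _) (Real.rpow_pos_of_pos (by linarith [hx.1]) _)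

theorem jacobiWeight_neg (α β x : ℝ) : jacobiWeight α β (-x) = jacobiWeight β α x := by
  simp only [jacobiWeight, sub_neg_eq_add, mul_comm, ← sub_eq_add_neg]

/-- The raising relation recovers `P_(n+1)` from the derivative of the weight times `P_n` with
shifted parameters, so the symmetry passes from `n` to `n + 1`. Division by the weight restricts the
argument to the open interval. -/
theorem jacobiP_neg {α β : ℝ} (hα : -1 < α) (hβ : -1 < β) (n : ℕ) {x : ℝ}
    (hx : x ∈ Set.Ioo (-1 : ℝ) 1) : jacobiP α β n (-x) = (-1) ^ n * jacobiP β α n x := by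
  induction n generalizing α β x with
  | zero => simp [jacobiP_zero]
  | succ n ih =>
    have hx' : -x ∈ Set.Ioo (-1 : ℝ) 1 := ⟨by linarith [hx.2], by linarith [hx.1]⟩
    have h1 := (hasDerivAt_weight_mul_jacobiP hα hβ n hx').scomp x (hasDerivAt_neg x)
    have h2 := (hasDerivAt_weight_mul_jacobiP hβ hα n hx).const_mul ((-1 : ℝ) ^ n)
    have h3 := h1.unique (h2.congr_of_eventuallyEq (by
      filter_upwards [isOpen_Ioo.mem_nhds hx] with y hy
      simp only [Function.comp]
      rw [jacobiWeight_neg, ih (by linarith) (by linarith) hy]; ring))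
    rw [jacobiWeight_neg] at h3
    have hw := jacobiWeight_pos β α hx
    have hn : (n : ℝ) + 1 ≠ 0 := by positivity
    apply mul_left_cancel₀ hw.ne'
    apply mul_left_cancel₀ hn
    simp only [smul_eq_mul] at h3
    rw [pow_succ]
    linear_combination h3 / 2

/-! ### Power asymptotics with one-order error; quotients of Gamma functions. -/

/-- `u k = c k ^ p + O(k ^ (p - 1))`. -/
def AsympPow (u : ℕ → ℝ) (c p : ℝ) : Prop :=
  (fun k : ℕ => u k - c * (k : ℝ) ^ p) =O[atTop] fun k : ℕ => (k : ℝ) ^ (p - 1)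

theorem natCast_rpow_isBigO {p q : ℝ} (h : p ≤ q) :
    (fun k : ℕ => (k : ℝ) ^ p) =O[atTop] fun k : ℕ => (k : ℝ) ^ q := by
  refine IsBigO.of_bound 1 ?_
  filter_upwards [eventually_ge_atTop 1] with k hk
  have hk' : (1 : ℝ) ≤ k := by exact_mod_cast hk
  rw [one_mul, Real.norm_of_nonneg (by positivity), Real.norm_of_nonneg (by positivity)]
  exact Real.rpow_le_rpow_of_exponent_le hk' h

theorem isBigO_mul_rpow {u v : ℕ → ℝ} {p q r : ℝ} (hu : u =O[atTop] fun k : ℕ => (k : ℝ) ^ p)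
    (hv : v =O[atTop] fun k : ℕ => (k : ℝ) ^ q) (h : p + q ≤ r) :
    (fun k => u k * v k) =O[atTop] fun k : ℕ => (k : ℝ) ^ r := by
  refine ((hu.mul hv).congr' EventuallyEq.rfl ?_).trans (natCast_rpow_isBigO h)
  filter_upwards [eventually_ge_atTop 1] with k hk
  have hk' : (0 : ℝ) < k := by exact_mod_cast hk
  rw [Real.rpow_add hk']

theorem AsympPow.isBigO {u : ℕ → ℝ} {c p : ℝ} (h : AsympPow u c p) :
    u =O[atTop] fun k : ℕ => (k : ℝ) ^ p := by
  have h1 := h.trans (natCast_rpow_isBigO (show p - 1 ≤ p by linarith))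
  have h2 := (isBigO_refl (fun k : ℕ => (k : ℝ) ^ p) atTop).const_mul_left c
  simpa using h1.add h2

theorem AsympPow.mul {u v : ℕ → ℝ} {c d p q : ℝ} (hu : AsympPow u c p) (hv : AsympPow v d q) :
    AsympPow (fun k => u k * v k) (c * d) (p + q) := by
  have h1 := isBigO_mul_rpow hu hv.isBigO (r := p + q - 1) (by linarith)
  have h2 := isBigO_mul_rpow ((isBigO_refl (fun k : ℕ => (k : ℝ) ^ p) atTop).const_mul_left c) hv
    (r := p + q - 1) (by linarith)
  refine (h1.add h2).congr' ?_ EventuallyEq.rfl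
  filter_upwards [eventually_ge_atTop 1] with k hk
  have hk' : (0 : ℝ) < k := by exact_mod_cast hk
  rw [Real.rpow_add hk']
  ring

theorem AsympPow.const_mul {u : ℕ → ℝ} {c p : ℝ} (a : ℝ) (h : AsympPow u c p) :
    AsympPow (fun k => a * u k) (a * c) p := by
  refine (IsBigO.const_mul_left h a).congr_left fun k => ?_
  ring

theorem AsympPow.congr' {u v : ℕ → ℝ} {c p : ℝ} (h : AsympPow u c p) (huv : u =ᶠ[atTop] v) :
    AsympPow v c p := by
  refine IsBigO.congr' h ?_ EventuallyEq.rfl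
  filter_upwards [huv] with k hk
  rw [hk]

theorem asympPow_add_const (a : ℝ) : AsympPow (fun k => k + a) 1 1 := by
  simp only [AsympPow, Real.rpow_one, one_mul, add_sub_cancel_left, sub_self, Real.rpow_zero]
  exact isBigO_const_const a one_ne_zero _

theorem asympPow_inv_add_const (a : ℝ) : AsympPow (fun k => ((k : ℝ) + a)⁻¹) 1 (-1) := by
  refine IsBigO.of_bound (2 * |a|) ?_
  filter_upwards [eventually_ge_atTop (⌈2 * |a|⌉₊ + 1)] with k hk
  have h1 : 2 * |a| + 1 ≤ k := by
    have : (⌈2 * |a|⌉₊ : ℝ) + 1 ≤ k := by exact_mod_cast hk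
    linarith [Nat.le_ceil (2 * |a|)]
  have h0 : 0 < (k : ℝ) := by linarith [abs_nonneg a]
  have h2 : (k : ℝ) / 2 ≤ k + a := by linarith [neg_abs_le a]
  have h3 : 0 < (k : ℝ) + a := by linarith
  rw [one_mul, Real.rpow_neg_one, show (-1 - 1 : ℝ) = -(2 : ℕ) by norm_num,
    Real.rpow_neg h0.le, Real.rpow_natCast, Real.norm_eq_abs, Real.norm_of_nonneg (by positivity)]
  have : ((k : ℝ) + a)⁻¹ - (k : ℝ)⁻¹ = -a / ((k + a) * k) := by field_simp; ring
  rw [this, abs_div, abs_neg, abs_of_pos (by positivity : 0 < ((k : ℝ) + a) * k), ← div_eq_mul_inv]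
  rw [div_le_div_iff₀ (by positivity) (by positivity)]
  have : (k : ℝ) ^ 2 ≤ 2 * ((k + a) * k) := by nlinarith
  nlinarith [abs_nonneg a]

/-- Log-convexity of Gamma between `x` and `x + 1`. -/
theorem Gamma_add_le_rpow_mul {x a : ℝ} (hx : 0 < x) (ha : 0 ≤ a) (ha1 : a ≤ 1) :
    Real.Gamma (x + a) ≤ x ^ a * Real.Gamma x := by
  rcases ha.eq_or_lt with rfl | ha
  · simp
  rcases ha1.eq_or_lt with rfl | ha1
  · simp [Real.Gamma_add_one hx.ne']
  have h := Real.Gamma_mul_add_mul_le_rpow_Gamma_mul_rpow_Gamma (by linarith : 0 < x + 1) hx ha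
    (by linarith : 0 < 1 - a) (by ring)
  have hG := Real.Gamma_pos_of_pos hx
  rw [show a * (x + 1) + (1 - a) * x = x + a by ring, Real.Gamma_add_one hx.ne',
    Real.mul_rpow hx.le hG.le, mul_assoc, ← Real.rpow_add hG] at h
  simpa using h

/-- The upper bound applied from `x + a` with exponent `1 - a`, so that it arrives at `x + 1`. The
loss `x / (x + a)` is `1 - O(1 / x)`. -/
theorem le_Gamma_add {x a : ℝ} (hx : 0 < x) (ha : 0 ≤ a) (ha1 : a ≤ 1) :
    x ^ a * Real.Gamma x * (x / (x + a)) ≤ Real.Gamma (x + a) := by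
  have h := Gamma_add_le_rpow_mul (by linarith : 0 < x + a) (by linarith : 0 ≤ 1 - a) (by linarith)
  rw [show x + a + (1 - a) = x + 1 by ring, Real.Gamma_add_one hx.ne'] at h
  have hxa : 0 < x + a := by linarith
  have hG := Real.Gamma_pos_of_pos hxa
  have h3 : (x + a) ^ (1 - a) * x ^ a ≤ x + a := by
    calc (x + a) ^ (1 - a) * x ^ a ≤ (x + a) ^ (1 - a) * (x + a) ^ a := by gcongr; linarith
      _ = x + a := by rw [← Real.rpow_add hxa]; simp
  rw [mul_div_assoc', div_le_iff₀ hxa]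
  calc x ^ a * Real.Gamma x * x = x ^ a * (x * Real.Gamma x) := by ring
    _ ≤ x ^ a * ((x + a) ^ (1 - a) * Real.Gamma (x + a)) := by gcongr
    _ = Real.Gamma (x + a) * ((x + a) ^ (1 - a) * x ^ a) := by ring
    _ ≤ Real.Gamma (x + a) * (x + a) := by gcongr

theorem asympPow_Gamma_fract {a : ℝ} (ha : 0 ≤ a) (ha1 : a ≤ 1) :
    AsympPow (fun k => Real.Gamma (k + a) / Real.Gamma k) 1 a ∧
      AsympPow (fun k => Real.Gamma k / Real.Gamma (k + a)) 1 (-a) := by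
  constructor
  · refine IsBigO.of_bound 1 ?_
    filter_upwards [eventually_ge_atTop 1] with k hk
    have hk' : (0 : ℝ) < k := by exact_mod_cast hk
    have hG := Real.Gamma_pos_of_pos hk'
    have h1 := Gamma_add_le_rpow_mul hk' ha ha1
    have h2 := le_Gamma_add hk' ha ha1
    have hp : (k : ℝ) ^ a = k ^ (a - 1) * k := by
      rw [← Real.rpow_add_one hk'.ne']; congr 1; ring
    have hp0 : 0 < (k : ℝ) ^ (a - 1) := by positivity
    rw [one_mul, one_mul, Real.norm_eq_abs, Real.norm_of_nonneg hp0.le, abs_sub_comm, abs_of_nonneg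
      (by rw [sub_nonneg, div_le_iff₀ hG]; exact h1)]
    have h3 : (k : ℝ) ^ a * (k / (k + a)) ≤ Real.Gamma (k + a) / Real.Gamma k := by
      rw [le_div_iff₀ hG]; linarith
    have h4 : (k : ℝ) ^ a - k ^ a * (k / (k + a)) ≤ k ^ (a - 1) := by
      rw [hp]
      have : (k : ℝ) ^ (a - 1) * k - k ^ (a - 1) * k * (k / (k + a)) =
        k ^ (a - 1) * (a * (k / (k + a))) := by field_simp; ring
      rw [this]
      have h5 : (k : ℝ) / (k + a) ≤ 1 := by rw [div_le_one (by positivity)]; linarith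
      have h6 : a * (k / (k + a)) ≤ 1 := mul_le_one₀ ha1 (by positivity) h5
      nlinarith
    linarith
  · refine IsBigO.of_bound 1 ?_
    filter_upwards [eventually_ge_atTop 1] with k hk
    have hk' : (0 : ℝ) < k := by exact_mod_cast hk
    have hG := Real.Gamma_pos_of_pos (by positivity : (0 : ℝ) < k + a)
    have h1 := Gamma_add_le_rpow_mul hk' ha ha1
    have h2 := le_Gamma_add hk' ha ha1
    have hp : (k : ℝ) ^ (-a) = k ^ (-a - 1) * k := by
      rw [← Real.rpow_add_one hk'.ne']; congr 1; ring
    have hpp : (k : ℝ) ^ (-a) * k ^ a = 1 := by rw [← Real.rpow_add hk']; simp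
    have hp0 : 0 < (k : ℝ) ^ (-a - 1) := by positivity
    have hp1 : 0 < (k : ℝ) ^ (-a) := by positivity
    have h3 : (k : ℝ) ^ (-a) ≤ Real.Gamma k / Real.Gamma (k + a) := by
      rw [le_div_iff₀ hG]
      calc (k : ℝ) ^ (-a) * Real.Gamma (k + a) ≤ k ^ (-a) * (k ^ a * Real.Gamma k) := by gcongr
        _ = _ := by rw [← mul_assoc, hpp, one_mul]
    have h4 : Real.Gamma k / Real.Gamma (k + a) ≤ k ^ (-a) * ((k + a) / k) := by
      rw [div_le_iff₀ hG]
      have := mul_le_mul_of_nonneg_left h2 (by positivity : 0 ≤ (k : ℝ) ^ (-a) * ((k + a) / k))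
      refine le_trans (le_of_eq ?_) this
      have e : (k + a) / (k : ℝ) * (k / (k + a)) = 1 := by field_simp
      linear_combination (-(Real.Gamma k)) * hpp - (k : ℝ) ^ (-a) * k ^ a * Real.Gamma k * e
    have h5 : (k : ℝ) ^ (-a) * ((k + a) / k) - k ^ (-a) = k ^ (-a - 1) * a := by
      rw [hp]; field_simp; ring
    rw [one_mul, one_mul, Real.norm_eq_abs, Real.norm_of_nonneg hp0.le, abs_of_nonneg (by linarith)]
    nlinarith

theorem eventually_natCast_add_pos (a : ℝ) : ∀ᶠ k : ℕ in atTop, 0 < (k : ℝ) + a := by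
  filter_upwards [eventually_gt_atTop ⌈-a⌉₊] with k hk
  have : (⌈-a⌉₊ : ℝ) < k := by exact_mod_cast hk
  linarith [Nat.le_ceil (-a)]

/-- The functional equation moves `a` by one either way, which extends the case `0 ≤ a ≤ 1` to all
real `a`. Quotient and reciprocal are carried together so that any `Γ(k + a) / Γ(k + b)` is a
product of two known factors. -/
theorem asympPow_Gamma_shift {a : ℝ} (h : AsympPow (fun k => Real.Gamma (k + a) / Real.Gamma k) 1 a ∧
      AsympPow (fun k => Real.Gamma k / Real.Gamma (k + a)) 1 (-a)) :
    (AsympPow (fun k => Real.Gamma (k + (a + 1)) / Real.Gamma k) 1 (a + 1) ∧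
      AsympPow (fun k => Real.Gamma k / Real.Gamma (k + (a + 1))) 1 (-(a + 1))) ∧
    (AsympPow (fun k => Real.Gamma (k + (a - 1)) / Real.Gamma k) 1 (a - 1) ∧
      AsympPow (fun k => Real.Gamma k / Real.Gamma (k + (a - 1))) 1 (-(a - 1))) := by
  have e1 := eventually_natCast_add_pos a
  have e2 := eventually_natCast_add_pos (a - 1)
  refine ⟨⟨?_, ?_⟩, ?_, ?_⟩
  · have := h.1.mul (asympPow_add_const a)
    rw [mul_one] at this
    refine this.congr' ?_
    filter_upwards [e1] with k hk
    rw [← add_assoc, Real.Gamma_add_one hk.ne']; ring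
  · have := h.2.mul (asympPow_inv_add_const a)
    rw [mul_one, show -a + -1 = -(a + 1) by ring] at this
    refine this.congr' ?_
    filter_upwards [e1] with k hk
    rw [← add_assoc, Real.Gamma_add_one hk.ne']; field_simp
  · have := h.1.mul (asympPow_inv_add_const (a - 1))
    rw [mul_one, ← sub_eq_add_neg] at this
    refine this.congr' ?_
    filter_upwards [e2] with k hk
    rw [show (k : ℝ) + a = k + (a - 1) + 1 by ring, Real.Gamma_add_one hk.ne']; field_simp
  · have := h.2.mul (asympPow_add_const (a - 1))
    rw [mul_one, show -a + 1 = -(a - 1) by ring] at this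
    refine this.congr' ?_
    filter_upwards [e2] with k hk
    rw [show (k : ℝ) + a = k + (a - 1) + 1 by ring, Real.Gamma_add_one hk.ne']; field_simp

theorem asympPow_Gamma (a : ℝ) :
    AsympPow (fun k => Real.Gamma (k + a) / Real.Gamma k) 1 a ∧
      AsympPow (fun k => Real.Gamma k / Real.Gamma (k + a)) 1 (-a) := by
  have key : ∀ n : ℤ, AsympPow (fun k => Real.Gamma (k + (Int.fract a + n)) / Real.Gamma k) 1
      (Int.fract a + n) ∧ AsympPow (fun k => Real.Gamma k / Real.Gamma (k + (Int.fract a + n))) 1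
        (-(Int.fract a + n)) := by
    intro n
    induction n using Int.induction_on with
    | zero => simpa using asympPow_Gamma_fract (Int.fract_nonneg a) (Int.fract_lt_one a).le
    | succ n ih =>
      have := (asympPow_Gamma_shift ih).1
      push_cast at this ⊢
      rwa [add_assoc (Int.fract a)] at this
    | pred n ih =>
      have := (asympPow_Gamma_shift ih).2
      push_cast at this ⊢
      rwa [add_sub_assoc (Int.fract a)] at this
  simpa using key ⌊a⌋

theorem asympPow_Gamma_div (a b : ℝ) :
    AsympPow (fun k => Real.Gamma (k + a) / Real.Gamma (k + b)) 1 (a - b) := by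
  have := (asympPow_Gamma a).1.mul (asympPow_Gamma b).2
  rw [mul_one, ← sub_eq_add_neg] at this
  refine this.congr' ?_
  filter_upwards [eventually_ge_atTop 1] with k hk
  have hG := Real.Gamma_pos_of_pos (by exact_mod_cast hk : (0 : ℝ) < k)
  field_simp

/-- The reciprocal of the squared norm of the Jacobi polynomials. -/
theorem asympPow_inv_jacobiH (α β : ℝ) :
    AsympPow (fun k => (jacobiH α β k)⁻¹) (2 ^ (-(α + β))) 1 := by
  have h1 := asympPow_Gamma_div 1 (α + 1)
  have h2 := asympPow_Gamma_div (α + β + 1) (β + 1)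
  have h3 := (asympPow_add_const ((α + β + 1) / 2)).const_mul 2
  have h := ((h1.mul h2).mul h3).const_mul (2 ^ (-(α + β + 1)))
  rw [show (2 : ℝ) ^ (-(α + β + 1)) * (1 * 1 * (2 * 1)) = 2 ^ (-(α + β)) by
    rw [show -(α + β) = -(α + β + 1) + 1 by ring, Real.rpow_add_one two_ne_zero]; ring,
    show 1 - (α + 1) + (α + β + 1 - (β + 1)) + 1 = (1 : ℝ) by ring] at h
  refine h.congr' ?_
  filter_upwards [eventually_ge_atTop 1] with k hk
  rw [jacobiH, if_neg (by omega), Real.rpow_neg two_pos.le, inv_div]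
  rw [show (k : ℝ) + (α + 1) = k + α + 1 by ring, show (k : ℝ) + (α + β + 1) = k + α + β + 1 by ring,
    show (k : ℝ) + (β + 1) = k + β + 1 by ring]
  simp only [div_eq_mul_inv, mul_inv]
  ring

theorem asympPow_jacobiH (α β : ℝ) :
    AsympPow (fun k => jacobiH α β k) (2 ^ (α + β)) (-1) := by
  have h1 := asympPow_Gamma_div (α + 1) 1
  have h2 := asympPow_Gamma_div (β + 1) (α + β + 1)
  have h3 := (asympPow_inv_add_const ((α + β + 1) / 2)).const_mul (1 / 2)
  have h := ((h1.mul h2).mul h3).const_mul (2 ^ (α + β + 1))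
  rw [show (2 : ℝ) ^ (α + β + 1) * (1 * 1 * (1 / 2 * 1)) = 2 ^ (α + β) by
    rw [Real.rpow_add_one two_ne_zero]; ring,
    show α + 1 - 1 + (β + 1 - (α + β + 1)) + -1 = (-1 : ℝ) by ring] at h
  refine h.congr' ?_
  filter_upwards [eventually_ge_atTop 1] with k hk
  rw [jacobiH, if_neg (by omega)]
  rw [show (k : ℝ) + (α + 1) = k + α + 1 by ring, show (k : ℝ) + (α + β + 1) = k + α + β + 1 by ring,
    show (k : ℝ) + (β + 1) = k + β + 1 by ring,
    show (2 : ℝ) * k + α + β + 1 = 2 * (k + (α + β + 1) / 2) by ring]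
  simp only [div_eq_mul_inv, mul_inv, one_mul]
  ring

/-! ### Integration by parts against the Jacobi weight, and the norms. -/

theorem continuousOn_jacobiWeight_Icc {α β a b : ℝ} (ha : 0 ≤ α ∨ b < 1) (hb : 0 ≤ β ∨ -1 < a) :
    ContinuousOn (jacobiWeight α β) (Set.Icc a b) := by
  refine ContinuousOn.mul ?_ ?_
  · refine ContinuousOn.rpow_const (by fun_prop) fun x hx => ?_
    rcases ha with h | h
    · exact Or.inr h
    · exact Or.inl (by linarith [hx.2])
  · refine ContinuousOn.rpow_const (by fun_prop) fun x hx => ?_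
    rcases hb with h | h
    · exact Or.inr h
    · exact Or.inl (by linarith [hx.1])

theorem intervalIntegrable_one_sub_rpow {a : ℝ} (ha : -1 < a) (c d : ℝ) :
    IntervalIntegrable (fun x : ℝ => (1 - x) ^ a) MeasureTheory.volume c d := by
  have h := (intervalIntegral.intervalIntegrable_rpow' (a := 1 - c) (b := 1 - d) ha).comp_sub_left 1
  simpa using h

theorem intervalIntegrable_one_add_rpow {a : ℝ} (ha : -1 < a) (c d : ℝ) :
    IntervalIntegrable (fun x : ℝ => (1 + x) ^ a) MeasureTheory.volume c d := by
  have h := (intervalIntegral.intervalIntegrable_rpow' (a := 1 + c) (b := 1 + d) ha).comp_add_left 1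
  simpa using h

theorem intervalIntegrable_jacobiWeight {α β : ℝ} (hα : -1 < α) (hβ : -1 < β) :
    IntervalIntegrable (jacobiWeight α β) MeasureTheory.volume (-1) 1 := by
  refine IntervalIntegrable.trans (b := 0) ?_ ?_
  · refine (intervalIntegrable_one_add_rpow hβ (-1) 0).continuousOn_mul ?_
    rw [Set.uIcc_of_le (by norm_num)]
    exact ContinuousOn.rpow_const (by fun_prop) fun x hx => Or.inl (by linarith [hx.2])
  · refine (intervalIntegrable_one_sub_rpow hα 0 1).mul_continuousOn ?_
    rw [Set.uIcc_of_le (by norm_num)]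
    exact ContinuousOn.rpow_const (by fun_prop) fun x hx => Or.inl (by linarith [hx.1])

/-- The translation `y = 1 + x` turns this into a beta integral over `[0, 2]`. -/
theorem integral_jacobiWeight {α β : ℝ} (hα : -1 < α) (hβ : -1 < β) :
    ∫ x in (-1 : ℝ)..1, jacobiWeight α β x =
      2 ^ (α + β + 1) * Real.Gamma (α + 1) * Real.Gamma (β + 1) / Real.Gamma (α + β + 2) := by
  have h := Complex.betaIntegral_scaled ((β + 1 : ℝ) : ℂ) ((α + 1 : ℝ) : ℂ) (a := 2) two_pos
  rw [Complex.betaIntegral_eq_Gamma_mul_div _ _ (by simpa using by linarith)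
    (by simpa using by linarith)] at h
  have h2 : ∫ x in (-1 : ℝ)..1, jacobiWeight α β x =
      ∫ y in (0 : ℝ)..2, y ^ β * (2 - y) ^ α := by
    have := intervalIntegral.integral_comp_add_left (a := -1) (b := 1)
      (fun y : ℝ => y ^ β * (2 - y) ^ α) 1
    norm_num at this
    rw [← this]
    refine intervalIntegral.integral_congr fun x _ => ?_
    simp only [jacobiWeight]
    rw [mul_comm, show (1 : ℝ) - x = 2 - (1 + x) by ring]
  have h3 : ∫ x in (0 : ℝ)..2, (x : ℂ) ^ (((β + 1 : ℝ) : ℂ) - 1) *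
      (((2 : ℝ) : ℂ) - x) ^ (((α + 1 : ℝ) : ℂ) - 1) =
      ((∫ y in (0 : ℝ)..2, y ^ β * (2 - y) ^ α : ℝ) : ℂ) := by
    rw [← intervalIntegral.integral_ofReal]
    refine intervalIntegral.integral_congr fun x hx => ?_
    rw [Set.uIcc_of_le (by norm_num)] at hx
    rw [Complex.ofReal_mul, Complex.ofReal_cpow hx.1, Complex.ofReal_cpow (by linarith [hx.2])]
    push_cast
    congr 2 <;> ring
  rw [h3, ← h2] at h
  rw [← Complex.ofReal_add, ← Complex.ofReal_one, ← Complex.ofReal_sub, Complex.Gamma_ofReal,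
    Complex.Gamma_ofReal, Complex.Gamma_ofReal, ← Complex.ofReal_cpow two_pos.le,
    ← Complex.ofReal_mul, ← Complex.ofReal_div, ← Complex.ofReal_mul, Complex.ofReal_inj] at h
  rw [h, show β + 1 + (α + 1) - 1 = α + β + 1 by ring, show β + 1 + (α + 1) = α + β + 2 by ring]
  ring

/-- Product rule combined with the raising relation. The boundary terms are required only as limits,
since `f` may be singular at the endpoints; values in `E` cover real powers as well as complex
boundary values. -/
theorem integral_jacobi_by_parts {E : Type*} [NormedAddCommGroup E] [NormedSpace ℝ E]
    [CompleteSpace E] {α β : ℝ} (hα : -1 < α) (hβ : -1 < β) (n : ℕ) {f f' : ℝ → E}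
    (hf : ∀ x ∈ Set.Ioo (-1 : ℝ) 1, HasDerivAt f (f' x) x)
    (hi : IntervalIntegrable (fun x => (jacobiWeight α β x * jacobiP α β (n + 1) x) • f x)
      MeasureTheory.volume (-1) 1)
    (hi' : IntervalIntegrable
      (fun x => (jacobiWeight (α + 1) (β + 1) x * jacobiP (α + 1) (β + 1) n x) • f' x)
      MeasureTheory.volume (-1) 1)
    (hl : Tendsto (fun x => jacobiWeight (α + 1) (β + 1) x • f x) (𝓝[>] (-1)) (𝓝 0))
    (hr : Tendsto (fun x => jacobiWeight (α + 1) (β + 1) x • f x) (𝓝[<] 1) (𝓝 0)) :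
    ∫ x in (-1 : ℝ)..1, (jacobiWeight α β x * jacobiP α β (n + 1) x) • f x =
      (1 / (2 * (n + 1)) : ℝ) • ∫ x in (-1 : ℝ)..1,
        (jacobiWeight (α + 1) (β + 1) x * jacobiP (α + 1) (β + 1) n x) • f' x := by
  have hlim : ∀ (s : ℝ) (l : Filter ℝ), l ≤ 𝓝 s →
      Tendsto (fun x => jacobiWeight (α + 1) (β + 1) x • f x) l (𝓝 0) →
      Tendsto (fun x => (jacobiWeight (α + 1) (β + 1) x * jacobiP (α + 1) (β + 1) n x) • f x) l
        (𝓝 0) := by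
    intro s l hl h
    have := (((continuous_jacobiP (α + 1) (β + 1) n).tendsto s).mono_left hl).smul h
    simp only [smul_zero, smul_smul] at this
    exact this.congr fun x => by rw [mul_comm]
  have h := intervalIntegral.integral_eq_sub_of_hasDerivAt_of_tendsto
    (f := fun x => (jacobiWeight (α + 1) (β + 1) x * jacobiP (α + 1) (β + 1) n x) • f x)
    (f' := fun x => (jacobiWeight (α + 1) (β + 1) x * jacobiP (α + 1) (β + 1) n x) • f' x +
      (-2 * (n + 1) : ℝ) • (jacobiWeight α β x * jacobiP α β (n + 1) x) • f x)
    (by norm_num : (-1 : ℝ) < 1) (fun x hx => by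
      refine ((hasDerivAt_weight_mul_jacobiP hα hβ n hx).smul (hf x hx)).congr_deriv ?_
      rw [smul_smul])
    (hi'.add (hi.smul _)) (hlim _ _ nhdsWithin_le_nhds hl) (hlim _ _ nhdsWithin_le_nhds hr)
  have hadd := intervalIntegral.integral_add hi' (hi.smul (-2 * (n + 1) : ℝ))
  simp only [Pi.smul_apply] at hadd
  rw [hadd, intervalIntegral.integral_smul, sub_self] at h
  have h2 := eq_neg_of_add_eq_zero_left h
  rw [h2, ← neg_smul, smul_smul]
  have : (1 / (2 * (n + 1)) * -(-2 * ((n : ℝ) + 1))) = 1 := by field_simp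
  rw [show (1 / (2 * (n + 1)) * -(-2 * ((n : ℝ) + 1))) = 1 from this, one_smul]

theorem tendsto_jacobiWeight_smul {E : Type*} [NormedAddCommGroup E] [NormedSpace ℝ E]
    {α β : ℝ} (hα : -1 < α) (hβ : -1 < β) {f : ℝ → E}
    (hf : ContinuousOn f (Set.Icc (-1) 1)) :
    Tendsto (fun x => jacobiWeight (α + 1) (β + 1) x • f x) (𝓝[>] (-1)) (𝓝 0) ∧
      Tendsto (fun x => jacobiWeight (α + 1) (β + 1) x • f x) (𝓝[<] 1) (𝓝 0) := by
  have hw : ContinuousOn (jacobiWeight (α + 1) (β + 1)) (Set.Icc (-1) 1) :=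
    continuousOn_jacobiWeight_Icc (Or.inl (by linarith)) (Or.inl (by linarith))
  have h := hw.smul hf
  constructor
  · have h1 := h (-1) ⟨le_rfl, by norm_num⟩
    have h2 : jacobiWeight (α + 1) (β + 1) (-1) = 0 := by
      simp [jacobiWeight, Real.zero_rpow (by linarith : β + 1 ≠ 0)]
    simp only [ContinuousWithinAt, Pi.smul_apply', h2, zero_smul] at h1
    refine h1.mono_left ?_
    rw [← nhdsWithin_Ioo_eq_nhdsGT (by norm_num : (-1 : ℝ) < 1)]
    exact nhdsWithin_mono _ Set.Ioo_subset_Icc_self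
  · have h1 := h 1 ⟨by norm_num, le_rfl⟩
    have h2 : jacobiWeight (α + 1) (β + 1) 1 = 0 := by
      simp [jacobiWeight, Real.zero_rpow (by linarith : α + 1 ≠ 0)]
    simp only [ContinuousWithinAt, Pi.smul_apply', h2, zero_smul] at h1
    refine h1.mono_left ?_
    rw [← nhdsWithin_Ioo_eq_nhdsLT (by norm_num : (-1 : ℝ) < 1)]
    exact nhdsWithin_mono _ Set.Ioo_subset_Icc_self

theorem intervalIntegrable_jacobi_smul {E : Type*} [NormedAddCommGroup E] [NormedSpace ℝ E]
    {α β : ℝ} (hα : -1 < α) (hβ : -1 < β) (n : ℕ) {f : ℝ → E}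
    (hf : ContinuousOn f (Set.Icc (-1) 1)) :
    IntervalIntegrable (fun x => (jacobiWeight α β x * jacobiP α β n x) • f x)
      MeasureTheory.volume (-1) 1 := by
  simp_rw [mul_smul]
  refine (intervalIntegrable_jacobiWeight hα hβ).smul_continuousOn ?_
  rw [Set.uIcc_of_le (by norm_num)]
  exact (continuous_jacobiP α β n).continuousOn.smul hf

theorem integral_jacobi_by_parts_of_continuousOn {E : Type*} [NormedAddCommGroup E] [NormedSpace ℝ E]
    [CompleteSpace E] {α β : ℝ} (hα : -1 < α) (hβ : -1 < β) (n : ℕ)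
    {f f' : ℝ → E} (hf : ∀ x ∈ Set.Ioo (-1 : ℝ) 1, HasDerivAt f (f' x) x)
    (hc : ContinuousOn f (Set.Icc (-1) 1)) (hc' : ContinuousOn f' (Set.Icc (-1) 1)) :
    ∫ x in (-1 : ℝ)..1, (jacobiWeight α β x * jacobiP α β (n + 1) x) • f x =
      (1 / (2 * (n + 1)) : ℝ) • ∫ x in (-1 : ℝ)..1,
        (jacobiWeight (α + 1) (β + 1) x * jacobiP (α + 1) (β + 1) n x) • f' x :=
  integral_jacobi_by_parts hα hβ n hf (intervalIntegrable_jacobi_smul hα hβ _ hc)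
    (intervalIntegrable_jacobi_smul (by linarith) (by linarith) _ hc')
    (tendsto_jacobiWeight_smul hα hβ hc).1 (tendsto_jacobiWeight_smul hα hβ hc).2

/-- The recursion that one integration by parts imposes on the norm. Index `0` on the right is
treated apart because there `jacobiH` is given by the `Γ(α + β + 2)` form. -/
theorem jacobiH_succ {α β : ℝ} (hα : -1 < α) (hβ : -1 < β) (n : ℕ) :
    jacobiH α β (n + 1) = (n + α + β + 2) / (4 * (n + 1)) * jacobiH (α + 1) (β + 1) n := by
  have h2 : (2 : ℝ) ^ (α + 1 + (β + 1) + 1) = 4 * 2 ^ (α + β + 1) := by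
    rw [show α + 1 + (β + 1) + 1 = α + β + 1 + (2 : ℕ) by push_cast; ring,
      Real.rpow_add_natCast two_ne_zero]
    ring
  rw [jacobiH, if_neg (Nat.succ_ne_zero n), jacobiH]
  have hn : (0 : ℝ) ≤ n := n.cast_nonneg
  have e1 : Real.Gamma (n + α + β + 3) = (n + α + β + 2) * Real.Gamma (n + α + β + 2) := by
    rw [← Real.Gamma_add_one (by linarith)]; congr 1; ring
  have hG := Real.Gamma_pos_of_pos (by linarith : 0 < n + α + β + 2)
  have p1 : 0 < (n : ℝ) + α + β + 2 := by linarith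
  split_ifs with h0
  · subst h0
    have e2 : Real.Gamma (α + 1 + (β + 1) + 2) = (α + β + 3) * Real.Gamma (α + β + 3) := by
      rw [← Real.Gamma_add_one (by linarith)]; congr 1; ring
    rw [e2, h2]
    simp only [CharP.cast_eq_zero, zero_add, Nat.cast_one] at *
    rw [e1]
    rw [show 1 + α + 1 = α + 1 + 1 by ring, show 1 + β + 1 = β + 1 + 1 by ring,
      show 1 + α + β + 1 = α + β + 2 by ring]
    norm_num
    have p2 : 0 < α + β + 3 := by linarith
    rw [show 2 + α + β + 1 = α + β + 3 by ring]
    field_simp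
  · have e3 : Real.Gamma ((n : ℝ) + 1 + 1) = (n + 1) * Real.Gamma (n + 1) :=
      Real.Gamma_add_one (by positivity)
    rw [h2]
    push_cast
    rw [e3, show (n : ℝ) + (α + 1) + (β + 1) + 1 = n + α + β + 3 by ring, e1,
      show (n : ℝ) + 1 + α + β + 1 = n + α + β + 2 by ring,
      show (n : ℝ) + (α + 1) + 1 = n + 1 + α + 1 by ring,
      show (n : ℝ) + (β + 1) + 1 = n + 1 + β + 1 by ring,
      show 2 * (n : ℝ) + (α + 1) + (β + 1) + 1 = 2 * (n + 1) + α + β + 1 by ring]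
    have hG2 := Real.Gamma_pos_of_pos (by linarith : 0 < (n : ℝ) + 1)
    have p2 : 0 < 2 * ((n : ℝ) + 1) + α + β + 1 := by linarith
    field_simp

/-- One integration by parts of `P_(n+1)` against itself reproduces the same integral for `P_n` with
raised parameters, down to the beta integral at `n = 0`. -/
theorem jacobiInner_self {α β : ℝ} (hα : -1 < α) (hβ : -1 < β) (n : ℕ) :
    jacobiInner α β (jacobiP α β n) (jacobiP α β n) = jacobiH α β n := by
  induction n generalizing α β with
  | zero => simpa [jacobiInner, jacobiP_zero, jacobiH] using integral_jacobiWeight hα hβ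
  | succ n ih =>
    have h := integral_jacobi_by_parts_of_continuousOn hα hβ n
      (fun x _ => hasDerivAt_jacobiP β hα n x) (continuous_jacobiP α β (n + 1)).continuousOn
      ((continuous_const.mul (continuous_jacobiP (α + 1) (β + 1) n)).continuousOn)
    have h1 := ih (by linarith : -1 < α + 1) (by linarith : -1 < β + 1)
    rw [jacobiH_succ hα hβ, ← h1]
    simp only [jacobiInner, smul_eq_mul] at h ⊢
    calc _ = ∫ x in (-1 : ℝ)..1, jacobiWeight α β x * jacobiP α β (n + 1) x *
          jacobiP α β (n + 1) x := by
          refine intervalIntegral.integral_congr fun x _ => ?_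
          ring
      _ = _ := by
        rw [h, ← intervalIntegral.integral_const_mul, ← intervalIntegral.integral_const_mul]
        refine intervalIntegral.integral_congr fun x _ => ?_
        field_simp
        ring

/-! ### Decay of the coefficients of smooth functions. -/

/-- Since `|P| ≤ 1 + P²`, the integral is at most the mass of the weight plus the squared norm, and
the latter is `O(1 / n)`. -/
theorem exists_bound_integral_abs_jacobiP {α β : ℝ} (hα : -1 < α) (hβ : -1 < β) :
    ∃ C, ∀ n, ∫ x in (-1 : ℝ)..1, jacobiWeight α β x * |jacobiP α β n x| ≤ C := by
  have h1 : (fun k => jacobiH α β k) =O[atTop] fun _ : ℕ => (1 : ℝ) := by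
    have := (asympPow_jacobiH α β).isBigO.trans (natCast_rpow_isBigO (by norm_num : (-1 : ℝ) ≤ 0))
    simpa using this
  obtain ⟨C, hC⟩ := isBigO_one_nat_atTop_iff.1 h1
  refine ⟨(∫ x in (-1 : ℝ)..1, jacobiWeight α β x) + C, fun n => ?_⟩
  have hi1 := intervalIntegrable_jacobiWeight hα hβ
  have hi2 := hi1.mul_continuousOn (continuous_jacobiP α β n).abs.continuousOn
  have hi3 := hi1.mul_continuousOn ((continuous_jacobiP α β n).mul (continuous_jacobiP α β n)).continuousOn
  simp only [Pi.mul_apply] at hi3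
  have h3 : ∫ x in (-1 : ℝ)..1, jacobiWeight α β x * |jacobiP α β n x| ≤
      ∫ x in (-1 : ℝ)..1,
        (jacobiWeight α β x + jacobiWeight α β x * (jacobiP α β n x * jacobiP α β n x)) := by
    refine intervalIntegral.integral_mono_on (by norm_num) hi2 (hi1.add hi3) fun x hx => ?_
    have hw : 0 ≤ jacobiWeight α β x := mul_nonneg
      (Real.rpow_nonneg (by linarith [hx.2]) _) (Real.rpow_nonneg (by linarith [hx.1]) _)
    rw [← mul_one_add, ← abs_mul_abs_self (jacobiP α β n x)]
    refine mul_le_mul_of_nonneg_left ?_ hw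
    nlinarith [abs_nonneg (jacobiP α β n x), sq_nonneg (|jacobiP α β n x| - 1)]
  rw [intervalIntegral.integral_add hi1 hi3] at h3
  have h4 := (le_abs_self _).trans (hC n)
  rw [← jacobiInner_self hα hβ] at h4
  refine h3.trans (add_le_add le_rfl (le_trans (le_of_eq ?_) h4))
  refine intervalIntegral.integral_congr fun x _ => ?_
  ring

/-- Integrating by parts `m` times lowers the degree from `k + m` to `k` and gains a factor at most
`1 / k` each time; the `L¹` bound for the raised parameters finishes. The rate is crude, but `m` is
at free disposal. -/
theorem exists_bound_integral_contDiffOn {α β : ℝ} (hα : -1 < α) (hβ : -1 < β) (m : ℕ) {f : ℝ → ℝ}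
    (hf : ContDiffOn ℝ m f (Set.Icc (-1) 1)) :
    ∃ C, ∀ k : ℕ, (k : ℝ) ^ m *
      |∫ x in (-1 : ℝ)..1, jacobiWeight α β x * jacobiP α β (k + m) x * f x| ≤ C := by
  induction m generalizing α β f with
  | zero =>
    have hc : ContinuousOn f (Set.Icc (-1) 1) := hf.continuousOn
    obtain ⟨M, hM⟩ := isCompact_Icc.exists_bound_of_continuousOn hc
    obtain ⟨C, hC⟩ := exists_bound_integral_abs_jacobiP hα hβ
    refine ⟨C * M, fun k => ?_⟩
    have hM0 : 0 ≤ M := (norm_nonneg _).trans (hM 0 (by norm_num))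
    have hi : IntervalIntegrable (fun x => jacobiWeight α β x * |jacobiP α β k x| * M)
        MeasureTheory.volume (-1) 1 :=
      ((intervalIntegrable_jacobiWeight hα hβ).mul_continuousOn
        (continuous_jacobiP α β k).abs.continuousOn).mul_const M
    have h2 := intervalIntegral.norm_integral_le_of_norm_le (μ := MeasureTheory.volume)
      (f := fun x => jacobiWeight α β x * jacobiP α β k x * f x) (by norm_num : (-1 : ℝ) ≤ 1)
      (Eventually.of_forall fun x hx => by
        have hw : 0 ≤ jacobiWeight α β x := mul_nonneg
          (Real.rpow_nonneg (by linarith [hx.2]) _) (Real.rpow_nonneg (by linarith [hx.1]) _)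
        rw [norm_mul, norm_mul, Real.norm_of_nonneg hw, Real.norm_eq_abs (jacobiP α β k x)]
        exact mul_le_mul_of_nonneg_left (hM x ⟨hx.1.le, hx.2⟩) (by positivity)) hi
    rw [intervalIntegral.integral_mul_const] at h2
    simpa using h2.trans (mul_le_mul_of_nonneg_right (hC k) hM0)
  | succ m ih =>
    have hu : UniqueDiffOn ℝ (Set.Icc (-1 : ℝ) 1) := uniqueDiffOn_Icc (by norm_num)
    have h1 : (1 : WithTop ℕ∞) ≤ ((m + 1 : ℕ) : WithTop ℕ∞) := by exact_mod_cast Nat.le_add_left 1 m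
    have hd : ∀ x ∈ Set.Ioo (-1 : ℝ) 1,
        HasDerivAt f (derivWithin f (Set.Icc (-1) 1) x) x := fun x hx =>
      ((hf.differentiableOn (by exact_mod_cast Nat.succ_ne_zero m) x
        (Set.Ioo_subset_Icc_self hx)).hasDerivWithinAt).hasDerivAt (Icc_mem_nhds hx.1 hx.2)
    have hf' : ContDiffOn ℝ m (derivWithin f (Set.Icc (-1) 1)) (Set.Icc (-1) 1) :=
      hf.derivWithin hu (by norm_cast)
    obtain ⟨C, hC⟩ := ih (by linarith : -1 < α + 1) (by linarith : -1 < β + 1) hf'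
    refine ⟨C, fun k => le_trans ?_ (hC k)⟩
    have h := integral_jacobi_by_parts_of_continuousOn hα hβ (k + m) hd hf.continuousOn
      hf'.continuousOn
    simp only [smul_eq_mul] at h
    rw [← add_assoc, h, abs_mul, abs_of_nonneg (by positivity), pow_succ, mul_assoc, ← mul_assoc (k : ℝ)]
    refine mul_le_mul_of_nonneg_left ?_ (by positivity)
    refine mul_le_of_le_one_left (abs_nonneg _) ?_
    rw [mul_one_div, div_le_one (by positivity)]
    push_cast
    linarith [(k.cast_nonneg : (0 : ℝ) ≤ k), (m.cast_nonneg : (0 : ℝ) ≤ m)]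

theorem jacobiCoeff_eq (α β : ℝ) (f : ℝ → ℝ) (k : ℕ) :
    jacobiCoeff α β f k =
      (∫ x in (-1 : ℝ)..1, jacobiWeight α β x * jacobiP α β k x * f x) * (jacobiH α β k)⁻¹ := by
  rw [jacobiCoeff, jacobiInner, div_eq_mul_inv]
  congr 1
  refine intervalIntegral.integral_congr fun x _ => ?_
  ring

theorem jacobiCoeff_isBigO_of_contDiffOn {α β : ℝ} (hα : -1 < α) (hβ : -1 < β) (m : ℕ) {f : ℝ → ℝ}
    (hf : ContDiffOn ℝ m f (Set.Icc (-1) 1)) :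
    (fun k => jacobiCoeff α β f k) =O[atTop] fun k : ℕ => (k : ℝ) ^ (1 - m : ℝ) := by
  simp only [jacobiCoeff_eq]
  obtain ⟨C, hC⟩ := exists_bound_integral_contDiffOn hα hβ m hf
  refine isBigO_mul_rpow (p := -(m : ℝ)) ?_ (asympPow_inv_jacobiH α β).isBigO (by linarith)
  refine IsBigO.of_bound (C * 2 ^ m) ?_
  -- With `k = j + m` this makes `k ≤ 2 j`, hence the factor `2 ^ m` when `j ^ m` replaces `k ^ m`.
  filter_upwards [eventually_ge_atTop (2 * m + 1)] with k hk
  obtain ⟨j, rfl⟩ : ∃ j, k = j + m := ⟨k - m, by omega⟩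
  have hj : (m : ℝ) + 1 ≤ j := by exact_mod_cast (by omega : m + 1 ≤ j)
  have hm : (0 : ℝ) ≤ m := m.cast_nonneg
  have h := hC j
  have hp : 0 < ((j + m : ℕ) : ℝ) := by push_cast; linarith
  have hj0 : 0 < (j : ℝ) := by linarith
  rw [Real.rpow_neg hp.le, Real.rpow_natCast, Real.norm_of_nonneg (by positivity : 0 ≤ (((j + m : ℕ) : ℝ) ^ m)⁻¹),
    ← div_eq_mul_inv, le_div_iff₀ (by positivity), Real.norm_eq_abs]
  set I := |∫ x in (-1 : ℝ)..1, jacobiWeight α β x * jacobiP α β (j + m) x * f x|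
  have hI : 0 ≤ I := abs_nonneg _
  calc I * ((j + m : ℕ) : ℝ) ^ m ≤ I * (2 * j) ^ m := by
        gcongr
        push_cast; linarith
    _ = (j : ℝ) ^ m * I * 2 ^ m := by rw [mul_pow]; ring
    _ ≤ C * 2 ^ m := by gcongr

/-! ### Exact coefficients of endpoint powers and the right endpoint. -/

theorem jacobiWeight_mul_one_sub_rpow (α β s : ℝ) {x : ℝ} (hx : x ∈ Set.Ioo (-1 : ℝ) 1) :
    jacobiWeight α β x * (1 - x) ^ s = jacobiWeight (α + s) β x := by
  have h1 : 0 < 1 - x := by linarith [hx.2]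
  simp only [jacobiWeight, Real.rpow_add h1]
  ring

theorem intervalIntegrable_one_sub_rpow_jacobi {α β s : ℝ} (hs : -1 < α + s) (hβ : -1 < β) (n : ℕ)
    {f : ℝ → ℝ} (hf : ContinuousOn f (Set.Icc (-1) 1)) :
    IntervalIntegrable (fun x => (jacobiWeight α β x * jacobiP α β n x) * ((1 - x) ^ s * f x))
      MeasureTheory.volume (-1) 1 := by
  have h : IntervalIntegrable (fun x => jacobiWeight (α + s) β x * (jacobiP α β n x * f x))
      MeasureTheory.volume (-1) 1 := by
    refine (intervalIntegrable_jacobiWeight hs hβ).mul_continuousOn ?_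
    rw [Set.uIcc_of_le (by norm_num)]
    exact (continuous_jacobiP α β n).continuousOn.mul hf
  refine h.congr_uIoo fun x hx => ?_
  rw [Set.uIoo_of_le (by norm_num)] at hx
  simp only [← jacobiWeight_mul_one_sub_rpow α β s hx]
  ring

/-- Each integration by parts lowers `s` and raises `α` and `β` by one. The sum `α + s` is
invariant, so integrability at `1` persists, and the last integral is a beta integral with exponents
`α + s` and `β + n`. -/
theorem integral_jacobi_one_sub_rpow {α β s : ℝ} (hα : -1 < α) (hβ : -1 < β) (hs : -1 < α + s)
    (n : ℕ) :
    ∫ x in (-1 : ℝ)..1, jacobiWeight α β x * jacobiP α β n x * (1 - x) ^ s =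
      (ascPochhammer ℝ n).eval (-s) / (2 ^ n * n.factorial) *
        (2 ^ (s + α + β + n + 1) * Real.Gamma (s + α + 1) * Real.Gamma (n + β + 1) /
          Real.Gamma (n + s + α + β + 2)) := by
  induction n generalizing α β s with
  | zero =>
    have h := integral_jacobiWeight hs hβ
    have h2 : ∫ x in (-1 : ℝ)..1, jacobiWeight α β x * jacobiP α β 0 x * (1 - x) ^ s =
        ∫ x in (-1 : ℝ)..1, jacobiWeight (α + s) β x := by
      refine intervalIntegral.integral_congr_Ioo_of_le (by norm_num) fun x hx => ?_
      simp only [jacobiP_zero, mul_one, jacobiWeight_mul_one_sub_rpow α β s hx]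
    rw [h2, h]
    simp [add_comm s α]
  | succ n ih =>
    have hi := intervalIntegrable_one_sub_rpow_jacobi hs hβ (n + 1) (f := fun _ => 1)
      continuousOn_const
    have hi' := intervalIntegrable_one_sub_rpow_jacobi (α := α + 1) (β := β + 1) (s := s - 1)
      (by linarith) (by linarith) n (f := fun _ => -s) continuousOn_const
    simp only [mul_one] at hi
    -- For `s < 0` the power is unbounded at `1`; absorbing it into the weight gives exponents `α +
    -- s + 1` and `β + 1`, both positive, so the boundary terms vanish.
    have hlim := tendsto_jacobiWeight_smul (E := ℝ) (α := α + s) hs hβ (f := fun _ => 1)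
      continuousOn_const
    have hev : ∀ x ∈ Set.Ioo (-1 : ℝ) 1, jacobiWeight (α + s + 1) (β + 1) x • (1 : ℝ) =
        jacobiWeight (α + 1) (β + 1) x • (1 - x) ^ s := by
      intro x hx
      rw [smul_eq_mul, smul_eq_mul, jacobiWeight_mul_one_sub_rpow _ _ _ hx, mul_one]
      congr 1; ring
    have h := integral_jacobi_by_parts hα hβ n (f := fun x => (1 - x) ^ s)
      (f' := fun x => (1 - x) ^ (s - 1) * -s) (fun x hx => by
        have h1 : 0 < 1 - x := by linarith [hx.2]
        refine (((hasDerivAt_id x).const_sub 1).rpow_const (p := s) (Or.inl h1.ne')).congr_deriv ?_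
        simp only [id]; ring) hi hi'
      (hlim.1.congr' (by
        filter_upwards [Ioo_mem_nhdsGT (by norm_num : (-1 : ℝ) < 1)] with x hx using hev x hx))
      (hlim.2.congr' (by
        filter_upwards [Ioo_mem_nhdsLT (by norm_num : (-1 : ℝ) < 1)] with x hx using hev x hx))
    simp only [smul_eq_mul] at h
    have h3 := ih (α := α + 1) (β := β + 1) (s := s - 1) (by linarith) (by linarith) (by linarith)
    simp only [← mul_assoc] at h
    rw [h, intervalIntegral.integral_mul_const, h3, ascPochhammer_eval_succ_left,
      Nat.factorial_succ, pow_succ]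
    push_cast
    rw [show -(s - 1) = -s + 1 by ring,
      show s - 1 + (α + 1) + (β + 1) + n + 1 = s + α + β + (n + 1) + 1 by ring,
      show s - 1 + (α + 1) + 1 = s + α + 1 by ring,
      show (n : ℝ) + (β + 1) + 1 = n + 1 + β + 1 by ring,
      show (n : ℝ) + (s - 1) + (α + 1) + (β + 1) + 2 = n + 1 + s + α + β + 2 by ring]
    field_simp

theorem ascPochhammer_eval_eq_Gamma_div {x : ℝ} (hx : ∀ m : ℕ, x ≠ -m) (n : ℕ) :
    (ascPochhammer ℝ n).eval x = Real.Gamma (n + x) / Real.Gamma x := by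
  have h0 : Real.Gamma x ≠ 0 := Real.Gamma_ne_zero hx
  induction n with
  | zero => simp [h0]
  | succ n ih =>
    have h1 : (n : ℝ) + x ≠ 0 := fun h => hx n (by linarith)
    rw [ascPochhammer_succ_eval, ih]
    push_cast
    rw [show (n : ℝ) + 1 + x = n + x + 1 by ring, Real.Gamma_add_one h1]
    ring

/-- Non-integrality of `s` allows `(-s)_k` to be written as `Γ(k - s) / Γ(-s)`. What depends on `k`
is then two Gamma quotients and `1 / h_k`, with powers `-s - 1`, `-(s + α + 1)` and `1`. -/
theorem asympPow_jacobiCoeff_one_sub_rpow {α β s : ℝ} (hα : -1 < α) (hβ : -1 < β) (hs : -1 < α + s)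
    (hsn : ∀ m : ℤ, s ≠ m) :
    AsympPow (fun k => jacobiCoeff α β (fun x => (1 - x) ^ s) k)
      (2 ^ (s + 1) * Real.Gamma (s + α + 1) / Real.Gamma (-s)) (-(2 * s + α + 1)) := by
  have h1 := asympPow_Gamma_div (-s) 1
  have h2 := asympPow_Gamma_div (β + 1) (s + α + β + 2)
  have h := ((h1.mul h2).const_mul (2 ^ (s + α + β + 1) * Real.Gamma (s + α + 1) /
    Real.Gamma (-s))).mul (asympPow_inv_jacobiH α β)
  have e : (2 : ℝ) ^ (s + α + β + 1) * 2 ^ (-(α + β)) = 2 ^ (s + 1) := by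
    rw [← Real.rpow_add two_pos]; congr 1; ring
  rw [show -s - 1 + (β + 1 - (s + α + β + 2)) + 1 = -(2 * s + α + 1) by ring,
    show 2 ^ (s + α + β + 1) * Real.Gamma (s + α + 1) / Real.Gamma (-s) * (1 * 1) * 2 ^ (-(α + β)) =
      2 ^ (s + 1) * Real.Gamma (s + α + 1) / Real.Gamma (-s) by rw [← e]; ring] at h
  refine h.congr' (Eventually.of_forall fun k => ?_)
  simp only [jacobiCoeff_eq]
  rw [integral_jacobi_one_sub_rpow hα hβ hs, ascPochhammer_eval_eq_Gamma_div
    (fun m hm => hsn m (by push_cast; linarith)), Real.Gamma_nat_eq_factorial,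
    show s + α + β + k + 1 = s + α + β + 1 + k by ring, Real.rpow_add_natCast two_ne_zero,
    show (k : ℝ) + (β + 1) = k + β + 1 by ring,
    show (k : ℝ) + (s + α + β + 2) = k + s + α + β + 2 by ring]
  have : (k.factorial : ℝ) ≠ 0 := by positivity
  field_simp

theorem HasJacobiCoeffs.congr {α β : ℝ} {f g : ℝ → ℝ} (hf : HasJacobiCoeffs α β f)
    (h : Set.EqOn f g (Set.Ioo (-1) 1)) : HasJacobiCoeffs α β g := fun k =>
  (hf k).congr_uIoo fun x hx => by
    rw [Set.uIoo_of_le (by norm_num)] at hx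
    simp only [h hx]

theorem jacobiCoeff_congr (α β : ℝ) {f g : ℝ → ℝ} (h : Set.EqOn f g (Set.Ioo (-1) 1)) (k : ℕ) :
    jacobiCoeff α β f k = jacobiCoeff α β g k := by
  simp only [jacobiCoeff, jacobiInner]
  congr 1
  refine intervalIntegral.integral_congr_Ioo_of_le (by norm_num) fun x hx => ?_
  simp only [h hx]

theorem HasJacobiCoeffs.const_mul {α β : ℝ} {f : ℝ → ℝ} (hf : HasJacobiCoeffs α β f) (c : ℝ) :
    HasJacobiCoeffs α β fun x => c * f x := fun k =>
  ((hf k).const_mul c).congr_uIoo fun x _ => by ring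

theorem jacobiCoeff_const_mul (α β : ℝ) (f : ℝ → ℝ) (c : ℝ) (k : ℕ) :
    jacobiCoeff α β (fun x => c * f x) k = c * jacobiCoeff α β f k := by
  simp only [jacobiCoeff, jacobiInner, mul_assoc, intervalIntegral.integral_const_mul, mul_div_assoc]

theorem HasJacobiCoeffs.add {α β : ℝ} {f g : ℝ → ℝ} (hf : HasJacobiCoeffs α β f)
    (hg : HasJacobiCoeffs α β g) : HasJacobiCoeffs α β fun x => f x + g x := fun k =>
  ((hf k).add (hg k)).congr_uIoo fun x _ => by ring

theorem jacobiCoeff_add {α β : ℝ} {f g : ℝ → ℝ} (hf : HasJacobiCoeffs α β f)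
    (hg : HasJacobiCoeffs α β g) (k : ℕ) :
    jacobiCoeff α β (fun x => f x + g x) k = jacobiCoeff α β f k + jacobiCoeff α β g k := by
  simp only [jacobiCoeff, jacobiInner, add_mul, ← add_div]
  rw [intervalIntegral.integral_add (hf k) (hg k)]

theorem HasJacobiCoeffs.sum {α β : ℝ} {ι : Type*} (s : Finset ι) {f : ι → ℝ → ℝ}
    (hf : ∀ i ∈ s, HasJacobiCoeffs α β (f i)) :
    HasJacobiCoeffs α β fun x => ∑ i ∈ s, f i x := fun k => by
  have h := IntervalIntegrable.sum s (fun i hi => hf i hi k)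
  refine h.congr_uIoo fun x _ => ?_
  simp [Finset.sum_mul]

theorem jacobiCoeff_sum {α β : ℝ} {ι : Type*} (s : Finset ι) {f : ι → ℝ → ℝ}
    (hf : ∀ i ∈ s, HasJacobiCoeffs α β (f i)) (k : ℕ) :
    jacobiCoeff α β (fun x => ∑ i ∈ s, f i x) k = ∑ i ∈ s, jacobiCoeff α β (f i) k := by
  simp only [jacobiCoeff, jacobiInner, Finset.sum_mul, ← Finset.sum_div]
  rw [intervalIntegral.integral_finsetSum (fun i hi => hf i hi k)]

theorem hasJacobiCoeffs_one_sub_rpow_mul {α β s : ℝ} (hs : -1 < α + s) (hβ : -1 < β) {f : ℝ → ℝ}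
    (hf : ContinuousOn f (Set.Icc (-1) 1)) :
    HasJacobiCoeffs α β fun x => (1 - x) ^ s * f x := fun k =>
  (intervalIntegrable_one_sub_rpow_jacobi hs hβ k hf).congr_uIoo fun x _ => by ring

theorem analyticOnNhd_dslope {g : ℝ → ℝ} {s : Set ℝ} {ξ : ℝ} (hξ : ξ ∈ s)
    (hg : AnalyticOnNhd ℝ g s) : AnalyticOnNhd ℝ (dslope g ξ) s := by
  intro x hx
  rcases eq_or_ne x ξ with rfl | hne
  · obtain ⟨p, hp⟩ := hg x hx
    exact ⟨_, hp.has_fpower_series_dslope_fslope⟩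
  · have h : AnalyticAt ℝ (fun y => (y - ξ)⁻¹ * (g y - g ξ)) x :=
      ((analyticAt_id.sub analyticAt_const).inv (by simpa [sub_eq_zero] using hne)).mul
        ((hg x hx).sub analyticAt_const)
    refine h.congr ?_
    filter_upwards [isOpen_ne.mem_nhds hne] with y hy
    rw [dslope_of_ne _ hy, slope_def_module, smul_eq_mul]

/-- Iterated divided differences at `ξ`. Unlike a local power series, this gives a remainder factor
`r` analytic on all of `s`. -/
theorem exists_taylor_expansion {g : ℝ → ℝ} {s : Set ℝ} {ξ : ℝ} (hξ : ξ ∈ s)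
    (hg : AnalyticOnNhd ℝ g s) (N : ℕ) :
    ∃ (c : ℕ → ℝ) (r : ℝ → ℝ), AnalyticOnNhd ℝ r s ∧ c 0 = g ξ ∧
      ∀ x, g x = ∑ j ∈ Finset.range N, c j * (x - ξ) ^ j + (x - ξ) ^ N * r x := by
  induction N generalizing g with
  | zero => exact ⟨fun _ => g ξ, g, hg, rfl, fun x => by simp⟩
  | succ N ih =>
    obtain ⟨c, r, hr, -, h⟩ := ih (analyticOnNhd_dslope hξ hg)
    refine ⟨fun j => Nat.casesOn j (g ξ) c, r, hr, rfl, fun x => ?_⟩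
    have h1 : (x - ξ) * dslope g ξ x = g x - g ξ := by
      simpa using sub_smul_dslope g ξ x
    rw [Finset.sum_range_succ']
    simp only [pow_zero, mul_one]
    rw [h x] at h1
    have h2 : ∑ j ∈ Finset.range N, c j * (x - ξ) ^ (j + 1) =
      (x - ξ) * ∑ j ∈ Finset.range N, c j * (x - ξ) ^ j := by
      rw [Finset.mul_sum]
      exact Finset.sum_congr rfl fun j _ => by ring
    rw [h2]
    linear_combination -h1

theorem AsympPow.isBigO_one_div {u : ℕ → ℝ} {c p q : ℝ} (h : AsympPow u c (-p)) (hq : q = p + 1) :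
    (fun k : ℕ => u k - c / (k : ℝ) ^ p) =O[atTop] fun k : ℕ => 1 / (k : ℝ) ^ q := by
  refine IsBigO.congr_left (IsBigO.congr_right h fun k => ?_) fun k => ?_
  · rw [hq, one_div, ← Real.rpow_neg k.cast_nonneg]; congr 1; ring
  · rw [Real.rpow_neg k.cast_nonneg, div_eq_mul_inv]

theorem AsympPow.add_isBigO {u v : ℕ → ℝ} {c p q : ℝ} (h : AsympPow u c p)
    (hv : v =O[atTop] fun k : ℕ => (k : ℝ) ^ q) (hq : q ≤ p - 1) :
    AsympPow (fun k => u k + v k) c p := by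
  refine (IsBigO.add h (hv.trans (natCast_rpow_isBigO hq))).congr_left fun k => ?_
  ring

theorem contDiffOn_one_sub_rpow_mul {p : ℝ} {m : ℕ} (hp : (m : ℝ) ≤ p) {r : ℝ → ℝ}
    (hr : AnalyticOnNhd ℝ r (Set.Icc (-1) 1)) :
    ContDiffOn ℝ m (fun x => (1 - x) ^ p * r x) (Set.Icc (-1) 1) := by
  have h1 : ContDiff ℝ m fun x : ℝ => (1 - x) ^ p :=
    (Real.contDiff_rpow_const_of_le hp).comp (contDiff_const.sub contDiff_id)
  exact h1.contDiffOn.mul (hr.contDiffOn (uniqueDiffOn_Icc (by norm_num)))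

/-- The Taylor term of index `j` at `1` contributes at order `k ^ (-(2σ + 2j + α + 1))`, so every `j
≥ 1` already lies within the error. -/
theorem asympPow_jacobiCoeff_right {α β σ : ℝ} (hα : -1 < α) (hβ : -1 < β) (hσ : -α - 1 < σ)
    (hσn : ∀ m : ℤ, σ ≠ m) {g : ℝ → ℝ} (hg : AnalyticOnNhd ℝ g (Set.Icc (-1) 1)) :
    HasJacobiCoeffs α β (modelFun σ 1 g) ∧
      AsympPow (fun k => jacobiCoeff α β (modelFun σ 1 g) k) (ampRight α σ g)
        (-(2 * σ + α + 1)) := by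
  have heq : ∀ x ∈ Set.Ioo (-1 : ℝ) 1, (1 - x) ^ σ * g x = modelFun σ 1 g x := fun x hx => by
    rw [modelFun, abs_sub_comm, abs_of_pos (by linarith [hx.2])]
  refine ⟨(hasJacobiCoeffs_one_sub_rpow_mul (by linarith) hβ hg.continuousOn).congr heq, ?_⟩
  -- The choice of `m` makes `1 - m ≤ -(2σ + α + 2)`; the choice of `N` makes `σ + N + 1 ≥ m`, so
  -- that the remainder is `C^m` up to the endpoint.
  obtain ⟨m, hm⟩ := exists_nat_ge (2 * σ + α + 3)
  obtain ⟨N, hN⟩ := exists_nat_ge (m - σ)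
  obtain ⟨c, r, hr, hc0, h⟩ := exists_taylor_expansion (⟨by norm_num, le_rfl⟩ : (1 : ℝ) ∈ Set.Icc (-1) 1)
    hg (N + 1)
  have hdec : Set.EqOn (modelFun σ 1 g) (fun x => (g 1 * (1 - x) ^ σ +
      ∑ j ∈ Finset.range N, (-1) ^ (j + 1) * c (j + 1) * (1 - x) ^ (σ + (j + 1 : ℕ))) +
        (1 - x) ^ (σ + (N + 1 : ℕ)) * ((-1) ^ (N + 1) * r x)) (Set.Ioo (-1) 1) := by
    intro x hx
    have h1 : 1 - x ≠ 0 := by linarith [hx.2]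
    rw [← heq x hx, h x, Finset.sum_range_succ']
    have h2 : ∀ j : ℕ, (x - 1) ^ j = (-1) ^ j * (1 - x) ^ j := fun j => by
      rw [← mul_pow]; congr 1; ring
    simp only [h2, Real.rpow_add_natCast h1, hc0]
    rw [mul_add, mul_add, Finset.mul_sum]
    have : ∀ j, (1 - x) ^ σ * (c (j + 1) * ((-1) ^ (j + 1) * (1 - x) ^ (j + 1))) =
        (-1) ^ (j + 1) * c (j + 1) * ((1 - x) ^ σ * (1 - x) ^ (j + 1)) := fun j => by ring
    simp only [this]
    ring
  have hpow : ∀ j : ℕ, HasJacobiCoeffs α β fun x => (1 - x) ^ (σ + j) := fun j => by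
    have := hasJacobiCoeffs_one_sub_rpow_mul (α := α) (s := σ + j)
      (by linarith [(j.cast_nonneg : (0 : ℝ) ≤ j)]) hβ
      (f := fun _ => 1) continuousOn_const
    simpa using this
  have hcoef : ∀ j : ℕ, AsympPow (fun k => jacobiCoeff α β (fun x => (1 - x) ^ (σ + j)) k)
      (2 ^ (σ + j + 1) * Real.Gamma (σ + j + α + 1) / Real.Gamma (-(σ + j)))
      (-(2 * (σ + j) + α + 1)) := fun j =>
    asympPow_jacobiCoeff_one_sub_rpow hα hβ (by linarith [(j.cast_nonneg : (0 : ℝ) ≤ j)])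
      fun n hn => hσn (n - j) (by push_cast; linarith)
  have h0 := hpow 0
  have h0' := hcoef 0
  simp only [CharP.cast_eq_zero, add_zero] at h0 h0'
  have hrc : ContinuousOn (fun x => (-1) ^ (N + 1) * r x) (Set.Icc (-1) 1) :=
    continuousOn_const.mul hr.continuousOn
  have hR := hasJacobiCoeffs_one_sub_rpow_mul (α := α) (s := σ + (N + 1 : ℕ))
    (by push_cast; linarith [(N.cast_nonneg : (0 : ℝ) ≤ N)]) hβ hrc
  have hS := HasJacobiCoeffs.sum (Finset.range N) (fun j (_ : j ∈ Finset.range N) =>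
    (hpow (j + 1)).const_mul ((-1) ^ (j + 1) * c (j + 1)))
  have hRO := jacobiCoeff_isBigO_of_contDiffOn hα hβ m (f := fun x => (1 - x) ^ (σ + (N + 1 : ℕ)) *
    ((-1) ^ (N + 1) * r x)) (contDiffOn_one_sub_rpow_mul (by push_cast; linarith)
      (analyticOnNhd_const.mul hr))
  have hSO : (fun k => ∑ j ∈ Finset.range N, (-1) ^ (j + 1) * c (j + 1) *
      jacobiCoeff α β (fun x => (1 - x) ^ (σ + (j + 1 : ℕ))) k) =O[atTop]
      fun k : ℕ => (k : ℝ) ^ (-(2 * σ + α + 1) - 1) := by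
    refine IsBigO.fun_sum fun j _ => IsBigO.const_mul_left ((hcoef (j + 1)).isBigO.trans
      (natCast_rpow_isBigO ?_)) _
    push_cast
    linarith [(j.cast_nonneg : (0 : ℝ) ≤ j)]
  have hmain := ((h0'.const_mul (g 1)).add_isBigO hSO le_rfl).add_isBigO hRO
    (by linarith)
  rw [show g 1 * (2 ^ (σ + 1) * Real.Gamma (σ + α + 1) / Real.Gamma (-σ)) = ampRight α σ g by
    rw [ampRight, mul_comm]] at hmain
  refine hmain.congr' (Eventually.of_forall fun k => ?_)
  beta_reduce
  rw [jacobiCoeff_congr α β hdec, jacobiCoeff_add ((h0.const_mul _).add hS) hR,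
    jacobiCoeff_add (h0.const_mul _) hS, jacobiCoeff_const_mul,
    jacobiCoeff_sum _ (fun j (_ : j ∈ Finset.range N) =>
    (hpow (j + 1)).const_mul ((-1) ^ (j + 1) * c (j + 1)))]
  simp only [jacobiCoeff_const_mul]

/-! ### Reflection and the left endpoint. -/

theorem jacobiH_comm (α β : ℝ) (n : ℕ) : jacobiH α β n = jacobiH β α n := by
  simp only [jacobiH]
  rw [add_comm α β, show 2 * (n : ℝ) + β + α + 1 = 2 * n + α + β + 1 by ring,
    show (n : ℝ) + β + α + 1 = n + α + β + 1 by ring]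
  split_ifs <;> ring

theorem HasJacobiCoeffs.comp_neg {α β : ℝ} (hα : -1 < α) (hβ : -1 < β) {f : ℝ → ℝ}
    (hf : HasJacobiCoeffs β α f) : HasJacobiCoeffs α β fun x => f (-x) := fun k => by
  have h := (IntervalIntegrable.iff_comp_neg (by finiteness)).1 (hf k)
  rw [neg_neg] at h
  refine (h.symm.const_mul ((-1) ^ k)).congr_uIoo fun x hx => ?_
  rw [Set.uIoo_of_le (by norm_num)] at hx
  simp only [jacobiWeight_neg, jacobiP_neg hβ hα k hx]
  rw [show (-1) ^ k * (f (-x) * ((-1) ^ k * jacobiP α β k x) * jacobiWeight α β x) =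
    ((-1) ^ k * (-1) ^ k) * (f (-x) * jacobiP α β k x * jacobiWeight α β x) by ring, ← mul_pow]
  norm_num

theorem jacobiCoeff_comp_neg {α β : ℝ} (hα : -1 < α) (hβ : -1 < β) (f : ℝ → ℝ) (k : ℕ) :
    jacobiCoeff α β (fun x => f (-x)) k = (-1) ^ k * jacobiCoeff β α f k := by
  rw [jacobiCoeff, jacobiCoeff, jacobiH_comm, ← mul_div_assoc]
  congr 1
  rw [jacobiInner, jacobiInner, ← intervalIntegral.integral_const_mul]
  have h := intervalIntegral.integral_comp_neg (a := -1) (b := 1)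
    fun x => f x * jacobiP α β k (-x) * jacobiWeight α β (-x)
  simp only [neg_neg] at h
  rw [h]
  refine intervalIntegral.integral_congr_Ioo_of_le (by norm_num) fun x hx => ?_
  simp only [jacobiWeight_neg, jacobiP_neg hα hβ k hx]
  ring

theorem asymptotics_jacobiCoeff_left {α β σ : ℝ} (hα : -1 < α) (hβ : -1 < β) (hσ : -β - 1 < σ)
    (hσn : ∀ m : ℤ, σ ≠ m) {g : ℝ → ℝ} (hg : AnalyticOnNhd ℝ g (Set.Icc (-1) 1)) :
    HasJacobiCoeffs α β (modelFun σ (-1) g) ∧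
      (fun k : ℕ => jacobiCoeff α β (modelFun σ (-1) g) k -
          (-1) ^ k * ampLeft β σ g / (k : ℝ) ^ (2 * σ + β + 1))
        =O[atTop] (fun k : ℕ => 1 / (k : ℝ) ^ (2 * σ + β + 2)) := by
  have hg' : AnalyticOnNhd ℝ (fun x => g (-x)) (Set.Icc (-1) 1) := fun x hx => by
    have : AnalyticAt ℝ g (-x) := hg (-x) ⟨by linarith [hx.2], by linarith [hx.1]⟩
    exact this.comp_of_eq (analyticAt_id.neg) rfl
  obtain ⟨h1, h2⟩ := asympPow_jacobiCoeff_right hβ hα hσ hσn hg'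
  have heq : modelFun σ (-1) g = fun x => modelFun σ 1 (fun x => g (-x)) (-x) := by
    ext x
    simp only [modelFun, neg_neg]
    rw [show -x - 1 = -(x - -1) by ring, abs_neg]
  rw [heq]
  refine ⟨h1.comp_neg hα hβ, ?_⟩
  have h3 := h2.isBigO_one_div (q := 2 * σ + β + 2) (by ring)
  have h4 : (fun k : ℕ => (-1 : ℝ) ^ k) =O[atTop] fun _ => (1 : ℝ) :=
    isBigO_of_le _ fun k => by simp
  refine (h4.mul h3).congr (fun k => ?_) fun k => by rw [one_mul]
  rw [jacobiCoeff_comp_neg hα hβ, show ampRight β σ (fun x => g (-x)) = ampLeft β σ g from rfl]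
  ring

/-! ### Contour deformation to the path of steepest descent. -/

/-- A holomorphic function on an open set star-shaped about `0` has its radial integral as a
primitive: differentiating in `z` under the integral gives `F(sz) + s z F'(sz)`, which is the
`s`-derivative of `s F(sz)`. -/
theorem hasDerivAt_radial_primitive {D : Set ℂ} (hD : IsOpen D)
    (hs : ∀ z ∈ D, ∀ s ∈ Set.Icc (0 : ℝ) 1, (s : ℂ) * z ∈ D) {F : ℂ → ℂ}
    (hF : DifferentiableOn ℂ F D) {z₀ : ℂ} (hz₀ : z₀ ∈ D) :
    HasDerivAt (fun z => ∫ s in (0 : ℝ)..1, z * F (s * z)) (F z₀) z₀ := by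
  obtain ⟨δ, hδ, hball⟩ := Metric.nhds_basis_closedBall.mem_iff.1 (hD.mem_nhds hz₀)
  have hF' : ContinuousOn (deriv F) D := (hF.deriv hD).continuousOn
  have hmaps : Set.MapsTo (fun p : ℂ × ℝ => (p.2 : ℂ) * p.1)
      (Metric.closedBall z₀ δ ×ˢ Set.Icc (0 : ℝ) 1) D := fun p hp => hs _ (hball hp.1) _ hp.2
  have hm : ContinuousOn (fun p : ℂ × ℝ => (p.2 : ℂ) * p.1)
      (Metric.closedBall z₀ δ ×ˢ Set.Icc (0 : ℝ) 1) := by fun_prop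
  have hc1 : ContinuousOn (fun p : ℂ × ℝ => F (p.2 * p.1))
      (Metric.closedBall z₀ δ ×ˢ Set.Icc (0 : ℝ) 1) := hF.continuousOn.comp hm hmaps
  have hc2 : ContinuousOn (fun p : ℂ × ℝ => F (p.2 * p.1) + p.1 * (deriv F (p.2 * p.1) * p.2))
      (Metric.closedBall z₀ δ ×ˢ Set.Icc (0 : ℝ) 1) :=
    hc1.add (continuousOn_fst.mul ((hF'.comp hm hmaps).mul (by fun_prop)))
  obtain ⟨M, hM⟩ := ((isCompact_closedBall z₀ δ).prod isCompact_Icc).exists_bound_of_continuousOn hc2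
  have slice : ∀ (H : ℂ × ℝ → ℂ) (z : ℂ), z ∈ Metric.closedBall z₀ δ →
      ContinuousOn H (Metric.closedBall z₀ δ ×ˢ Set.Icc (0 : ℝ) 1) →
      ContinuousOn (fun s : ℝ => H (z, s)) (Set.Icc 0 1) := fun H z hz hH =>
    hH.comp (by fun_prop) fun s hs => ⟨hz, hs⟩
  have hsub : Set.uIoc (0 : ℝ) 1 ⊆ Set.Icc 0 1 := by
    rw [Set.uIoc_of_le zero_le_one]; exact Set.Ioc_subset_Icc_self
  have hmem : z₀ ∈ Metric.closedBall z₀ δ := Metric.mem_closedBall_self hδ.le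
  have hder : ∀ z ∈ D, ∀ s ∈ Set.Icc (0 : ℝ) 1, HasDerivAt (fun z => z * F (s * z))
      (F (s * z) + z * (deriv F (s * z) * s)) z := by
    intro z hz s hs'
    have h1 : HasDerivAt F (deriv F (s * z)) (s * z) :=
      (hF.differentiableAt (hD.mem_nhds (hs z hz s hs'))).hasDerivAt
    have h2 : HasDerivAt (fun z : ℂ => (s : ℂ) * z) s z := by
      simpa using (hasDerivAt_id z).const_mul (s : ℂ)
    refine ((hasDerivAt_id z).mul (h1.comp z h2)).congr_deriv ?_
    simp only [Function.comp, id, one_mul]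
  have key := intervalIntegral.hasDerivAt_integral_of_dominated_loc_of_deriv_le
    (F := fun z (s : ℝ) => z * F (s * z)) (μ := MeasureTheory.volume) (a := 0) (b := 1)
    (F' := fun z (s : ℝ) => F (s * z) + z * (deriv F (s * z) * s)) (x₀ := z₀)
    (bound := fun _ => M) (Metric.ball_mem_nhds z₀ hδ) (by
      filter_upwards [Metric.ball_mem_nhds z₀ hδ] with z hz
      exact ((slice _ z (Metric.ball_subset_closedBall hz)
        (continuousOn_fst.mul hc1)).aestronglyMeasurable measurableSet_Icc).mono_set hsub)
    (by
      refine ContinuousOn.intervalIntegrable ?_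
      rw [Set.uIcc_of_le zero_le_one]
      exact slice _ z₀ hmem (continuousOn_fst.mul hc1))
    (((slice _ z₀ hmem hc2).aestronglyMeasurable measurableSet_Icc).mono_set hsub)
    (Eventually.of_forall fun s hs z hz => hM (z, s) ⟨Metric.ball_subset_closedBall hz, hsub hs⟩)
    intervalIntegrable_const
    (Eventually.of_forall fun s hs z hz =>
      hder z (hball (Metric.ball_subset_closedBall hz)) s (hsub hs))
  refine key.2.congr_deriv ?_
  have hint : IntervalIntegrable (fun s : ℝ => F (s * z₀) + z₀ * (deriv F (s * z₀) * s))
      MeasureTheory.volume 0 1 := key.1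
  have h2 := intervalIntegral.integral_eq_sub_of_hasDerivAt (a := 0) (b := 1)
    (f := fun s : ℝ => (s : ℂ) * F (s * z₀)) (fun s hs' => by
      rw [Set.uIcc_of_le zero_le_one] at hs'
      have h1 : HasDerivAt F (deriv F (s * z₀)) (s * z₀) :=
        (hF.differentiableAt (hD.mem_nhds (hs z₀ hz₀ s hs'))).hasDerivAt
      have h2 : HasDerivAt (fun s : ℝ => (s : ℂ) * z₀) z₀ s := by
        simpa using (Complex.ofRealCLM.hasDerivAt (x := s)).mul_const z₀
      have h3 := (Complex.ofRealCLM.hasDerivAt (x := s)).mul (h1.comp s h2)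
      refine h3.congr_deriv ?_
      simp only [Complex.ofRealCLM_apply, Complex.ofReal_one, Function.comp]
      ring_nf) hint
  rw [h2]; simp

/-- Cauchy's theorem in the form needed: the integral depends only on the endpoints of the path. Two
sets occur because the endpoints `±1` are branch points. `F` is holomorphic on `D`, which holds the
open path, and merely continuous on `S`, which holds the closed one. -/
theorem integral_path_eq_sub {D : Set ℂ} (hD : IsOpen D)
    (hs : ∀ z ∈ D, ∀ s ∈ Set.Icc (0 : ℝ) 1, (s : ℂ) * z ∈ D) {F : ℂ → ℂ}
    (hF : DifferentiableOn ℂ F D) {S : Set ℂ}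
    (hS : ∀ z ∈ S, ∀ s ∈ Set.Icc (0 : ℝ) 1, (s : ℂ) * z ∈ S) (hFS : ContinuousOn F S)
    {γ γ' : ℝ → ℂ} (hγD : ∀ t ∈ Set.Ioo (-1 : ℝ) 1, γ t ∈ D) (hγS : ∀ t ∈ Set.Icc (-1 : ℝ) 1, γ t ∈ S)
    (hγ : ∀ t ∈ Set.Icc (-1 : ℝ) 1, HasDerivAt γ (γ' t) t) (hγ' : ContinuousOn γ' (Set.Icc (-1) 1)) :
    ∫ t in (-1 : ℝ)..1, F (γ t) * γ' t =
      (∫ s in (0 : ℝ)..1, γ 1 * F (s * γ 1)) - ∫ s in (0 : ℝ)..1, γ (-1) * F (s * γ (-1)) := by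
  have hγc : ContinuousOn γ (Set.Icc (-1) 1) := fun t ht => (hγ t ht).continuousAt.continuousWithinAt
  have hcont : ContinuousOn (fun t => ∫ s in (0 : ℝ)..1, γ t * F (s * γ t)) (Set.Icc (-1) 1) := by
    rw [continuousOn_iff_continuous_domRestrict]
    have hγr : Continuous fun t : Set.Icc (-1 : ℝ) 1 => γ t := hγc.domRestrict
    -- Clamping `s` to `[0, 1]` gives joint continuity for all real `s` without changing the
    -- integral.
    have h1 : Continuous (fun p : Set.Icc (-1 : ℝ) 1 × ℝ =>
        γ p.1 * F ((Set.projIcc (0 : ℝ) 1 zero_le_one p.2 : ℝ) * γ p.1)) := by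
      have hm : Continuous (fun p : Set.Icc (-1 : ℝ) 1 × ℝ =>
        (((Set.projIcc (0 : ℝ) 1 zero_le_one p.2 : ℝ) : ℂ) * γ p.1)) :=
        (Complex.continuous_ofReal.comp (continuous_subtype_val.comp
          (continuous_projIcc.comp continuous_snd))).mul (hγr.comp continuous_fst)
      exact (hγr.comp continuous_fst).mul (hFS.comp_continuous hm fun p =>
        hS _ (hγS _ p.1.2) _ (Set.projIcc (0 : ℝ) 1 zero_le_one p.2).2)
    have h2 := intervalIntegral.continuous_parametric_intervalIntegral_of_continuous'
      (μ := MeasureTheory.volume)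
      (f := fun (t : Set.Icc (-1 : ℝ) 1) (s : ℝ) =>
        γ t * F ((Set.projIcc (0 : ℝ) 1 zero_le_one s : ℝ) * γ t)) h1 0 1
    refine h2.congr fun t => ?_
    refine intervalIntegral.integral_congr fun s hs => ?_
    rw [Set.uIcc_of_le zero_le_one] at hs
    simp only [Set.projIcc_of_mem zero_le_one hs]
  refine intervalIntegral.integral_eq_sub_of_hasDerivAt_of_le (by norm_num) hcont (fun t ht => ?_) ?_
  · have h1 := hasDerivAt_radial_primitive hD hs hF (hγD t ht)
    exact h1.comp t (hγ t (Set.Ioo_subset_Icc_self ht))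
  · refine ContinuousOn.intervalIntegrable ?_
    rw [Set.uIcc_of_le (by norm_num)]
    exact (hFS.comp hγc hγS).mul hγ'

/-- The steepest descent path from `-1` to `1` through the saddle point `e ^ (i θ)`. -/
noncomputable def saddlePath (θ : ℝ) (t : ℂ) : ℂ :=
  (1 - t ^ 2) * Complex.exp (θ * Complex.I) +
    t * (1 - (1 - t ^ 2) * Complex.exp (θ * Complex.I) ^ 2) ^ (1 / 2 : ℂ)

/-- The derivative of `saddlePath`. -/
noncomputable def saddlePathDeriv (θ : ℝ) (t : ℂ) : ℂ :=
  -(2 * t) * Complex.exp (θ * Complex.I) +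
    ((1 - (1 - t ^ 2) * Complex.exp (θ * Complex.I) ^ 2) ^ (1 / 2 : ℂ) +
      t * ((1 / 2 : ℂ) * (1 - (1 - t ^ 2) * Complex.exp (θ * Complex.I) ^ 2) ^ (1 / 2 - 1 : ℂ) *
        (2 * t * Complex.exp (θ * Complex.I) ^ 2)))

/-- The real part is `t² + 2 (1 - t²) sin² θ > 0`, so the principal square root in `saddlePath` is
smooth along the path. -/
theorem one_sub_mul_exp_mem_slitPlane {θ : ℝ} (hθ : θ ∈ Set.Ioo 0 Real.pi) {t : ℝ}
    (ht : t ∈ Set.Icc (-1 : ℝ) 1) :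
    1 - (1 - (t : ℂ) ^ 2) * Complex.exp (θ * Complex.I) ^ 2 ∈ Complex.slitPlane := by
  left
  have h1 : Complex.exp (θ * Complex.I) ^ 2 = ((Real.cos (2 * θ) : ℝ) : ℂ) +
      ((Real.sin (2 * θ) : ℝ) : ℂ) * Complex.I := by
    rw [← Complex.exp_nat_mul, ← mul_assoc, Complex.exp_mul_I]; push_cast; rfl
  have hs : 0 < Real.sin θ := Real.sin_pos_of_mem_Ioo hθ
  have h3 : 1 - (1 - (t : ℂ) ^ 2) * Complex.exp (θ * Complex.I) ^ 2 =
      ((1 - (1 - t ^ 2) * Real.cos (2 * θ) : ℝ) : ℂ) +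
        ((-(1 - t ^ 2) * Real.sin (2 * θ) : ℝ) : ℂ) * Complex.I := by
    rw [h1]; push_cast; ring
  rw [h3, Complex.add_re, Complex.ofReal_re, Complex.re_ofReal_mul, Complex.I_re, mul_zero, add_zero]
  rw [Real.cos_two_mul, Real.cos_sq']
  have ht2 : t ^ 2 ≤ 1 := by nlinarith [ht.1, ht.2]
  have hs1 : Real.sin θ ^ 2 ≤ 1 := Real.sin_sq_le_one θ
  nlinarith [mul_pos hs hs, sq_nonneg t, mul_nonneg (sq_nonneg t) (sub_nonneg.2 hs1)]

theorem hasDerivAt_saddlePath (θ : ℝ) {t : ℂ}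
    (h : 1 - (1 - t ^ 2) * Complex.exp (θ * Complex.I) ^ 2 ∈ Complex.slitPlane) :
    HasDerivAt (saddlePath θ) (saddlePathDeriv θ t) t := by
  have h1 : HasDerivAt (fun t : ℂ => 1 - t ^ 2) (-(2 * t)) t := by
    simpa using (hasDerivAt_pow 2 t).const_sub 1
  have h2 := (h1.mul_const (Complex.exp (θ * Complex.I) ^ 2)).const_sub 1
  have h3 := (h1.mul_const (Complex.exp (θ * Complex.I))).add
    ((hasDerivAt_id t).mul (h2.cpow_const (c := (1 / 2 : ℂ)) h))
  refine h3.congr_deriv ?_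
  simp only [saddlePathDeriv, id]
  ring

/-- This quadratic equation for `z` defines the path. With `e = e ^ (iθ)` and `2 e cos θ = e² + 1`,
a quarter of its discriminant is `t² (1 - (1 - t²) e²)`; taking `t` as root of `t²` keeps the path
smooth through the saddle at `t = 0`. -/
theorem one_sub_saddlePath_sq (θ : ℝ) (t : ℂ) :
    1 - saddlePath θ t ^ 2 =
      -2 * Complex.exp (θ * Complex.I) * (1 - t ^ 2) * (saddlePath θ t - Real.cos θ) := by
  have h1 : ((1 - (1 - t ^ 2) * Complex.exp (θ * Complex.I) ^ 2) ^ (1 / 2 : ℂ)) ^ 2 =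
      1 - (1 - t ^ 2) * Complex.exp (θ * Complex.I) ^ 2 := by
    rw [one_div]; exact_mod_cast Complex.cpow_nat_inv_pow _ two_ne_zero
  have h2 : 2 * ((Real.cos θ : ℝ) : ℂ) * Complex.exp (θ * Complex.I) =
      Complex.exp (θ * Complex.I) ^ 2 + 1 := by
    rw [Complex.ofReal_cos, Complex.cos, mul_div_cancel₀ _ two_ne_zero, add_mul, ← sq, ← Complex.exp_add]
    simp
  simp only [saddlePath]
  set e := Complex.exp (θ * Complex.I)
  set s := (1 - (1 - t ^ 2) * e ^ 2) ^ (1 / 2 : ℂ)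
  linear_combination (-t ^ 2) * h1 + (-(1 - t ^ 2)) * h2

theorem saddlePath_one (θ : ℝ) : saddlePath θ 1 = 1 := by simp [saddlePath]

theorem saddlePath_neg_one (θ : ℝ) : saddlePath θ (-1) = -1 := by simp [saddlePath]

theorem saddlePath_zero (θ : ℝ) : saddlePath θ 0 = Complex.exp (θ * Complex.I) := by
  simp [saddlePath]

/-- If the path met the real axis at `x`, the imaginary part of the defining quadratic would force
`x = cos θ`, and then `sin² θ = 0`. At `t = 0` the imaginary part is `sin θ > 0`, and its sign
cannot change. -/
theorem saddlePath_im_pos {θ : ℝ} (hθ : θ ∈ Set.Ioo 0 Real.pi) {t : ℝ}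
    (ht : t ∈ Set.Ioo (-1 : ℝ) 1) : 0 < (saddlePath θ t).im := by
  have hs : 0 < Real.sin θ := Real.sin_pos_of_mem_Ioo hθ
  have hexp : (Complex.exp (θ * Complex.I)).im = Real.sin θ := Complex.exp_ofReal_mul_I_im θ
  have hne : ∀ t ∈ Set.Ioo (-1 : ℝ) 1, (saddlePath θ t).im ≠ 0 := by
    intro t ht h0
    have h := one_sub_saddlePath_sq θ t
    obtain ⟨x, hx⟩ : ∃ x : ℝ, saddlePath θ t = x := 
      ⟨(saddlePath θ t).re, Complex.ext (by simp) (by simpa using h0)⟩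
    rw [hx] at h
    have hi := congrArg Complex.im h
    have e1 : (1 - (x : ℂ) ^ 2).im = 0 := by
      rw [← Complex.ofReal_one, ← Complex.ofReal_pow, ← Complex.ofReal_sub, Complex.ofReal_im]
    have e2 : (-2 * Complex.exp (θ * Complex.I) * (1 - (t : ℂ) ^ 2) * (x - Real.cos θ)).im =
        (-2 * (1 - t ^ 2) * (x - Real.cos θ)) * Real.sin θ := by
      rw [show -2 * Complex.exp (θ * Complex.I) * (1 - (t : ℂ) ^ 2) * (x - Real.cos θ) =
        ((-2 * (1 - t ^ 2) * (x - Real.cos θ) : ℝ) : ℂ) * Complex.exp (θ * Complex.I) by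
          push_cast; ring, Complex.im_ofReal_mul, hexp]
    rw [e1, e2] at hi
    have ht2 : 0 < 1 - t ^ 2 := by nlinarith [ht.1, ht.2]
    have hx' : x = Real.cos θ := by
      rcases mul_eq_zero.1 hi.symm with h | h
      · rcases mul_eq_zero.1 h with h | h
        · nlinarith
        · linarith
      · exact absurd h hs.ne'
    rw [hx', sub_self, mul_zero] at h
    norm_cast at h
    nlinarith [Real.sin_sq_add_cos_sq θ]
  have hc : ContinuousOn (fun t : ℝ => (saddlePath θ t).im) (Set.Ioo (-1) 1) := fun t ht =>
    (Complex.continuous_im.continuousAt.comp ((hasDerivAt_saddlePath θ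
      (one_sub_mul_exp_mem_slitPlane hθ (Set.Ioo_subset_Icc_self ht))).continuousAt.comp
        Complex.continuous_ofReal.continuousAt)).continuousWithinAt
  by_contra hneg
  have h0 : (0 : ℝ) ∈ Set.Ioo (-1 : ℝ) 1 := by norm_num
  have := isPreconnected_Ioo.intermediate_value ht h0 hc
  obtain ⟨u, hu, hu'⟩ := this (Set.mem_Icc.2 ⟨not_lt.1 hneg, by
    simp only [Complex.ofReal_zero, saddlePath_zero, hexp]; exact hs.le⟩)
  exact hne u hu hu'

theorem continuousOn_saddlePath {θ : ℝ} (hθ : θ ∈ Set.Ioo 0 Real.pi) :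
    ContinuousOn (fun t : ℝ => saddlePath θ t) (Set.Icc (-1) 1) := fun _ ht =>
  ((hasDerivAt_saddlePath θ (one_sub_mul_exp_mem_slitPlane hθ ht)).continuousAt.comp
    Complex.continuous_ofReal.continuousAt).continuousWithinAt

theorem continuousOn_saddlePathDeriv {θ : ℝ} (hθ : θ ∈ Set.Ioo 0 Real.pi) :
    ContinuousOn (fun t : ℝ => saddlePathDeriv θ t) (Set.Icc (-1) 1) := fun t ht => by
  have hm := one_sub_mul_exp_mem_slitPlane hθ ht
  refine ContinuousAt.continuousWithinAt ?_
  unfold saddlePathDeriv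
  have hk : ∀ p : ℂ, ContinuousAt (fun t : ℝ =>
      (1 - (1 - (t : ℂ) ^ 2) * Complex.exp (θ * Complex.I) ^ 2) ^ p) t := fun p =>
    ContinuousAt.cpow (by fun_prop) continuousAt_const hm
  have hk1 := hk (1 / 2)
  have hk2 := hk (1 / 2 - 1)
  fun_prop

/-- The shift by `ε` puts the branch point of the third factor below the real axis, so the segment
and the saddle path are homotopic where the integrand is holomorphic. -/
theorem integral_saddlePath_eq_integral {a b ε θ : ℝ} (c ξ : ℝ) (ha : 0 < a) (hb : 0 < b) (hε : 0 < ε)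
    (hθ : θ ∈ Set.Ioo 0 Real.pi) :
    ∫ t in (-1 : ℝ)..1, (1 - saddlePath θ t) ^ (a : ℂ) * (1 + saddlePath θ t) ^ (b : ℂ) *
        (saddlePath θ t - ξ + ε * Complex.I) ^ (c : ℂ) * saddlePathDeriv θ t =
      ∫ x in (-1 : ℝ)..1, (1 - x : ℂ) ^ (a : ℂ) * (1 + x : ℂ) ^ (b : ℂ) *
        (x - ξ + ε * Complex.I) ^ (c : ℂ) := by
  set F : ℂ → ℂ := fun z => (1 - z) ^ (a : ℂ) * (1 + z) ^ (b : ℂ) *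
    (z - ξ + ε * Complex.I) ^ (c : ℂ) with hFdef
  -- `D` avoids the cuts `|x| ≥ 1` of the first two powers and the cut on `Im z = -ε` of the third.
  -- `S` adds the endpoints `±1`, where `a, b > 0` give continuity. Both sets are star-shaped about
  -- `0`.
  set D : Set ℂ := {z | -ε < z.im} ∩ ({z | z.im ≠ 0} ∪ {z | |z.re| < 1}) with hDdef
  set S : Set ℂ := {z | 0 ≤ z.im ∧ (z.im ≠ 0 ∨ |z.re| ≤ 1)} with hSdef
  have hD : IsOpen D := (isOpen_lt continuous_const Complex.continuous_im).inter
    ((isOpen_ne_fun Complex.continuous_im continuous_const).union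
      (isOpen_lt Complex.continuous_re.abs continuous_const))
  have hscale : ∀ (z : ℂ) (s : ℝ), ((s : ℂ) * z).im = s * z.im ∧ ((s : ℂ) * z).re = s * z.re :=
    fun z s => ⟨Complex.im_ofReal_mul s z, Complex.re_ofReal_mul s z⟩
  have hDs : ∀ z ∈ D, ∀ s ∈ Set.Icc (0 : ℝ) 1, (s : ℂ) * z ∈ D := by
    rintro z ⟨h1, h2⟩ s ⟨hs0, hs1⟩
    simp only [Set.mem_ofPred_eq] at h1
    refine ⟨?_, ?_⟩
    · simp only [Set.mem_ofPred_eq, (hscale z s).1]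
      nlinarith [mul_nonneg hs0 (by linarith : 0 ≤ z.im + ε), mul_nonneg (sub_nonneg.2 hs1) hε.le]
    · simp only [Set.mem_union, Set.mem_ofPred_eq, (hscale z s).1, (hscale z s).2, abs_mul,
        abs_of_nonneg hs0] at h2 ⊢
      rcases hs0.eq_or_lt with rfl | hs0
      · right; simp
      · rcases h2 with h2 | h2
        · left; exact mul_ne_zero hs0.ne' h2
        · right; nlinarith [abs_nonneg z.re]
  have hSs : ∀ z ∈ S, ∀ s ∈ Set.Icc (0 : ℝ) 1, (s : ℂ) * z ∈ S := by
    rintro z ⟨h1, h2⟩ s ⟨hs0, hs1⟩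
    refine ⟨?_, ?_⟩
    · rw [(hscale z s).1]; positivity
    · rw [(hscale z s).1, (hscale z s).2, abs_mul, abs_of_nonneg hs0]
      rcases hs0.eq_or_lt with rfl | hs0
      · right; simp
      · rcases h2 with h2 | h2
        · left; exact mul_ne_zero hs0.ne' h2
        · right; nlinarith [abs_nonneg z.re]
  have hFD : DifferentiableOn ℂ F D := by
    rintro z ⟨h1, h2⟩
    simp only [Set.mem_union, Set.mem_ofPred_eq] at h1 h2
    have e1 : 1 - z ∈ Complex.slitPlane := by
      rcases h2 with h2 | h2
      · right; simpa using h2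
      · left; simpa using (abs_lt.1 h2).2
    have e2 : 1 + z ∈ Complex.slitPlane := by
      rcases h2 with h2 | h2
      · right; simpa using h2
      · left; simp; linarith [(abs_lt.1 h2).1]
    have e3 : z - ξ + ε * Complex.I ∈ Complex.slitPlane := by
      right; simp; linarith
    refine DifferentiableAt.differentiableWithinAt ?_
    refine ((DifferentiableAt.cpow_const ?_ e1).mul (DifferentiableAt.cpow_const ?_ e2)).mul
      (DifferentiableAt.cpow_const ?_ e3) <;> fun_prop
  have hFS : ContinuousOn F S := by
    rintro z ⟨h1, h2⟩
    have hre : z.im = 0 → |z.re| ≤ 1 := fun h => h2.resolve_left (by simpa using h)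
    have e1 : 0 ≤ (1 - z).re ∨ (1 - z).im ≠ 0 := by
      by_cases h : z.im = 0
      · left; simpa using (abs_le.1 (hre h)).2
      · right; simpa using h
    have e2 : 0 ≤ (1 + z).re ∨ (1 + z).im ≠ 0 := by
      by_cases h : z.im = 0
      · left; simp; linarith [(abs_le.1 (hre h)).1]
      · right; simpa using h
    have e3 : z - ξ + ε * Complex.I ∈ Complex.slitPlane := by
      right; simp; linarith
    have c1 : ContinuousAt (fun z : ℂ => (1 - z) ^ (a : ℂ)) z :=
      (Complex.continuousAt_cpow_const_of_re_pos e1 (by simpa using ha)).comp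
        (f := fun z : ℂ => 1 - z) (by fun_prop)
    have c2 : ContinuousAt (fun z : ℂ => (1 + z) ^ (b : ℂ)) z :=
      (Complex.continuousAt_cpow_const_of_re_pos e2 (by simpa using hb)).comp
        (f := fun z : ℂ => 1 + z) (by fun_prop)
    have c3 : ContinuousAt (fun z : ℂ => (z - ξ + ε * Complex.I) ^ (c : ℂ)) z :=
      ContinuousAt.cpow (by fun_prop) continuousAt_const e3
    exact ((c1.mul c2).mul c3).continuousWithinAt
  have h1 := integral_path_eq_sub hD hDs hFD hSs hFS (γ := fun t => saddlePath θ t)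
    (γ' := fun t => saddlePathDeriv θ t)
    (fun t ht => by
      have := saddlePath_im_pos hθ ht
      exact ⟨by simp only [Set.mem_ofPred_eq]; linarith, Or.inl this.ne'⟩)
    (fun t ht => by
      rcases ht.1.eq_or_lt with rfl | h1
      · simp [hSdef, saddlePath_neg_one]
      rcases ht.2.eq_or_lt with rfl | h2
      · simp [hSdef, saddlePath_one]
      · have := saddlePath_im_pos hθ ⟨h1, h2⟩
        exact ⟨this.le, Or.inl this.ne'⟩)
    (fun t ht => (hasDerivAt_saddlePath θ (one_sub_mul_exp_mem_slitPlane hθ ht)).comp_ofReal)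
    (continuousOn_saddlePathDeriv hθ)
  have h2 := integral_path_eq_sub hD hDs hFD hSs hFS (γ := fun t => (t : ℂ)) (γ' := fun _ => 1)
    (fun t ht => ⟨by simpa using hε, Or.inr (by
      simp only [Set.mem_ofPred_eq, Complex.ofReal_re]; exact abs_lt.2 ht)⟩)
    (fun t ht => ⟨by simp, Or.inr (by simpa using abs_le.2 ht)⟩)
    (fun t _ => (hasDerivAt_id (t : ℂ)).comp_ofReal) continuousOn_const
  simp only [Complex.ofReal_one, Complex.ofReal_neg, saddlePath_one, saddlePath_neg_one,
    mul_one] at h1 h2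
  rw [h1, ← h2]

theorem ofReal_jacobiWeight {a b x : ℝ} (hx : x ∈ Set.Icc (-1 : ℝ) 1) :
    ((jacobiWeight a b x : ℝ) : ℂ) = (1 - x : ℂ) ^ (a : ℂ) * (1 + x : ℂ) ^ (b : ℂ) := by
  rw [jacobiWeight, Complex.ofReal_mul, Complex.ofReal_cpow (by linarith [hx.2]),
    Complex.ofReal_cpow (by linarith [hx.1])]
  push_cast
  rfl

/-! ### Interior powers as boundary values from the upper half plane. -/

theorem integral_jacobi_by_parts_iterate {α β : ℝ} (hα : -1 < α) (hβ : -1 < β) (n : ℕ)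
    {f : ℕ → ℝ → ℂ} (hf : ∀ j x, HasDerivAt (f j) (f (j + 1) x) x) :
    ∫ x in (-1 : ℝ)..1, (jacobiWeight α β x * jacobiP α β n x) • f 0 x =
      (1 / (2 ^ n * n.factorial) : ℝ) •
        ∫ x in (-1 : ℝ)..1, jacobiWeight (α + n) (β + n) x • f n x := by
  induction n generalizing α β f with
  | zero => simp [jacobiP_zero]
  | succ n ih =>
    have hc : ∀ j, Continuous (f j) := fun j =>
      continuous_iff_continuousAt.2 fun x => (hf j x).continuousAt
    rw [integral_jacobi_by_parts_of_continuousOn hα hβ n (fun x _ => hf 0 x) (hc 0).continuousOn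
      (hc 1).continuousOn]
    have h := ih (by linarith : -1 < α + 1) (by linarith : -1 < β + 1) (f := fun j => f (j + 1))
      fun j x => hf (j + 1) x
    simp only [zero_add] at h ⊢
    rw [h, smul_smul]
    congr 1
    · rw [Nat.factorial_succ, pow_succ]; push_cast; field_simp
    · push_cast
      simp only [add_assoc, add_comm (1 : ℝ)]

theorem intervalIntegrable_abs_sub_rpow_mul_jacobiWeight {α β μ ξ : ℝ} (hα : -1 < α) (hβ : -1 < β)
    (hμ : -1 < μ) (hξ : ξ ∈ Set.Ioo (-1 : ℝ) 1) :
    IntervalIntegrable (fun x => |x - ξ| ^ μ * jacobiWeight α β x) MeasureTheory.volume (-1) 1 := by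
  have hw := intervalIntegrable_jacobiWeight hα hβ
  have hx : ∀ a b : ℝ, IntervalIntegrable (fun x : ℝ => |x - ξ| ^ μ) MeasureTheory.volume a b := by
    intro a b
    have h := (intervalIntegral.intervalIntegrable_cpow' (a := a - ξ) (b := b - ξ)
      (r := (μ : ℂ)) (by simpa using hμ)).norm
    simp only [Complex.norm_cpow_real, Complex.norm_real, Real.norm_eq_abs] at h
    simpa using h.comp_sub_right ξ
  have hsub : ∀ a b : ℝ, -1 ≤ a → a ≤ b → b ≤ 1 →
      IntervalIntegrable (jacobiWeight α β) MeasureTheory.volume a b := fun a b h1 h2 h3 =>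
    hw.mono_set (by
      rw [Set.uIcc_of_le h2, Set.uIcc_of_le (by norm_num)]; exact Set.Icc_subset_Icc h1 h3)
  have hc : ∀ a b : ℝ, a ≤ b → (ξ < a ∨ b < ξ) →
      ContinuousOn (fun x : ℝ => |x - ξ| ^ μ) (Set.uIcc a b) := by
    intro a b hab h
    rw [Set.uIcc_of_le hab]
    refine ContinuousOn.rpow_const (by fun_prop) fun x hx => Or.inl ?_
    rw [abs_ne_zero, sub_ne_zero]
    rcases h with h | h
    · exact (h.trans_le hx.1).ne'
    · exact (hx.2.trans_lt h).ne
  obtain ⟨h1, h2⟩ := hξ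
  -- Cutting halfway between `ξ` and each endpoint leaves at most one singular factor on every
  -- piece.
  refine IntervalIntegrable.trans (b := (ξ - 1) / 2) ?_ (IntervalIntegrable.trans (b := (ξ + 1) / 2) ?_ ?_)
  · exact (hsub _ _ le_rfl (by linarith) (by linarith)).continuousOn_mul
      (hc _ _ (by linarith) (Or.inr (by linarith)))
  · refine (hx _ _).mul_continuousOn ?_
    rw [Set.uIcc_of_le (by linarith)]
    exact continuousOn_jacobiWeight_Icc (Or.inr (by linarith)) (Or.inr (by linarith))
  · exact (hsub _ _ (by linarith) (by linarith) le_rfl).continuousOn_mul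
      (hc _ _ (by linarith) (Or.inl (by linarith)))

/-- The slowly varying factor of the steepest descent integrand. -/
noncomputable def saddleAmp (α β τ θ : ℝ) (t : ℂ) : ℂ :=
  (1 - saddlePath θ t) ^ (α : ℂ) * (1 + saddlePath θ t) ^ (β : ℂ) *
    (saddlePath θ t - Real.cos θ) ^ (τ : ℂ) * saddlePathDeriv θ t

theorem cos_mem_Ioo {θ : ℝ} (hθ : θ ∈ Set.Ioo 0 Real.pi) : Real.cos θ ∈ Set.Ioo (-1 : ℝ) 1 := by
  have hs := Real.sin_pos_of_mem_Ioo hθ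
  constructor <;> nlinarith [Real.sin_sq_add_cos_sq θ]

theorem exists_le_norm_saddlePath_sub {θ : ℝ} (hθ : θ ∈ Set.Ioo 0 Real.pi) :
    ∃ d > 0, ∀ t ∈ Set.Icc (-1 : ℝ) 1, d ≤ ‖saddlePath θ t - Real.cos θ‖ := by
  have hc : ContinuousOn (fun t : ℝ => ‖saddlePath θ t - Real.cos θ‖) (Set.Icc (-1) 1) :=
    ((continuousOn_saddlePath hθ).sub continuousOn_const).norm
  obtain ⟨t₀, ht₀, hmin⟩ := isCompact_Icc.exists_isMinOn ⟨0, by norm_num⟩ hc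
  refine ⟨_, ?_, fun t ht => hmin ht⟩
  refine norm_pos_iff.2 (sub_ne_zero.2 fun h => ?_)
  have h2 := one_sub_saddlePath_sq θ t₀
  rw [h, sub_self, mul_zero] at h2
  norm_cast at h2
  nlinarith [Real.sin_sq_add_cos_sq θ, Real.sin_pos_of_mem_Ioo hθ]

/-- The `n`-th powers assemble to `((1 - z²) / (z - cos θ)) ^ n`, which the path equation evaluates.
All three bases are nonzero because `Im z > 0`, so the exponents may be split. -/
theorem saddle_integrand_eq {α β τ θ : ℝ} (hθ : θ ∈ Set.Ioo 0 Real.pi) (n : ℕ) {t : ℝ}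
    (ht : t ∈ Set.Ioo (-1 : ℝ) 1) :
    (1 - saddlePath θ t) ^ ((α + n : ℝ) : ℂ) * (1 + saddlePath θ t) ^ ((β + n : ℝ) : ℂ) *
        (saddlePath θ t - Real.cos θ) ^ ((τ - n : ℝ) : ℂ) * saddlePathDeriv θ t =
      (-2 * Complex.exp (θ * Complex.I)) ^ n * (saddleAmp α β τ θ t * (1 - (t : ℂ) ^ 2) ^ n) := by
  have him := saddlePath_im_pos hθ ht
  have hsq := one_sub_saddlePath_sq θ t
  set z := saddlePath θ t with hz
  have h1 : 1 - z ≠ 0 := fun h => by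
    have := congrArg Complex.im h; simp at this; exact him.ne' this
  have h2 : 1 + z ≠ 0 := fun h => by
    have := congrArg Complex.im h; simp at this; exact him.ne' this
  have h3 : z - Real.cos θ ≠ 0 := fun h => by
    have := congrArg Complex.im h
    rw [Complex.sub_im, Complex.ofReal_im] at this; simp at this; exact him.ne' this
  rw [saddleAmp, ← hz]
  push_cast
  rw [Complex.cpow_add _ _ h1, Complex.cpow_add _ _ h2, Complex.cpow_sub _ _ (by exact_mod_cast h3),
    Complex.cpow_natCast, Complex.cpow_natCast, Complex.cpow_natCast]
  push_cast at hsq h3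
  have hn : (1 - z) ^ n * (1 + z) ^ n = (-2 * Complex.exp (θ * Complex.I)) ^ n *
      (1 - (t : ℂ) ^ 2) ^ n * (z - Complex.cos θ) ^ n := by
    rw [← mul_pow, ← mul_pow, ← mul_pow, ← hsq]; ring
  have h4 : (z - Complex.cos θ) ^ n ≠ 0 := pow_ne_zero _ h3
  field_simp
  linear_combination (1 - z) ^ (α : ℂ) * (1 + z) ^ (β : ℂ) * (z - Complex.cos θ) ^ (τ : ℂ) *
    saddlePathDeriv θ t * hn

/-- Dominated convergence: the path stays away from `cos θ` and above the real axis, so adding `iε`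
only increases the distance to the branch point, and the exponent `c` is nonpositive. -/
theorem tendsto_integral_saddlePath {a b c θ : ℝ} (ha : 0 < a) (hb : 0 < b) (hc : c ≤ 0)
    (hθ : θ ∈ Set.Ioo 0 Real.pi) :
    Tendsto (fun ε : ℝ => ∫ t in (-1 : ℝ)..1, (1 - saddlePath θ t) ^ (a : ℂ) *
        (1 + saddlePath θ t) ^ (b : ℂ) * (saddlePath θ t - Real.cos θ + ε * Complex.I) ^ (c : ℂ) *
          saddlePathDeriv θ t) (𝓝[>] 0)
      (𝓝 (∫ t in (-1 : ℝ)..1, (1 - saddlePath θ t) ^ (a : ℂ) *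
        (1 + saddlePath θ t) ^ (b : ℂ) * (saddlePath θ t - Real.cos θ) ^ (c : ℂ) *
          saddlePathDeriv θ t)) := by
  obtain ⟨d, hd, hdz⟩ := exists_le_norm_saddlePath_sub hθ
  obtain ⟨M, hM⟩ := isCompact_Icc.exists_bound_of_continuousOn (continuousOn_saddlePath hθ)
  obtain ⟨M', hM'⟩ := isCompact_Icc.exists_bound_of_continuousOn (continuousOn_saddlePathDeriv hθ)
  have hpos : ∀ (t : ℝ), t ∈ Set.Ioo (-1 : ℝ) 1 → ∀ ε : ℝ, 0 ≤ ε →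
      saddlePath θ t - Real.cos θ + ε * Complex.I ∈ Complex.slitPlane := by
    intro t ht ε hε
    have := saddlePath_im_pos hθ ht
    right
    rw [Complex.add_im, Complex.sub_im, Complex.ofReal_im, Complex.im_ofReal_mul, Complex.I_im]
    linarith
  have hIoo : ∀ᵐ t : ℝ, t ∈ Set.uIoc (-1 : ℝ) 1 → t ∈ Set.Ioo (-1 : ℝ) 1 := by
    filter_upwards [MeasureTheory.Measure.ae_ne MeasureTheory.volume (1 : ℝ)] with t ht1 ht
    rw [Set.uIoc_of_le (by norm_num)] at ht
    exact ⟨ht.1, lt_of_le_of_ne ht.2 ht1⟩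
  refine intervalIntegral.tendsto_integral_filter_of_dominated_convergence
    (fun _ => (1 + M) ^ a * (1 + M) ^ b * d ^ c * M') ?_ ?_ intervalIntegrable_const ?_
  · filter_upwards [self_mem_nhdsWithin] with ε hε
    have hcont : ContinuousOn (fun t : ℝ => (1 - saddlePath θ t) ^ (a : ℂ) *
        (1 + saddlePath θ t) ^ (b : ℂ) * (saddlePath θ t - Real.cos θ + ε * Complex.I) ^ (c : ℂ) *
          saddlePathDeriv θ t) (Set.Ioo (-1) 1) := by
      intro t ht
      have him := saddlePath_im_pos hθ ht
      have hz := (continuousOn_saddlePath hθ).continuousAt (Icc_mem_nhds ht.1 ht.2)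
      have hz' := (continuousOn_saddlePathDeriv hθ).continuousAt (Icc_mem_nhds ht.1 ht.2)
      have e1 : 1 - saddlePath θ t ∈ Complex.slitPlane := by right; simpa using him.ne'
      have e2 : 1 + saddlePath θ t ∈ Complex.slitPlane := by right; simpa using him.ne'
      have c1 : ContinuousAt (fun t : ℝ => (1 - saddlePath θ t) ^ (a : ℂ)) t :=
        (continuousAt_const.sub hz).cpow continuousAt_const e1
      have c2 : ContinuousAt (fun t : ℝ => (1 + saddlePath θ t) ^ (b : ℂ)) t :=
        (continuousAt_const.add hz).cpow continuousAt_const e2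
      have c3 : ContinuousAt (fun t : ℝ =>
          (saddlePath θ t - Real.cos θ + ε * Complex.I) ^ (c : ℂ)) t :=
        ((hz.sub continuousAt_const).add continuousAt_const).cpow continuousAt_const
          (hpos t ht ε (le_of_lt hε))
      exact (((c1.mul c2).mul c3).mul hz').continuousWithinAt
    rw [Set.uIoc_of_le (by norm_num), ← MeasureTheory.restrict_Ioo_eq_restrict_Ioc]
    exact hcont.aestronglyMeasurable measurableSet_Ioo
  · filter_upwards [self_mem_nhdsWithin] with ε hε
    filter_upwards [hIoo] with t ht' ht
    have ht := Set.Ioo_subset_Icc_self (ht' ht)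
    have him := saddlePath_im_pos hθ (ht' ‹_›)
    have hM0 := hM t ht
    rw [norm_mul, norm_mul, norm_mul, Complex.norm_cpow_real, Complex.norm_cpow_real,
      Complex.norm_cpow_real]
    have n1 : ‖1 - saddlePath θ t‖ ≤ 1 + M := (norm_sub_le _ _).trans (by simpa using hM0)
    have n2 : ‖1 + saddlePath θ t‖ ≤ 1 + M := (norm_add_le _ _).trans (by simpa using hM0)
    have n3 : d ≤ ‖saddlePath θ t - Real.cos θ + ε * Complex.I‖ := by
      refine (hdz t ht).trans ?_
      rw [Complex.norm_eq_sqrt_sq_add_sq, Complex.norm_eq_sqrt_sq_add_sq]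
      refine Real.sqrt_le_sqrt ?_
      have hε' : (0 : ℝ) < ε := hε
      have r1 : (saddlePath θ t - Real.cos θ + ε * Complex.I).re =
        (saddlePath θ t - Real.cos θ).re := by
        rw [Complex.add_re, Complex.re_ofReal_mul, Complex.I_re]; ring
      have r2 : (saddlePath θ t - Real.cos θ + ε * Complex.I).im =
        (saddlePath θ t - Real.cos θ).im + ε := by
        rw [Complex.add_im, Complex.im_ofReal_mul, Complex.I_im]; ring
      have r3 : (saddlePath θ t - Real.cos θ).im = (saddlePath θ t).im := by
        rw [Complex.sub_im, Complex.ofReal_im, sub_zero]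
      rw [r1, r2, r3]
      nlinarith
    have n4 := hM' t ht
    have hM1 : 0 ≤ 1 + M := (norm_nonneg _).trans n1
    gcongr ?_ * ?_ * ?_ * ?_
    · exact Real.rpow_le_rpow (norm_nonneg _) n1 ha.le
    · exact Real.rpow_le_rpow (norm_nonneg _) n2 hb.le
    · exact Real.rpow_le_rpow_of_nonpos hd n3 hc
  · filter_upwards [hIoo] with t ht' ht
    have hmem := hpos t (ht' ht) 0 le_rfl
    have hcc : ContinuousAt (fun ε : ℝ => (saddlePath θ t - Real.cos θ + ε * Complex.I) ^ (c : ℂ)) 0 :=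
      ContinuousAt.cpow (by fun_prop) continuousAt_const hmem
    have hcc' := hcc.tendsto
    simp only [Complex.ofReal_zero, zero_mul, add_zero] at hcc'
    exact ((hcc'.mono_left nhdsWithin_le_nhds).const_mul _).mul_const _

/-- The integral of the boundary values of `f 0` against a Jacobi polynomial, when `f j` is the
`j`-th derivative of `f 0` in the upper half plane and eventually a multiple of a pure power. -/
theorem integral_jacobi_boundary_values {α β θ τ μ C : ℝ} {κ : ℂ} (hα : -1 < α) (hβ : -1 < β)
    (hθ : θ ∈ Set.Ioo 0 Real.pi) {f : ℕ → ℂ → ℂ} {v : ℝ → ℂ}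
    (hder : ∀ j ζ, 0 < ζ.im → HasDerivAt (f j) (f (j + 1) ζ) ζ)
    (hpow : ∀ n : ℕ, τ < n → ∀ ζ : ℂ, 0 < ζ.im →
      f n ζ = κ * (-1) ^ n * Real.Gamma (n - τ) * ζ ^ ((τ - n : ℝ) : ℂ))
    (hlim : ∀ x : ℝ, x ≠ 0 → Tendsto (fun ε : ℝ => f 0 (x + ε * Complex.I)) (𝓝[>] 0) (𝓝 (v x)))
    (hμ : -1 < μ) (hμ0 : μ ≤ 0)
    (hbound : ∀ ζ : ℂ, 0 < ζ.im → ‖ζ‖ ≤ 3 → ‖f 0 ζ‖ ≤ C * ‖ζ‖ ^ μ)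
    {n : ℕ} (hn : 1 ≤ n) (hnτ : τ < n) :
    ∫ x in (-1 : ℝ)..1, (jacobiWeight α β x * jacobiP α β n x) • v (x - Real.cos θ) =
      κ * Real.Gamma (n - τ) / n.factorial * Complex.exp (θ * Complex.I) ^ n *
        ∫ t in (-1 : ℝ)..1, saddleAmp α β τ θ t * (1 - (t : ℂ) ^ 2) ^ n := by
  have hn' : (1 : ℝ) ≤ n := by exact_mod_cast hn
  have hξ := cos_mem_Ioo hθ
  set ξ := Real.cos θ with hξdef
  -- On the line shifted up by `ε` the function is smooth, so `n` integrations by parts and the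
  -- contour deformation are both legitimate; `ε → 0` comes last, on each side separately.
  have hfactor : ∀ ε : ℝ, 0 < ε →
      ∫ x in (-1 : ℝ)..1, (jacobiWeight α β x * jacobiP α β n x) • f 0 (x - ξ + ε * Complex.I) =
        (1 / (2 ^ n * n.factorial) : ℝ) • (κ * (-1) ^ n * Real.Gamma (n - τ) *
          ∫ t in (-1 : ℝ)..1, (1 - saddlePath θ t) ^ ((α + n : ℝ) : ℂ) *
            (1 + saddlePath θ t) ^ ((β + n : ℝ) : ℂ) *
            (saddlePath θ t - ξ + ε * Complex.I) ^ ((τ - n : ℝ) : ℂ) * saddlePathDeriv θ t) := by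
    intro ε hε
    have him : ∀ x : ℝ, 0 < ((x : ℂ) - ξ + ε * Complex.I).im := fun x => by simpa using hε
    have h := integral_jacobi_by_parts_iterate hα hβ n
      (f := fun j x => f j ((x : ℂ) - ξ + ε * Complex.I)) fun j x => by
        have h1 : HasDerivAt (fun x : ℂ => x - ξ + ε * Complex.I) 1 (x : ℂ) := by
          simpa using ((hasDerivAt_id (x : ℂ)).sub_const (ξ : ℂ)).add_const (ε * Complex.I)
        have h2 := (hder j _ (him x)).comp (x : ℂ) h1
        rw [mul_one] at h2
        exact h2.comp_ofReal
    rw [h, integral_saddlePath_eq_integral _ _ (by linarith) (by linarith) hε hθ,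
      ← intervalIntegral.integral_const_mul]
    congr 1
    refine intervalIntegral.integral_congr fun x hx => ?_
    rw [Set.uIcc_of_le (by norm_num)] at hx
    rw [hpow n hnτ _ (him x), Complex.real_smul, ofReal_jacobiWeight hx]
    ring
  have hL : Tendsto (fun ε : ℝ => ∫ x in (-1 : ℝ)..1,
      (jacobiWeight α β x * jacobiP α β n x) • f 0 (x - ξ + ε * Complex.I)) (𝓝[>] 0)
      (𝓝 (∫ x in (-1 : ℝ)..1, (jacobiWeight α β x * jacobiP α β n x) • v (x - ξ))) := by
    have hP := continuous_jacobiP α β n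
    have hne : ∀ᵐ x : ℝ, x ≠ ξ := MeasureTheory.Measure.ae_ne MeasureTheory.volume ξ
    refine intervalIntegral.tendsto_integral_filter_of_dominated_convergence
      (fun x => |x - ξ| ^ μ * jacobiWeight α β x * (|jacobiP α β n x| * C)) ?_ ?_ ?_ ?_
    · filter_upwards [self_mem_nhdsWithin] with ε hε
      have hε' : (0 : ℝ) < ε := hε
      have hcf : Continuous fun x : ℝ => f 0 ((x : ℂ) - ξ + ε * Complex.I) := by
        refine continuous_iff_continuousAt.2 fun x => ?_
        have : ContinuousAt (f 0) ((x : ℂ) - ξ + ε * Complex.I) :=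
          (hder 0 _ (by simpa using hε')).continuousAt
        exact this.comp (f := fun x : ℝ => (x : ℂ) - ξ + ε * Complex.I) (by fun_prop)
      exact (intervalIntegrable_jacobi_smul hα hβ n hcf.continuousOn).def'.aestronglyMeasurable
    · filter_upwards [Ioo_mem_nhdsGT (zero_lt_one' ℝ)] with ε hε
      filter_upwards [hne] with x hx hxI
      rw [Set.uIoc_of_le (by norm_num)] at hxI
      have hw : 0 ≤ jacobiWeight α β x := mul_nonneg
        (Real.rpow_nonneg (by linarith [hxI.2]) _) (Real.rpow_nonneg (by linarith [hxI.1]) _)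
      have him : 0 < ((x : ℂ) - ξ + ε * Complex.I).im := by simpa using hε.1
      have hxξ : ‖(x : ℂ) - ξ‖ = |x - ξ| := by
        rw [← Complex.ofReal_sub, Complex.norm_real, Real.norm_eq_abs]
      have h3 : ‖(x : ℂ) - ξ + ε * Complex.I‖ ≤ 3 := by
        refine (norm_add_le _ _).trans ?_
        rw [hxξ, norm_mul, Complex.norm_I, mul_one, Complex.norm_real, Real.norm_of_nonneg hε.1.le]
        have : |x - ξ| ≤ 2 := abs_le.2 ⟨by linarith [hxI.1, hξ.2], by linarith [hxI.2, hξ.1]⟩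
        linarith [hε.2]
      have hle : |x - ξ| ≤ ‖(x : ℂ) - ξ + ε * Complex.I‖ := by
        have := Complex.abs_re_le_norm ((x : ℂ) - ξ + ε * Complex.I)
        simpa using this
      have hpos : 0 < |x - ξ| := abs_pos.2 (sub_ne_zero.2 hx)
      have hb := hbound _ him h3
      have hC : 0 ≤ C := by
        have h0 : 0 < ‖(x : ℂ) - ξ + ε * Complex.I‖ ^ μ := Real.rpow_pos_of_pos (hpos.trans_le hle) _
        exact nonneg_of_mul_nonneg_left ((norm_nonneg _).trans hb) h0
      rw [norm_smul, norm_mul, Real.norm_of_nonneg hw, Real.norm_eq_abs]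
      have := Real.rpow_le_rpow_of_nonpos hpos hle hμ0
      calc jacobiWeight α β x * |jacobiP α β n x| * ‖f 0 ((x : ℂ) - ξ + ε * Complex.I)‖
          ≤ jacobiWeight α β x * |jacobiP α β n x| * (C * |x - ξ| ^ μ) := by
            gcongr
            exact hb.trans (by gcongr)
        _ = _ := by ring
    · refine (intervalIntegrable_abs_sub_rpow_mul_jacobiWeight hα hβ hμ hξ).mul_continuousOn ?_
      fun_prop
    · filter_upwards [hne] with x hx _
      have := hlim (x - ξ) (sub_ne_zero.2 hx)
      push_cast at this
      exact this.const_smul _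
  have hR := ((tendsto_integral_saddlePath (a := α + n) (b := β + n) (c := τ - n) (by linarith)
    (by linarith) (by linarith) hθ).const_mul (κ * (-1) ^ n * (Real.Gamma (n - τ) : ℂ))).const_smul
      (1 / (2 ^ n * n.factorial) : ℝ)
  have hR' := hR.congr' (f₂ := fun ε : ℝ => ∫ x in (-1 : ℝ)..1,
      (jacobiWeight α β x * jacobiP α β n x) • f 0 (x - ξ + ε * Complex.I)) (by
    filter_upwards [self_mem_nhdsWithin] with ε hε using (hfactor ε hε).symm)
  rw [tendsto_nhds_unique hL hR']
  have hsad : ∫ t in (-1 : ℝ)..1, (1 - saddlePath θ t) ^ ((α + n : ℝ) : ℂ) *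
            (1 + saddlePath θ t) ^ ((β + n : ℝ) : ℂ) *
            (saddlePath θ t - ξ) ^ ((τ - n : ℝ) : ℂ) * saddlePathDeriv θ t =
      (-2 * Complex.exp (θ * Complex.I)) ^ n *
        ∫ t in (-1 : ℝ)..1, saddleAmp α β τ θ t * (1 - (t : ℂ) ^ 2) ^ n := by
    rw [← intervalIntegral.integral_const_mul]
    exact intervalIntegral.integral_congr_Ioo_of_le (by norm_num) fun t ht =>
      saddle_integrand_eq hθ n ht
  rw [hsad, Complex.real_smul, mul_pow]
  push_cast
  have h2 : (2 : ℂ) ^ n ≠ 0 := pow_ne_zero _ two_ne_zero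
  have h3 : (n.factorial : ℂ) ≠ 0 := by exact_mod_cast n.factorial_ne_zero
  -- The sign `(-1) ^ n` of the `n`-th derivative and `(-2) ^ n` from the saddle value cancel the `2
  -- ^ n` of the integrations by parts.
  have h4 : (-1 : ℂ) ^ n * (-2) ^ n = 2 ^ n := by rw [← mul_pow]; norm_num
  field_simp
  linear_combination κ * Real.Gamma (n - τ) *
        (∫ t in (-1 : ℝ)..1, saddleAmp α β τ θ t * (1 - (t : ℂ) ^ 2) ^ n) * h4

/-- The coefficients of the `j`-th derivative of `ζ ^ τ (p + q log ζ)`. -/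
noncomputable def logPowCoeff (τ : ℝ) (p q : ℂ) : ℕ → ℂ × ℂ
  | 0 => (p, q)
  | j + 1 => ((τ - j) * (logPowCoeff τ p q j).1 + (logPowCoeff τ p q j).2,
      (τ - j) * (logPowCoeff τ p q j).2)

/-- The `j`-th derivative of `ζ ^ τ (p + q log ζ)`. -/
noncomputable def logPow (τ : ℝ) (p q : ℂ) (j : ℕ) (ζ : ℂ) : ℂ :=
  ζ ^ ((τ - j : ℝ) : ℂ) * ((logPowCoeff τ p q j).1 + (logPowCoeff τ p q j).2 * Complex.log ζ)

theorem hasDerivAt_logPow (τ : ℝ) (p q : ℂ) (j : ℕ) {ζ : ℂ} (hζ : 0 < ζ.im) :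
    HasDerivAt (logPow τ p q j) (logPow τ p q (j + 1) ζ) ζ := by
  have hs : ζ ∈ Complex.slitPlane := Or.inr hζ.ne'
  have h0 : ζ ≠ 0 := Complex.slitPlane_ne_zero hs
  have h1 : HasDerivAt (fun ζ : ℂ => ζ ^ ((τ - j : ℝ) : ℂ))
      (((τ - j : ℝ) : ℂ) * ζ ^ (((τ - j : ℝ) : ℂ) - 1)) ζ := by
    simpa using (hasDerivAt_id ζ).cpow_const (c := ((τ - j : ℝ) : ℂ)) hs
  have h2 := ((Complex.hasDerivAt_log hs).const_mul (logPowCoeff τ p q j).2).const_add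
    (logPowCoeff τ p q j).1
  refine (h1.mul h2).congr_deriv ?_
  have h3 : ζ ^ ((τ - j : ℝ) : ℂ) = ζ ^ (((τ - j : ℝ) : ℂ) - 1) * ζ := by
    rw [Complex.cpow_sub _ _ h0, Complex.cpow_one]; field_simp
  rw [h3]
  simp only [logPow, logPowCoeff]
  rw [show ((τ - (j + 1 : ℕ) : ℝ) : ℂ) = ((τ - j : ℝ) : ℂ) - 1 by push_cast; ring]
  push_cast
  field_simp
  ring

/-- Without logarithm the coefficient is `p` times the falling factorial of `τ`, which the
functional equation turns into a Gamma quotient. -/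
theorem logPowCoeff_of_ne_int {τ : ℝ} (hτ : ∀ m : ℤ, τ ≠ m) (p : ℂ) (n : ℕ) :
    logPowCoeff τ p 0 n = (p / Real.Gamma (-τ) * (-1) ^ n * Real.Gamma (n - τ), 0) := by
  have hG : Real.Gamma (-τ) ≠ 0 :=
    Real.Gamma_ne_zero fun m hm => hτ m (by push_cast; linarith)
  have hG' : (Real.Gamma (-τ) : ℂ) ≠ 0 := by exact_mod_cast hG
  induction n with
  | zero => simp [logPowCoeff, hG']
  | succ n ih =>
    have h1 : (n : ℝ) - τ ≠ 0 := fun h => hτ n (by push_cast; linarith)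
    simp only [logPowCoeff, ih, mul_zero, add_zero]
    rw [show ((n + 1 : ℕ) : ℝ) - τ = n - τ + 1 by push_cast; ring, Real.Gamma_add_one h1]
    push_cast
    congr 1
    ring

/-- Differentiation number `m + 1` carries the factor `τ - m = 0`, which kills the logarithm and the
contribution of `p`; what remains is the pure power with coefficient `m! q`. -/
theorem logPowCoeff_natCast (m : ℕ) (p q : ℂ) (i : ℕ) :
    logPowCoeff m p q (m + 1 + i) =
      ((-1) ^ (m + 1) * m.factorial * q * (-1) ^ (m + 1 + i) *
        Real.Gamma ((m + 1 + i : ℕ) - (m : ℝ)), 0) := by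
  have h1 : ∀ j ≤ m, (logPowCoeff m p q j).2 = m.descFactorial j * q := by
    intro j hj
    induction j with
    | zero => simp [logPowCoeff]
    | succ j ih =>
      rw [logPowCoeff, ih (by omega), Nat.descFactorial_succ, Nat.cast_mul, Nat.cast_sub (by omega)]
      push_cast; ring
  have h2 : ∀ i : ℕ, Real.Gamma ((m + 1 + i : ℕ) - (m : ℝ)) = i.factorial := fun i => by
    rw [← Real.Gamma_nat_eq_factorial]; congr 1; push_cast; ring
  have h3 : (-1 : ℂ) ^ (m + 1) * (-1) ^ (m + 1) = 1 := by rw [← mul_pow]; norm_num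
  simp only [h2]
  induction i with
  | zero =>
    simp only [add_zero, logPowCoeff, h1 m le_rfl, Nat.descFactorial_self]
    push_cast
    simp only [sub_self, zero_mul, zero_add, Nat.factorial_zero, Nat.cast_one, mul_one]
    congr 1
    linear_combination (-(m.factorial : ℂ) * q) * h3
  | succ i ih =>
    rw [← add_assoc, logPowCoeff, ih]
    simp only [mul_zero, add_zero, Nat.factorial_succ]
    push_cast
    congr 1
    ring

theorem exists_norm_logPow_le {τ : ℝ} (hτ : -1 < τ) (p q : ℂ) :
    ∃ μ C : ℝ, -1 < μ ∧ μ ≤ 0 ∧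
      ∀ ζ : ℂ, ζ ≠ 0 → ‖ζ‖ ≤ 3 → ‖logPow τ p q 0 ζ‖ ≤ C * ‖ζ‖ ^ μ := by
  -- An exponent above `-1` and strictly below `τ`: the spare power `‖ζ‖ ^ δ` absorbs the logarithm
  -- near `0`.
  set μ := min ((τ - 1) / 2) 0 with hμ
  have hμ1 : -1 < μ := lt_min (by linarith) (by norm_num)
  have hμ2 : μ ≤ (τ - 1) / 2 := min_le_left _ _
  set δ := τ - μ with hδ
  have hδ0 : 0 < δ := by linarith
  refine ⟨μ, 3 ^ δ * (‖p‖ + ‖q‖ * Real.pi) + ‖q‖ * (1 / δ + 3 * 3 ^ δ), hμ1, min_le_right _ _,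
    fun ζ hζ h3 => ?_⟩
  set r := ‖ζ‖ with hr
  have hr0 : 0 < r := norm_pos_iff.2 hζ
  have hlog : ‖Complex.log ζ‖ ≤ |Real.log r| + Real.pi := by
    refine (Complex.norm_le_abs_re_add_abs_im _).trans ?_
    rw [Complex.log_re, Complex.log_im]
    gcongr
    exact Complex.abs_arg_le_pi ζ
  have hrδ : r ^ δ ≤ 3 ^ δ := Real.rpow_le_rpow hr0.le h3 hδ0.le
  have hrl : r ^ δ * |Real.log r| ≤ 1 / δ + 3 * 3 ^ δ := by
    rcases le_total r 1 with h | h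
    · have := (Real.abs_log_mul_self_rpow_lt r δ hr0 h hδ0).le
      rw [abs_mul, abs_of_nonneg (Real.rpow_nonneg hr0.le δ), mul_comm] at this
      have : 0 ≤ 3 * (3 : ℝ) ^ δ := by positivity
      linarith
    · have h1 : |Real.log r| ≤ 3 := by
        rw [abs_of_nonneg (Real.log_nonneg h)]
        linarith [Real.log_le_sub_one_of_pos hr0]
      have : r ^ δ * |Real.log r| ≤ 3 ^ δ * 3 := by gcongr
      have : 0 ≤ 1 / δ := by positivity
      linarith
  have hsplit : r ^ τ = r ^ μ * r ^ δ := by rw [← Real.rpow_add hr0]; congr 1; ring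
  simp only [logPow, logPowCoeff, Nat.cast_zero, sub_zero, norm_mul, Complex.norm_cpow_real]
  rw [← hr, hsplit]
  calc r ^ μ * r ^ δ * ‖p + q * Complex.log ζ‖
      ≤ r ^ μ * r ^ δ * (‖p‖ + ‖q‖ * (|Real.log r| + Real.pi)) := by
        gcongr
        refine (norm_add_le _ _).trans ?_
        rw [norm_mul]
        gcongr
    _ = r ^ μ * (r ^ δ * (‖p‖ + ‖q‖ * Real.pi) + ‖q‖ * (r ^ δ * |Real.log r|)) := by ring
    _ ≤ r ^ μ * (3 ^ δ * (‖p‖ + ‖q‖ * Real.pi) + ‖q‖ * (1 / δ + 3 * 3 ^ δ)) := by gcongr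
    _ = _ := by ring

/-- On the negative axis the principal logarithm takes its limit from the upper half plane, so the
boundary value is the value of the formula itself. -/
theorem tendsto_logPow_boundary (τ : ℝ) (p q : ℂ) {x : ℝ} (hx : x ≠ 0) :
    Tendsto (fun ε : ℝ => logPow τ p q 0 (x + ε * Complex.I)) (𝓝[>] 0) (𝓝 (logPow τ p q 0 x)) := by
  have hline : Tendsto (fun ε : ℝ => (x : ℂ) + ε * Complex.I) (𝓝[>] 0)
      (𝓝[{z : ℂ | 0 ≤ z.im}] (x : ℂ)) := by
    refine tendsto_nhdsWithin_iff.2 ⟨?_, ?_⟩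
    · have : Continuous fun ε : ℝ => (x : ℂ) + ε * Complex.I := by fun_prop
      have h := this.tendsto 0
      simp only [Complex.ofReal_zero, zero_mul, add_zero] at h
      exact h.mono_left nhdsWithin_le_nhds
    · filter_upwards [self_mem_nhdsWithin] with ε hε
      simpa using le_of_lt hε
  have hlog : Tendsto (fun ε : ℝ => Complex.log (x + ε * Complex.I)) (𝓝[>] 0)
      (𝓝 (Complex.log x)) := by
    rcases hx.lt_or_gt with h | h
    · exact (Complex.continuousWithinAt_log_of_re_neg_of_im_zero (z := (x : ℂ)) (by simpa using h)
        (by simp)).tendsto.comp hline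
    · exact (continuousAt_clog (x := (x : ℂ)) (Or.inl (by simpa using h))).tendsto.comp
        (hline.mono_right nhdsWithin_le_nhds)
  have hx' : (x : ℂ) ≠ 0 := by exact_mod_cast hx
  have hlim : Tendsto (fun ε : ℝ => Complex.exp (Complex.log (x + ε * Complex.I) * ((τ : ℝ) : ℂ)) *
      (p + q * Complex.log (x + ε * Complex.I))) (𝓝[>] 0)
      (𝓝 (Complex.exp (Complex.log x * ((τ : ℝ) : ℂ)) * (p + q * Complex.log x))) :=
    ((Complex.continuous_exp.tendsto _).comp (hlog.mul_const _)).mul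
      ((hlog.const_mul q).const_add p)
  simp only [logPow, logPowCoeff, Nat.cast_zero, sub_zero]
  rw [Complex.cpow_def_of_ne_zero hx']
  refine hlim.congr' ?_
  filter_upwards with ε
  have : (x : ℂ) + ε * Complex.I ≠ 0 := fun h => hx (by simpa using congrArg Complex.re h)
  rw [Complex.cpow_def_of_ne_zero this]

theorem integral_jacobi_re_logPow {α β θ τ : ℝ} {p q κ : ℂ} (hα : -1 < α) (hβ : -1 < β) (hτ : -1 < τ)
    (hθ : θ ∈ Set.Ioo 0 Real.pi)
    (hcoef : ∀ n : ℕ, τ < n → logPowCoeff τ p q n = (κ * (-1) ^ n * Real.Gamma (n - τ), 0))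
    {n : ℕ} (hn : 1 ≤ n) (hnτ : τ < n) :
    ∫ x in (-1 : ℝ)..1, jacobiWeight α β x * jacobiP α β n x *
        (logPow τ p q 0 ((x - Real.cos θ : ℝ) : ℂ)).re =
      (κ * Real.Gamma (n - τ) / n.factorial * Complex.exp (θ * Complex.I) ^ n *
        ∫ t in (-1 : ℝ)..1, saddleAmp α β τ θ t * (1 - (t : ℂ) ^ 2) ^ n).re := by
  obtain ⟨μ, C, hμ, hμ0, hb⟩ := exists_norm_logPow_le hτ p q
  have h := integral_jacobi_boundary_values (C := C) hα hβ hθ (f := logPow τ p q)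
    (v := fun x : ℝ => logPow τ p q 0 x) (fun j ζ hζ => hasDerivAt_logPow τ p q j hζ)
    (fun n hn ζ _ => by simp only [logPow, hcoef n hn]; ring)
    (fun x hx => tendsto_logPow_boundary τ p q hx) hμ hμ0
    (fun ζ hζ h3 => hb ζ (fun h => by simp [h] at hζ) h3) hn hnτ
  rw [← h]
  have hξ := cos_mem_Ioo hθ
  have hmeas : Measurable fun x : ℝ => logPow τ p q 0 ((x - Real.cos θ : ℝ) : ℂ) := by
    unfold logPow
    have h1 : Measurable fun x : ℝ => ((x - Real.cos θ : ℝ) : ℂ) := by fun_prop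
    exact (h1.pow_const _).mul (measurable_const.add (measurable_const.mul
      (Complex.measurable_log.comp h1)))
  have hwm : Measurable (jacobiWeight α β) := by unfold jacobiWeight; fun_prop
  have hint : IntervalIntegrable (fun x : ℝ => (jacobiWeight α β x * jacobiP α β n x) •
      logPow τ p q 0 ((x - Real.cos θ : ℝ) : ℂ)) MeasureTheory.volume (-1) 1 := by
    have hi := (intervalIntegrable_abs_sub_rpow_mul_jacobiWeight hα hβ hμ hξ).mul_continuousOn
      (g := fun x => |jacobiP α β n x| * C)
      (by have := continuous_jacobiP α β n; fun_prop)
    refine hi.mono_fun' ?_ ?_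
    · exact ((hwm.mul (continuous_jacobiP α β n).measurable).smul hmeas).aestronglyMeasurable
    · rw [Filter.EventuallyLE, MeasureTheory.ae_restrict_iff' measurableSet_uIoc]
      filter_upwards [MeasureTheory.Measure.ae_ne MeasureTheory.volume (Real.cos θ)] with x hx hxI
      rw [Set.uIoc_of_le (by norm_num)] at hxI
      have hw : 0 ≤ jacobiWeight α β x := mul_nonneg
        (Real.rpow_nonneg (by linarith [hxI.2]) _) (Real.rpow_nonneg (by linarith [hxI.1]) _)
      have hn : ‖((x - Real.cos θ : ℝ) : ℂ)‖ = |x - Real.cos θ| := by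
        rw [Complex.norm_real, Real.norm_eq_abs]
      have h3 : |x - Real.cos θ| ≤ 3 :=
        abs_le.2 ⟨by linarith [hxI.1, hξ.2], by linarith [hxI.2, hξ.1]⟩
      have := hb _ (Complex.ofReal_ne_zero.2 (sub_ne_zero.2 hx)) (hn.trans_le h3)
      rw [hn] at this
      rw [norm_smul, norm_mul, Real.norm_of_nonneg hw, Real.norm_eq_abs]
      calc _ ≤ jacobiWeight α β x * |jacobiP α β n x| * (C * |x - Real.cos θ| ^ μ) := by gcongr
        _ = _ := by ring
  have := Complex.reCLM.intervalIntegral_comp_comm hint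
  simp only [Complex.reCLM_apply, Complex.smul_re, smul_eq_mul] at this
  exact this

theorem ofReal_cpow_of_neg {x : ℝ} (hx : x < 0) (τ : ℝ) :
    (x : ℂ) ^ (τ : ℂ) = ((|x| ^ τ : ℝ) : ℂ) * Complex.exp ((Real.pi * τ : ℝ) * Complex.I) := by
  rw [Complex.ofReal_cpow_of_nonpos hx.le, abs_of_neg hx, Complex.ofReal_cpow (by linarith)]
  push_cast
  congr 2
  ring

/-- The integral of a one-sided power against a Jacobi polynomial, as a steepest descent integral. -/
theorem exists_integral_jacobi_abs_rpow {τ : ℝ} (hτ : -1 < τ) (A B : ℝ) :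
    ∃ κ : ℂ, (A = 1 → B = 1 → (∀ m : ℤ, τ ≠ 2 * m) →
        κ = -(2 / Real.pi * Real.Gamma (τ + 1) * Real.sin (Real.pi * τ / 2) : ℝ) *
          Complex.exp ((-(Real.pi * τ / 2) : ℝ) * Complex.I)) ∧
      ∀ {α β θ : ℝ}, -1 < α → -1 < β → θ ∈ Set.Ioo 0 Real.pi → ∀ {n : ℕ}, 1 ≤ n → τ < n →
        ∫ x in (-1 : ℝ)..1, jacobiWeight α β x * jacobiP α β n x *
            (|x - Real.cos θ| ^ τ * if Real.cos θ < x then A else B) =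
          (κ * Real.Gamma (n - τ) / n.factorial * Complex.exp (θ * Complex.I) ^ n *
            ∫ t in (-1 : ℝ)..1, saddleAmp α β τ θ t * (1 - (t : ℂ) ^ 2) ^ n).re := by
  have main : ∀ p q κ : ℂ, (∀ x : ℝ, 0 < x → (logPow τ p q 0 x).re = |x| ^ τ * A) →
      (∀ x : ℝ, x < 0 → (logPow τ p q 0 x).re = |x| ^ τ * B) →
      (∀ n : ℕ, τ < n → logPowCoeff τ p q n = (κ * (-1) ^ n * Real.Gamma (n - τ), 0)) →
      ∀ {α β θ : ℝ}, -1 < α → -1 < β → θ ∈ Set.Ioo 0 Real.pi → ∀ {n : ℕ}, 1 ≤ n → τ < n →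
        ∫ x in (-1 : ℝ)..1, jacobiWeight α β x * jacobiP α β n x *
            (|x - Real.cos θ| ^ τ * if Real.cos θ < x then A else B) =
          (κ * Real.Gamma (n - τ) / n.factorial * Complex.exp (θ * Complex.I) ^ n *
            ∫ t in (-1 : ℝ)..1, saddleAmp α β τ θ t * (1 - (t : ℂ) ^ 2) ^ n).re := by
    intro p q κ h1 h2 h3 α β θ hα hβ hθ n hn hnτ
    rw [← integral_jacobi_re_logPow hα hβ hτ hθ h3 hn hnτ]
    refine intervalIntegral.integral_congr_ae ?_
    filter_upwards [MeasureTheory.Measure.ae_ne MeasureTheory.volume (Real.cos θ)] with x hx _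
    rcases hx.lt_or_gt with h | h
    · rw [if_neg h.le.not_gt, h2 _ (by linarith)]
    · rw [if_pos h, h1 _ (by linarith)]
  by_cases hint : ∃ m : ℤ, τ = m
  · obtain ⟨m', hm'⟩ := hint
    obtain ⟨m, rfl⟩ : ∃ m : ℕ, m' = m := by
      refine ⟨m'.toNat, (Int.toNat_of_nonneg ?_).symm⟩
      have : (-1 : ℝ) < m' := by rw [← hm']; exact hτ
      have : (-1 : ℤ) < m' := by exact_mod_cast this
      omega
    obtain rfl : τ = m := by simpa using hm'
    -- For `x < 0` the logarithm has imaginary part `π`, so the real part is `|x| ^ m (-1) ^ m (A -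
    -- π y)`; `y` makes this `|x| ^ m B`.
    set y : ℝ := (A - (-1) ^ m * B) / Real.pi with hy
    refine ⟨(-1) ^ (m + 1) * m.factorial * (y * Complex.I), fun hA hB hodd => ?_,
      main A (y * Complex.I) _ (fun x hx => ?_) (fun x hx => ?_) fun n hn => ?_⟩
    · have hmo : Odd m := by
        rw [← Nat.not_even_iff_odd]
        rintro ⟨k, hk⟩
        exact hodd k (by rw [hk]; push_cast; ring)
      obtain ⟨k, hk⟩ := hmo
      have hm1 : (-1 : ℝ) ^ m = -1 := Odd.neg_one_pow ⟨k, hk⟩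
      have hy' : y = 2 / Real.pi := by rw [hy, hA, hB, hm1]; ring
      -- For odd `m` the exponential in the claimed `κ` is `-i sin(πm / 2)`, and `sin² = 1`.
      have hcos : Real.cos (Real.pi * m / 2) = 0 := by
        rw [Real.cos_eq_zero_iff]
        exact ⟨k, by rw [hk]; push_cast; ring⟩
      have hsin : Real.sin (Real.pi * m / 2) ^ 2 = 1 := by
        have := Real.sin_sq_add_cos_sq (Real.pi * m / 2)
        rw [hcos] at this; linarith
      rw [Complex.exp_mul_I, ← Complex.ofReal_cos, ← Complex.ofReal_sin, Real.cos_neg, hcos,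
        Real.sin_neg, Real.Gamma_nat_eq_factorial, hy', pow_succ,
        show (-1 : ℂ) ^ m = ((-1 : ℝ) ^ m : ℝ) by push_cast; rfl, hm1]
      have hsin' : ((Real.sin (Real.pi * m / 2) : ℝ) : ℂ) ^ 2 = 1 := by exact_mod_cast hsin
      push_cast at hsin' ⊢
      linear_combination (-(2 / (Real.pi : ℂ) * m.factorial * Complex.I)) * hsin'
    · simp only [logPow, logPowCoeff, Nat.cast_zero, sub_zero]
      rw [← Complex.ofReal_cpow hx.le, ← Complex.ofReal_log hx.le, Complex.re_ofReal_mul,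
        abs_of_pos hx]
      simp
    · simp only [logPow, logPowCoeff, Nat.cast_zero, sub_zero]
      have h1 : (x : ℂ) ^ ((m : ℝ) : ℂ) = ((|x| ^ (m : ℝ) * (-1) ^ m : ℝ) : ℂ) := by
        rw [Complex.ofReal_natCast, Complex.cpow_natCast, Real.rpow_natCast, ← mul_pow,
          abs_of_neg hx]
        push_cast; congr 1; ring
      rw [h1, Complex.re_ofReal_mul, Complex.add_re, mul_assoc (y : ℂ), Complex.re_ofReal_mul,
        Complex.I_mul_re, Complex.log_im, Complex.arg_ofReal_of_neg hx, Complex.ofReal_re, mul_assoc]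
      congr 1
      have hpi := Real.pi_ne_zero
      have : (-1 : ℝ) ^ m * (-1) ^ m = 1 := by rw [← mul_pow]; norm_num
      rw [hy]
      field_simp
      linear_combination B * this
    · have hn' : m < n := by exact_mod_cast hn
      obtain ⟨i, rfl⟩ : ∃ i, n = m + 1 + i := ⟨n - (m + 1), by omega⟩
      rw [logPowCoeff_natCast]
  · push Not at hint
    have hs : Real.sin (Real.pi * τ) ≠ 0 := by
      intro h
      obtain ⟨k, hk⟩ := Real.sin_eq_zero_iff.1 h
      exact hint k (mul_left_cancel₀ Real.pi_ne_zero (by linarith))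
    -- For `x < 0` the real part is `|x| ^ τ (A cos πτ - y sin πτ)`; `y` makes this `|x| ^ τ B`, as
    -- `sin πτ ≠ 0`.
    set y : ℝ := (A * Real.cos (Real.pi * τ) - B) / Real.sin (Real.pi * τ) with hy
    refine ⟨(A + y * Complex.I) / Real.Gamma (-τ), fun hA hB _ => ?_,
      main (A + y * Complex.I) 0 _ (fun x hx => ?_) (fun x hx => ?_) fun n _ =>
        logPowCoeff_of_ne_int hint _ n⟩
    · have h2 : Real.pi * τ = 2 * (Real.pi * τ / 2) := by ring
      have hsin : Real.sin (Real.pi * τ) =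
          2 * Real.sin (Real.pi * τ / 2) * Real.cos (Real.pi * τ / 2) := by
        conv_lhs => rw [h2, Real.sin_two_mul]
      have hcos : Real.cos (Real.pi * τ) = 1 - 2 * Real.sin (Real.pi * τ / 2) ^ 2 := by
        conv_lhs => rw [h2, Real.cos_two_mul, Real.cos_sq']
        ring
      -- The reflection formula exchanges `1 / Γ(-τ)` for `-Γ(τ + 1) sin(πτ) / π`.
      have hG := Real.Gamma_mul_Gamma_one_sub (-τ)
      rw [sub_neg_eq_add, add_comm 1 τ, mul_neg, Real.sin_neg, hsin] at hG
      have hG0 : Real.Gamma (-τ) ≠ 0 :=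
        Real.Gamma_ne_zero fun m hm => hint m (by push_cast; linarith)
      rw [Complex.exp_mul_I, ← Complex.ofReal_cos, ← Complex.ofReal_sin, Real.cos_neg, Real.sin_neg]
      rw [hsin] at hs
      rw [hA, hB, hcos, hsin] at hy
      set s := Real.sin (Real.pi * τ / 2)
      set c := Real.cos (Real.pi * τ / 2)
      have hs0 : s ≠ 0 := fun h => hs (by rw [h]; ring)
      have hc0 : c ≠ 0 := fun h => hs (by rw [h]; ring)
      have hyc : y * c = -s := by rw [hy]; field_simp; ring
      have hG' : Real.Gamma (-τ) * (2 / Real.pi * Real.Gamma (τ + 1) * s) * c = -1 := by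
        have hpi := Real.pi_ne_zero
        field_simp at hG ⊢
        linear_combination hG
      have hGc : (Real.Gamma (-τ) : ℂ) ≠ 0 := by exact_mod_cast hG0
      have hyc' : (y : ℂ) * c = -s := by exact_mod_cast hyc
      have hG'' : (Real.Gamma (-τ) : ℂ) * ((2 / Real.pi * Real.Gamma (τ + 1) * s : ℝ) : ℂ) * c = -1 := by
        exact_mod_cast hG'
      have hcc : (c : ℂ) ≠ 0 := by exact_mod_cast hc0
      rw [div_eq_iff hGc, hA]
      apply mul_right_cancel₀ hcc
      rw [Complex.ofReal_one, Complex.ofReal_neg s]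
      linear_combination Complex.I * hyc' + ((c : ℂ) - s * Complex.I) * hG''
    · simp only [logPow, logPowCoeff, Nat.cast_zero, sub_zero]
      rw [← Complex.ofReal_cpow hx.le, Complex.re_ofReal_mul, abs_of_pos hx]
      simp
    · simp only [logPow, logPowCoeff, Nat.cast_zero, sub_zero]
      rw [ofReal_cpow_of_neg hx, mul_assoc, Complex.re_ofReal_mul, Complex.exp_mul_I,
        ← Complex.ofReal_cos, ← Complex.ofReal_sin]
      congr 1
      simp only [zero_mul, add_zero, Complex.mul_re, Complex.add_re, Complex.add_im, Complex.ofReal_re,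
        Complex.ofReal_im, Complex.I_re, Complex.I_im, Complex.mul_im]
      rw [hy]
      field_simp
      ring

/-! ### Laplace's method on the steepest descent path. -/

/-- The beta integral with both exponents `n`, simplified by the duplication formula. -/
theorem integral_one_sub_sq_pow (n : ℕ) :
    ∫ t in (-1 : ℝ)..1, (1 - t ^ 2) ^ n =
      Real.sqrt Real.pi * (Real.Gamma (n + 1) / Real.Gamma (n + 3 / 2)) := by
  have h := integral_jacobiWeight (α := n) (β := n) (by linarith [(n.cast_nonneg : (0 : ℝ) ≤ n)])
    (by linarith [(n.cast_nonneg : (0 : ℝ) ≤ n)])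
  have h1 : ∫ t in (-1 : ℝ)..1, (1 - t ^ 2) ^ n = ∫ x in (-1 : ℝ)..1, jacobiWeight n n x := by
    refine intervalIntegral.integral_congr fun x _ => ?_
    rw [jacobiWeight, Real.rpow_natCast, Real.rpow_natCast, ← mul_pow]
    congr 1; ring
  have h2 := Real.Gamma_mul_Gamma_add_half (n + 1)
  rw [h1, h, show (n : ℝ) + n + 2 = 2 * (n + 1) by ring]
  rw [show (n : ℝ) + 1 + 1 / 2 = n + 3 / 2 by ring] at h2
  have hn : (0 : ℝ) ≤ n := n.cast_nonneg
  have hG2 := (Real.Gamma_pos_of_pos (by linarith : (0 : ℝ) < n + 3 / 2)).ne'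
  have hG3 := (Real.Gamma_pos_of_pos (by linarith : (0 : ℝ) < 2 * (n + 1))).ne'
  have hp : (2 : ℝ) ^ ((n : ℝ) + n + 1) * 2 ^ (1 - 2 * ((n : ℝ) + 1)) = 1 := by
    rw [← Real.rpow_add two_pos, show (n : ℝ) + n + 1 + (1 - 2 * (n + 1)) = 0 by ring, Real.rpow_zero]
  rw [← mul_div_assoc, div_eq_div_iff hG3 hG2]
  linear_combination 2 ^ ((n : ℝ) + n + 1) * Real.Gamma (n + 1) * h2 +
    Real.Gamma (n + 1) * Real.Gamma (2 * (n + 1)) * Real.sqrt Real.pi * hp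

theorem asympPow_integral_one_sub_sq_pow :
    AsympPow (fun n => ∫ t in (-1 : ℝ)..1, (1 - t ^ 2) ^ n) (Real.sqrt Real.pi) (-(1 / 2)) := by
  have h := (asympPow_Gamma_div 1 (3 / 2)).const_mul (Real.sqrt Real.pi)
  rw [mul_one, show (1 : ℝ) - 3 / 2 = -(1 / 2) by norm_num] at h
  exact h.congr' (Eventually.of_forall fun n => (integral_one_sub_sq_pow n).symm)

/-- The second moment of `(1 - t²) ^ n` is this difference, so a quadratic error costs one full
order in `n`. -/
theorem integral_one_sub_sq_pow_sub (n : ℕ) :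
    (∫ t in (-1 : ℝ)..1, (1 - t ^ 2) ^ n) - ∫ t in (-1 : ℝ)..1, (1 - t ^ 2) ^ (n + 1) =
      (∫ t in (-1 : ℝ)..1, (1 - t ^ 2) ^ (n + 1)) * (1 / 2 * (((n + 1 : ℕ) : ℝ) + 0)⁻¹) := by
  rw [integral_one_sub_sq_pow, integral_one_sub_sq_pow]
  push_cast
  have hn : (0 : ℝ) ≤ n := n.cast_nonneg
  rw [show (n : ℝ) + 1 + 3 / 2 = n + 3 / 2 + 1 by ring,
    Real.Gamma_add_one (by linarith : (n : ℝ) + 1 ≠ 0),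
    Real.Gamma_add_one (by linarith : (n : ℝ) + 3 / 2 ≠ 0)]
  have hG2 := (Real.Gamma_pos_of_pos (by linarith : (0 : ℝ) < n + 3 / 2)).ne'
  have h1 : (n : ℝ) + 1 ≠ 0 := by linarith
  have h2 : (n : ℝ) + 3 / 2 ≠ 0 := by linarith
  field_simp
  ring

theorem integral_sq_mul_one_sub_sq_pow (n : ℕ) :
    ∫ t in (-1 : ℝ)..1, t ^ 2 * (1 - t ^ 2) ^ n =
      (∫ t in (-1 : ℝ)..1, (1 - t ^ 2) ^ n) - ∫ t in (-1 : ℝ)..1, (1 - t ^ 2) ^ (n + 1) := by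
  rw [← intervalIntegral.integral_sub (Continuous.intervalIntegrable (by fun_prop) _ _)
    (Continuous.intervalIntegrable (by fun_prop) _ _)]
  refine intervalIntegral.integral_congr fun x _ => ?_
  rw [pow_succ]; ring

theorem integral_ofReal_mul_one_sub_sq_pow (n : ℕ) :
    ∫ t in (-1 : ℝ)..1, (t : ℂ) * (1 - (t : ℂ) ^ 2) ^ n = 0 := by
  have h := intervalIntegral.integral_comp_neg (a := -1) (b := 1)
    fun t : ℝ => (t : ℂ) * (1 - (t : ℂ) ^ 2) ^ n
  simp only [neg_neg, Complex.ofReal_neg, neg_mul, neg_sq, intervalIntegral.integral_neg] at h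
  have := eq_neg_of_add_eq_zero_left (a := (2 : ℂ) * ∫ t in (-1 : ℝ)..1, (t : ℂ) * (1 - (t : ℂ) ^ 2) ^ n)
    (b := 0) (by linear_combination -h)
  simpa using this

/-- Laplace's method for the weights `(1 - t ^ 2) ^ n`. -/
theorem norm_integral_mul_one_sub_sq_pow_sub_le {h : ℝ → ℂ} {a b : ℂ} {C : ℝ}
    (hc : ContinuousOn h (Set.Ioo (-1) 1))
    (hC : ∀ t ∈ Set.Ioo (-1 : ℝ) 1, ‖h t * (1 - (t : ℂ) ^ 2) - (a + b * t)‖ ≤ C * t ^ 2) (n : ℕ) :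
    ‖(∫ t in (-1 : ℝ)..1, h t * (1 - (t : ℂ) ^ 2) ^ (n + 1)) -
        a * ((∫ t in (-1 : ℝ)..1, (1 - t ^ 2) ^ n : ℝ) : ℂ)‖ ≤
      C * ((∫ t in (-1 : ℝ)..1, (1 - t ^ 2) ^ n) - ∫ t in (-1 : ℝ)..1, (1 - t ^ 2) ^ (n + 1)) := by
  have hbound : ∀ t ∈ Set.Ioo (-1 : ℝ) 1,
      ‖(h t * (1 - (t : ℂ) ^ 2) - (a + b * t)) * (1 - (t : ℂ) ^ 2) ^ n‖ ≤
        C * (t ^ 2 * (1 - t ^ 2) ^ n) := by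
    intro t ht
    have h1 : 0 ≤ 1 - t ^ 2 := by nlinarith [ht.1, ht.2]
    rw [norm_mul, norm_pow, show (1 - (t : ℂ) ^ 2) = ((1 - t ^ 2 : ℝ) : ℂ) by push_cast; rfl,
      Complex.norm_of_nonneg h1, ← mul_assoc]
    have := hC t ht
    rw [show (1 - (t : ℂ) ^ 2) = ((1 - t ^ 2 : ℝ) : ℂ) by push_cast; rfl] at this
    gcongr
  have hI1 : IntervalIntegrable (fun t : ℝ => C * (t ^ 2 * (1 - t ^ 2) ^ n))
      MeasureTheory.volume (-1) 1 := Continuous.intervalIntegrable (by fun_prop) _ _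
  have hI2 : IntervalIntegrable (fun t : ℝ => (h t * (1 - (t : ℂ) ^ 2) - (a + b * t)) *
      (1 - (t : ℂ) ^ 2) ^ n) MeasureTheory.volume (-1) 1 := by
    rw [intervalIntegrable_iff_integrableOn_Ioo_of_le (by norm_num)] at hI1 ⊢
    refine hI1.mono' (ContinuousOn.aestronglyMeasurable (by fun_prop) measurableSet_Ioo) ?_
    exact (MeasureTheory.ae_restrict_iff' measurableSet_Ioo).2 (Eventually.of_forall hbound)
  have hI3 : IntervalIntegrable (fun t : ℝ => a * (1 - (t : ℂ) ^ 2) ^ n)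
      MeasureTheory.volume (-1) 1 := Continuous.intervalIntegrable (by fun_prop) _ _
  have hI4 : IntervalIntegrable (fun t : ℝ => b * ((t : ℂ) * (1 - (t : ℂ) ^ 2) ^ n))
      MeasureTheory.volume (-1) 1 := Continuous.intervalIntegrable (by fun_prop) _ _
  have e1 : ∫ t in (-1 : ℝ)..1, h t * (1 - (t : ℂ) ^ 2) ^ (n + 1) =
      (∫ t in (-1 : ℝ)..1, (h t * (1 - (t : ℂ) ^ 2) - (a + b * t)) * (1 - (t : ℂ) ^ 2) ^ n) +
      ((∫ t in (-1 : ℝ)..1, a * (1 - (t : ℂ) ^ 2) ^ n) +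
        ∫ t in (-1 : ℝ)..1, b * ((t : ℂ) * (1 - (t : ℂ) ^ 2) ^ n)) := by
    rw [← intervalIntegral.integral_add hI3 hI4, ← intervalIntegral.integral_add hI2 (hI3.add hI4)]
    refine intervalIntegral.integral_congr fun t _ => ?_
    rw [pow_succ]; ring
  have e2 : ∫ t in (-1 : ℝ)..1, a * (1 - (t : ℂ) ^ 2) ^ n =
      a * ((∫ t in (-1 : ℝ)..1, (1 - t ^ 2) ^ n : ℝ) : ℂ) := by
    rw [intervalIntegral.integral_const_mul, ← intervalIntegral.integral_ofReal]
    push_cast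
    rfl
  -- The linear term is odd and integrates to zero, so `b` does not matter.
  rw [e1, e2, intervalIntegral.integral_const_mul b, integral_ofReal_mul_one_sub_sq_pow, mul_zero,
    add_zero, add_sub_cancel_right, ← integral_sq_mul_one_sub_sq_pow,
    ← intervalIntegral.integral_const_mul]
  refine intervalIntegral.norm_integral_le_of_norm_le (by norm_num) ?_ hI1
  filter_upwards [MeasureTheory.Measure.ae_ne MeasureTheory.volume (1 : ℝ)] with t ht1 ht
  exact hbound t ⟨ht.1, lt_of_le_of_ne ht.2 ht1⟩

/-- The amplitude may blow up at `t = ±1`. By the path equation one factor `1 - t²` raises the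
exponents of `|1 - z|` and `|1 + z|` to `α + 1` and `β + 1`, both positive. -/
theorem exists_norm_saddleAmp_mul_le {α β : ℝ} (τ : ℝ) {θ : ℝ} (hα : -1 < α) (hβ : -1 < β)
    (hθ : θ ∈ Set.Ioo 0 Real.pi) :
    ∃ M, ∀ t ∈ Set.Ioo (-1 : ℝ) 1, ‖saddleAmp α β τ θ t * (1 - (t : ℂ) ^ 2)‖ ≤ M := by
  obtain ⟨d, hd, hdz⟩ := exists_le_norm_saddlePath_sub hθ
  obtain ⟨M, hM⟩ := isCompact_Icc.exists_bound_of_continuousOn (continuousOn_saddlePath hθ)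
  obtain ⟨M', hM'⟩ := isCompact_Icc.exists_bound_of_continuousOn (continuousOn_saddlePathDeriv hθ)
  have hM0 : 0 ≤ M := (norm_nonneg _).trans (hM 0 (by norm_num))
  refine ⟨(1 + M) ^ (α + 1) * (1 + M) ^ (β + 1) * (1 / (2 * d)) * (d ^ τ + (M + 1) ^ τ) * M',
    fun t ht => ?_⟩
  have ht' := Set.Ioo_subset_Icc_self ht
  have him := saddlePath_im_pos hθ ht
  have hsq := one_sub_saddlePath_sq θ t
  have hd' := hdz t ht'
  have hz := hM t ht'
  have hz' := hM' t ht'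
  rw [saddleAmp]
  set z := saddlePath θ t
  have h1 : 1 - z ≠ 0 := fun h => by
    have := congrArg Complex.im h; simp at this; exact him.ne' this
  have h2 : 1 + z ≠ 0 := fun h => by
    have := congrArg Complex.im h; simp at this; exact him.ne' this
  have hcos : ‖(Real.cos θ : ℂ)‖ ≤ 1 := by
    rw [Complex.norm_real]; exact Real.abs_cos_le_one θ
  have ha : ‖1 - z‖ ≤ 1 + M := (norm_sub_le _ _).trans (by rw [norm_one]; linarith)
  have hb : ‖1 + z‖ ≤ 1 + M := (norm_add_le _ _).trans (by rw [norm_one]; linarith)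
  have hD : ‖z - Real.cos θ‖ ≤ M + 1 := (norm_sub_le _ _).trans (by linarith)
  have hprod : ‖1 - z‖ * ‖1 + z‖ = 2 * ‖1 - (t : ℂ) ^ 2‖ * ‖z - Real.cos θ‖ := by
    rw [← norm_mul, show (1 - z) * (1 + z) = 1 - z ^ 2 by ring, hsq, norm_mul, norm_mul, norm_mul,
      Complex.norm_exp_ofReal_mul_I]
    simp
  rw [norm_mul, norm_mul, norm_mul, norm_mul, Complex.norm_cpow_real, Complex.norm_cpow_real,
    Complex.norm_cpow_real]
  have ha0 := norm_pos_iff.2 h1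
  have hb0 := norm_pos_iff.2 h2
  set A := ‖1 - z‖
  set B := ‖1 + z‖
  set D := ‖z - Real.cos θ‖
  have hD0 : 0 < D := hd.trans_le hd'
  have hT : ‖1 - (t : ℂ) ^ 2‖ = A * B * (1 / (2 * D)) := by
    rw [hprod]; field_simp
  have hDτ : D ^ τ ≤ d ^ τ + (M + 1) ^ τ := by
    rcases le_or_gt 0 τ with h | h
    · exact (Real.rpow_le_rpow hD0.le hD h).trans (le_add_of_nonneg_left (by positivity))
    · exact (Real.rpow_le_rpow_of_nonpos hd hd' h.le).trans (le_add_of_nonneg_right (by positivity))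
  rw [hT, show A ^ α * B ^ β * D ^ τ * ‖saddlePathDeriv θ t‖ * (A * B * (1 / (2 * D))) =
    A ^ α * A * (B ^ β * B) * (1 / (2 * D)) * D ^ τ * ‖saddlePathDeriv θ t‖ by ring,
    ← Real.rpow_add_one ha0.ne', ← Real.rpow_add_one hb0.ne']
  have hα' : 0 ≤ α + 1 := by linarith
  have hβ' : 0 ≤ β + 1 := by linarith
  have : 0 ≤ d ^ τ + (M + 1) ^ τ := by positivity
  gcongr

theorem analyticAt_saddleAmp (α β τ : ℝ) {θ : ℝ} (hθ : θ ∈ Set.Ioo 0 Real.pi) {t : ℝ}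
    (ht : t ∈ Set.Ioo (-1 : ℝ) 1) : AnalyticAt ℂ (saddleAmp α β τ θ) t := by
  have hm := one_sub_mul_exp_mem_slitPlane hθ (Set.Ioo_subset_Icc_self ht)
  have him := saddlePath_im_pos hθ ht
  have hk : ∀ p : ℂ, AnalyticAt ℂ (fun t : ℂ =>
      (1 - (1 - t ^ 2) * Complex.exp (θ * Complex.I) ^ 2) ^ p) t := fun p =>
    AnalyticAt.cpow (by fun_prop) analyticAt_const hm
  have hk1 := hk (1 / 2)
  have hk2 := hk (1 / 2 - 1)
  have hz : AnalyticAt ℂ (saddlePath θ) t := by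
    unfold saddlePath; fun_prop
  have hz' : AnalyticAt ℂ (saddlePathDeriv θ) t := by
    unfold saddlePathDeriv; fun_prop
  refine (((AnalyticAt.cpow (analyticAt_const.sub hz) analyticAt_const (Or.inr ?_)).mul
    (AnalyticAt.cpow (analyticAt_const.add hz) analyticAt_const (Or.inr ?_))).mul
    (AnalyticAt.cpow (hz.sub analyticAt_const) analyticAt_const (Or.inr ?_))).mul hz'
  · simpa using him.ne'
  · simpa using him.ne'
  · rw [Pi.sub_apply, Complex.sub_im, Complex.ofReal_im, sub_zero]; exact him.ne'

theorem exists_saddleAmp_expansion {α β : ℝ} (τ : ℝ) {θ : ℝ} (hα : -1 < α) (hβ : -1 < β)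
    (hθ : θ ∈ Set.Ioo 0 Real.pi) :
    ∃ (b : ℂ) (C : ℝ), ∀ t ∈ Set.Ioo (-1 : ℝ) 1,
      ‖saddleAmp α β τ θ t * (1 - (t : ℂ) ^ 2) - (saddleAmp α β τ θ 0 + b * t)‖ ≤ C * t ^ 2 := by
  have hA : AnalyticAt ℂ (fun t : ℂ => saddleAmp α β τ θ t * (1 - t ^ 2)) 0 := by
    have := analyticAt_saddleAmp α β τ hθ (t := 0) (by norm_num)
    rw [Complex.ofReal_zero] at this
    fun_prop
  obtain ⟨p, hp⟩ := hA
  have hO := hp.isBigO_sub_partialSum_pow 2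
  have h0 : p.coeff 0 = saddleAmp α β τ θ 0 := (hp.coeff_zero 1).trans (by
    rw [zero_pow two_ne_zero, sub_zero, mul_one])
  have hps : ∀ y, p.partialSum 2 y = saddleAmp α β τ θ 0 + p.coeff 1 * y := by
    intro y
    rw [FormalMultilinearSeries.partialSum]
    simp only [FormalMultilinearSeries.apply_eq_pow_smul_coeff, Finset.sum_range_succ,
      Finset.sum_range_zero, h0]
    simp [mul_comm]
  simp only [hps, zero_add] at hO
  obtain ⟨K, hK⟩ := hO.bound
  obtain ⟨δ, hδ, hball⟩ := Metric.eventually_nhds_iff.1 hK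
  obtain ⟨M, hM⟩ := exists_norm_saddleAmp_mul_le τ hα hβ hθ
  have hM0 : 0 ≤ M := (norm_nonneg _).trans (hM 0 (by norm_num))
  set a := saddleAmp α β τ θ 0
  set b := p.coeff 1
  -- For `|t| < δ` the Taylor bound gives `|K|`; elsewhere the left side is bounded and `1 ≤ t² /
  -- δ²`.
  refine ⟨b, |K| + (M + (‖a‖ + ‖b‖)) / δ ^ 2, fun t ht => ?_⟩
  rcases lt_or_ge |t| δ with h | h
  · have := hball (y := (t : ℂ)) (by simpa using h)
    rw [norm_pow, norm_norm, Complex.norm_real, Real.norm_eq_abs, sq_abs] at this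
    refine this.trans (mul_le_mul_of_nonneg_right ?_ (sq_nonneg t))
    exact (le_abs_self K).trans (le_add_of_nonneg_right (by positivity))
  · have ht1 : |t| ≤ 1 := abs_le.2 ⟨ht.1.le, ht.2.le⟩
    have h1 : ‖a + b * t‖ ≤ ‖a‖ + ‖b‖ := by
      refine (norm_add_le _ _).trans ?_
      rw [norm_mul, Complex.norm_real, Real.norm_eq_abs]
      gcongr
      exact mul_le_of_le_one_right (norm_nonneg _) ht1
    have h2 : 1 ≤ t ^ 2 / δ ^ 2 := by
      rw [one_le_div (by positivity), ← sq_abs t]; gcongr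
    calc _ ≤ M + (‖a‖ + ‖b‖) := (norm_sub_le _ _).trans (add_le_add (hM t ht) h1)
      _ ≤ (M + (‖a‖ + ‖b‖)) * (t ^ 2 / δ ^ 2) := le_mul_of_one_le_right (by positivity) h2
      _ = (M + (‖a‖ + ‖b‖)) / δ ^ 2 * t ^ 2 := by ring
      _ ≤ _ := mul_le_mul_of_nonneg_right (le_add_of_nonneg_left (abs_nonneg K)) (sq_nonneg t)

theorem integral_saddleAmp_isBigO {α β : ℝ} (τ : ℝ) {θ : ℝ} (hα : -1 < α) (hβ : -1 < β)
    (hθ : θ ∈ Set.Ioo 0 Real.pi) :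
    (fun n : ℕ => (∫ t in (-1 : ℝ)..1, saddleAmp α β τ θ t * (1 - (t : ℂ) ^ 2) ^ n) -
      saddleAmp α β τ θ 0 * ((Real.sqrt Real.pi * (n : ℝ) ^ (-(1 / 2) : ℝ) : ℝ) : ℂ)) =O[atTop]
      fun n : ℕ => (n : ℝ) ^ (-(3 / 2) : ℝ) := by
  obtain ⟨b, C, hC⟩ := exists_saddleAmp_expansion τ hα hβ hθ
  set a := saddleAmp α β τ θ 0
  have hc : ContinuousOn (fun t : ℝ => saddleAmp α β τ θ t) (Set.Ioo (-1) 1) := fun t ht =>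
    ((analyticAt_saddleAmp α β τ hθ ht).continuousAt.comp
      Complex.continuous_ofReal.continuousAt).continuousWithinAt
  set E : ℕ → ℝ := fun n => ∫ t in (-1 : ℝ)..1, (1 - t ^ 2) ^ n with hE
  have hEO : (fun n => E n * (1 / 2 * ((n : ℝ) + 0)⁻¹)) =O[atTop]
      fun n : ℕ => (n : ℝ) ^ (-(3 / 2) : ℝ) :=
    isBigO_mul_rpow asympPow_integral_one_sub_sq_pow.isBigO
      (((asympPow_inv_add_const 0).const_mul (1 / 2)).isBigO) (by norm_num)
  have h1 : (fun n : ℕ => (∫ t in (-1 : ℝ)..1, saddleAmp α β τ θ t * (1 - (t : ℂ) ^ 2) ^ n) -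
      a * (E n : ℂ)) =O[atTop] fun n => E n * (1 / 2 * ((n : ℝ) + 0)⁻¹) := by
    refine IsBigO.of_bound (C + ‖a‖) ?_
    filter_upwards [eventually_ge_atTop 1] with m hm
    -- One of the `m` factors `1 - t²` is spent on making the amplitude bounded, so `E (m - 1)`
    -- appears; it differs from `E m` by `E m / (2 m)`.
    obtain ⟨n, rfl⟩ : ∃ n, m = n + 1 := ⟨m - 1, by omega⟩
    have h2 := norm_integral_mul_one_sub_sq_pow_sub_le hc hC n
    have h3 := integral_one_sub_sq_pow_sub n
    have hEpos : 0 ≤ E n - E (n + 1) := by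
      have := integral_sq_mul_one_sub_sq_pow n
      rw [hE, ← this]
      refine intervalIntegral.integral_nonneg (by norm_num) fun t ht => ?_
      have h1 : 0 ≤ 1 - t ^ 2 := by nlinarith [ht.1, ht.2]
      positivity
    change ‖_ - a * (E n : ℂ)‖ ≤ C * (E n - E (n + 1)) at h2
    change E n - E (n + 1) = E (n + 1) * _ at h3
    rw [← h3, Real.norm_of_nonneg hEpos, add_mul]
    refine (norm_sub_le_norm_sub_add_norm_sub _ (a * (E n : ℂ)) _).trans (add_le_add h2 ?_)
    rw [← mul_sub, norm_mul, ← Complex.ofReal_sub, Complex.norm_of_nonneg hEpos]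
  have h4 : (fun n : ℕ => a * ((E n - Real.sqrt Real.pi * (n : ℝ) ^ (-(1 / 2) : ℝ) : ℝ) : ℂ))
      =O[atTop] fun n : ℕ => (n : ℝ) ^ (-(3 / 2) : ℝ) := by
    have := asympPow_integral_one_sub_sq_pow
    rw [AsympPow, show (-(1 / 2) - 1 : ℝ) = -(3 / 2) by norm_num] at this
    refine IsBigO.const_mul_left (IsBigO.trans (isBigO_of_le _ fun n => ?_) this) a
    rw [Complex.norm_real]
  refine ((h1.trans hEO).add h4).congr_left fun n => ?_
  push_cast
  ring

theorem abs_re_mul_exp_pow_le (c : ℂ) (θ : ℝ) (k : ℕ) :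
    |(c * Complex.exp (θ * Complex.I) ^ k).re| ≤ ‖c‖ := by
  refine (Complex.abs_re_le_norm _).trans ?_
  rw [norm_mul, norm_pow, Complex.norm_exp_ofReal_mul_I, one_pow, mul_one]

/-- Jacobi coefficients of one-sided powers at an interior point. -/
theorem exists_jacobiCoeff_abs_rpow {τ : ℝ} (hτ : -1 < τ) (A B : ℝ) :
    ∃ κ : ℂ, (A = 1 → B = 1 → (∀ m : ℤ, τ ≠ 2 * m) →
        κ = -(2 / Real.pi * Real.Gamma (τ + 1) * Real.sin (Real.pi * τ / 2) : ℝ) *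
          Complex.exp ((-(Real.pi * τ / 2) : ℝ) * Complex.I)) ∧
      ∀ {α β θ : ℝ}, -1 < α → -1 < β → θ ∈ Set.Ioo 0 Real.pi →
        (fun k : ℕ => jacobiCoeff α β
            (fun x => |x - Real.cos θ| ^ τ * if Real.cos θ < x then A else B) k -
          2 ^ (-(α + β)) * Real.sqrt Real.pi *
            (κ * saddleAmp α β τ θ 0 * Complex.exp (θ * Complex.I) ^ k).re *
              (k : ℝ) ^ (-(τ + 1 / 2))) =O[atTop] fun k : ℕ => (k : ℝ) ^ (-(τ + 3 / 2)) := by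
  obtain ⟨κ, hκ, h⟩ := exists_integral_jacobi_abs_rpow hτ A B
  refine ⟨κ, hκ, fun {α β θ} hα hβ hθ => ?_⟩
  -- The non-oscillating prefactor `Γ(k - τ) / (k! h_k)` is of order `k ^ (-τ)`; the Laplace
  -- integral contributes the further `k ^ (-1/2)`.
  have hu := (asympPow_Gamma_div (-τ) 1).mul (asympPow_inv_jacobiH α β)
  rw [show -τ - 1 + 1 = -τ by ring, one_mul] at hu
  have hvw : (fun k : ℕ => (κ * Complex.exp (θ * Complex.I) ^ k *
        ∫ t in (-1 : ℝ)..1, saddleAmp α β τ θ t * (1 - (t : ℂ) ^ 2) ^ k).re -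
      (κ * saddleAmp α β τ θ 0 * Complex.exp (θ * Complex.I) ^ k).re *
        (Real.sqrt Real.pi * (k : ℝ) ^ (-(1 / 2) : ℝ))) =O[atTop]
      fun k : ℕ => (k : ℝ) ^ (-(3 / 2) : ℝ) := by
    refine IsBigO.trans (IsBigO.of_bound ‖κ‖ (Eventually.of_forall fun k => ?_))
      (integral_saddleAmp_isBigO τ hα hβ hθ)
    rw [← Complex.re_mul_ofReal, ← Complex.sub_re, Real.norm_eq_abs]
    refine (Complex.abs_re_le_norm _).trans (le_of_eq ?_)
    have : ∀ e I a s : ℂ, κ * e * I - κ * a * e * s = κ * e * (I - a * s) := fun e I a s => by ring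
    rw [this, norm_mul, norm_mul, norm_pow, Complex.norm_exp_ofReal_mul_I, one_pow, mul_one]
  have hw : (fun k : ℕ => (κ * saddleAmp α β τ θ 0 * Complex.exp (θ * Complex.I) ^ k).re *
        (Real.sqrt Real.pi * (k : ℝ) ^ (-(1 / 2) : ℝ))) =O[atTop]
      fun k : ℕ => (k : ℝ) ^ (-(1 / 2) : ℝ) := by
    refine IsBigO.of_bound (‖κ * saddleAmp α β τ θ 0‖ * Real.sqrt Real.pi)
      (Eventually.of_forall fun k => ?_)
    rw [norm_mul, norm_mul, Real.norm_eq_abs, Real.norm_of_nonneg (Real.sqrt_nonneg _), ← mul_assoc]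
    gcongr
    exact abs_re_mul_exp_pow_le _ θ k
  have h1 := isBigO_mul_rpow hu.isBigO hvw (r := -(τ + 3 / 2)) (by linarith)
  have h2 := isBigO_mul_rpow hu hw (r := -(τ + 3 / 2)) (by linarith)
  refine (h1.add h2).congr' ?_ EventuallyEq.rfl
  obtain ⟨N, hN⟩ := exists_nat_gt τ
  filter_upwards [eventually_ge_atTop (N + 1)] with k hk
  have hk1 : 1 ≤ k := by omega
  have hkτ : τ < k := hN.trans (by exact_mod_cast hk)
  have hk0 : (0 : ℝ) < k := by exact_mod_cast hk1
  rw [jacobiCoeff_eq, h hα hβ hθ hk1 hkτ, Real.Gamma_nat_eq_factorial, ← sub_eq_add_neg]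
  rw [show κ * (Real.Gamma (k - τ) : ℂ) / (k.factorial : ℂ) * Complex.exp (θ * Complex.I) ^ k *
      (∫ t in (-1 : ℝ)..1, saddleAmp α β τ θ t * (1 - (t : ℂ) ^ 2) ^ k) =
    ((Real.Gamma (k - τ) / k.factorial : ℝ) : ℂ) * (κ * Complex.exp (θ * Complex.I) ^ k *
      ∫ t in (-1 : ℝ)..1, saddleAmp α β τ θ t * (1 - (t : ℂ) ^ 2) ^ k) by push_cast; ring,
    Complex.re_ofReal_mul, neg_add τ (1 / 2), Real.rpow_add hk0]
  ring

/-! ### Modulus and phase of the amplitude at the saddle. -/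

theorem ofReal_mul_exp_cpow {r φ : ℝ} (hr : 0 < r) (h1 : -Real.pi < φ) (h2 : φ ≤ Real.pi) (p : ℝ) :
    ((r : ℂ) * Complex.exp (φ * Complex.I)) ^ (p : ℂ) =
      ((r ^ p : ℝ) : ℂ) * Complex.exp ((φ * p : ℝ) * Complex.I) := by
  have hr' : (r : ℂ) ≠ 0 := by exact_mod_cast hr.ne'
  rw [Complex.cpow_def_of_ne_zero (mul_ne_zero hr' (Complex.exp_ne_zero _)),
    Complex.log_ofReal_mul hr (Complex.exp_ne_zero _), Complex.log_exp (by simpa using h1)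
    (by simpa using h2), add_mul, Complex.exp_add, Real.rpow_def_of_pos hr]
  push_cast
  congr 2
  ring

theorem one_sub_exp_mul_I (φ : ℝ) :
    1 - Complex.exp (φ * Complex.I) = ((2 * Real.sin (φ / 2) : ℝ) : ℂ) *
      Complex.exp (((φ - Real.pi) / 2 : ℝ) * Complex.I) := by
  have h1 : φ = 2 * (φ / 2) := by ring
  rw [Complex.exp_mul_I, Complex.exp_mul_I, ← Complex.ofReal_cos, ← Complex.ofReal_sin,
    ← Complex.ofReal_cos, ← Complex.ofReal_sin, sub_div, Real.cos_sub_pi_div_two,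
    Real.sin_sub_pi_div_two]
  nth_rw 1 [h1]
  nth_rw 2 [h1]
  rw [Real.cos_two_mul, Real.sin_two_mul]
  have := Real.sin_sq_add_cos_sq (φ / 2)
  have h : ((Real.sin (φ / 2) : ℝ) : ℂ) ^ 2 + (Real.cos (φ / 2) : ℝ) ^ 2 = 1 := by exact_mod_cast this
  push_cast at h ⊢
  linear_combination -2 * h

theorem one_add_exp_mul_I (φ : ℝ) :
    1 + Complex.exp (φ * Complex.I) = ((2 * Real.cos (φ / 2) : ℝ) : ℂ) *
      Complex.exp ((φ / 2 : ℝ) * Complex.I) := by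
  have h1 : φ = 2 * (φ / 2) := by ring
  rw [Complex.exp_mul_I, Complex.exp_mul_I, ← Complex.ofReal_cos, ← Complex.ofReal_sin,
    ← Complex.ofReal_cos, ← Complex.ofReal_sin]
  nth_rw 1 [h1]
  nth_rw 2 [h1]
  rw [Real.cos_two_mul, Real.sin_two_mul]
  push_cast
  ring

/-- At `z = e ^ (iθ)` all factors have explicit polar forms, with arguments `(θ - π) / 2`, `θ / 2`
and `π / 2`, and `θ - π / 2` under the square root giving the path's velocity. All lie in `(-π, π]`,
so principal powers multiply the arguments. -/
theorem saddleAmp_zero (α β τ : ℝ) {θ : ℝ} (hθ : θ ∈ Set.Ioo 0 Real.pi) :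
    saddleAmp α β τ θ 0 = (((2 * Real.sin (θ / 2)) ^ α * (2 * Real.cos (θ / 2)) ^ β *
      Real.sin θ ^ τ * (2 * Real.sin θ) ^ (1 / 2 : ℝ) : ℝ) : ℂ) *
        Complex.exp (((θ - Real.pi) / 2 * α + θ / 2 * β + Real.pi / 2 * τ +
          (θ - Real.pi / 2) * (1 / 2) : ℝ) * Complex.I) := by
  obtain ⟨h0, hpi⟩ := hθ
  have hs : 0 < Real.sin θ := Real.sin_pos_of_pos_of_lt_pi h0 hpi
  have hs2 : 0 < Real.sin (θ / 2) := Real.sin_pos_of_pos_of_lt_pi (by linarith) (by linarith)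
  have hc2 : 0 < Real.cos (θ / 2) := Real.cos_pos_of_mem_Ioo ⟨by linarith, by linarith⟩
  have e3 : Complex.exp (θ * Complex.I) - Real.cos θ =
      (Real.sin θ : ℂ) * Complex.exp ((Real.pi / 2 : ℝ) * Complex.I) := by
    rw [Complex.exp_mul_I, Complex.exp_mul_I, ← Complex.ofReal_cos, ← Complex.ofReal_sin,
      ← Complex.ofReal_cos, ← Complex.ofReal_sin, Real.cos_pi_div_two, Real.sin_pi_div_two]
    push_cast
    ring
  have e4 : saddlePathDeriv θ 0 = (((2 * Real.sin θ) ^ (1 / 2 : ℝ) : ℝ) : ℂ) *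
      Complex.exp (((θ - Real.pi / 2) * (1 / 2) : ℝ) * Complex.I) := by
    have h := one_sub_exp_mul_I (2 * θ)
    rw [mul_div_cancel_left₀ _ two_ne_zero, show (2 * θ - Real.pi) / 2 = θ - Real.pi / 2 by ring] at h
    rw [← ofReal_mul_exp_cpow (by positivity) (by linarith) (by linarith), ← h]
    simp only [saddlePathDeriv]
    rw [← Complex.exp_nat_mul]
    push_cast
    simp [mul_assoc]
  rw [saddleAmp, saddlePath_zero, one_sub_exp_mul_I, one_add_exp_mul_I, e3, e4,
    ofReal_mul_exp_cpow (by positivity) (by linarith) (by linarith),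
    ofReal_mul_exp_cpow (by positivity) (by linarith) (by linarith),
    ofReal_mul_exp_cpow (by positivity) (by linarith) (by linarith)]
  push_cast
  simp only [add_mul _ _ Complex.I, Complex.exp_add]
  ring

theorem ampInterior_eq (α β σ : ℝ) {θ : ℝ} (hθ : θ ∈ Set.Ioo 0 Real.pi) (g : ℝ → ℝ) :
    ampInterior α β σ (Real.cos θ) g =
      g (Real.cos θ) * (2 ^ (-(α + β)) * Real.sqrt Real.pi *
        (-(2 / Real.pi * Real.Gamma (σ + 1) * Real.sin (Real.pi * σ / 2)) *
          ((2 * Real.sin (θ / 2)) ^ α * (2 * Real.cos (θ / 2)) ^ β *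
            Real.sin θ ^ σ * (2 * Real.sin θ) ^ (1 / 2 : ℝ)))) := by
  obtain ⟨h0, hpi⟩ := hθ
  have hs2 : 0 < Real.sin (θ / 2) := Real.sin_pos_of_pos_of_lt_pi (by linarith) (by linarith)
  have hc2 : 0 < Real.cos (θ / 2) := Real.cos_pos_of_mem_Ioo ⟨by linarith, by linarith⟩
  have hsin : Real.sin θ = 2 * Real.sin (θ / 2) * Real.cos (θ / 2) := by
    rw [← Real.sin_two_mul]; congr 1; ring
  have hcos : Real.cos θ = 2 * Real.cos (θ / 2) ^ 2 - 1 := by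
    rw [← Real.cos_two_mul]; congr 1; ring
  have h1 : 1 - Real.cos θ = 2 * Real.sin (θ / 2) ^ 2 := by
    rw [hcos]; linear_combination -2 * Real.sin_sq_add_cos_sq (θ / 2)
  have h2 : 1 + Real.cos θ = 2 * Real.cos (θ / 2) ^ 2 := by rw [hcos]; ring
  have h3 : Real.cos ((σ + 1) / 2 * Real.pi) = -Real.sin (Real.pi * σ / 2) := by
    rw [← Real.cos_add_pi_div_two]; congr 1; ring
  have key : (2 * Real.sin (θ / 2) ^ 2) ^ ((σ + α) / 2 + 1 / 4) *
      (2 * Real.cos (θ / 2) ^ 2) ^ ((σ + β) / 2 + 1 / 4) =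
      2 * 2 ^ (-(α + β)) * 2 ^ ((α + β - 3) / 2) *
        ((2 * Real.sin (θ / 2)) ^ α * (2 * Real.cos (θ / 2)) ^ β *
            (2 * Real.sin (θ / 2) * Real.cos (θ / 2)) ^ σ *
              (2 * (2 * Real.sin (θ / 2) * Real.cos (θ / 2))) ^ (1 / 2 : ℝ)) := by
    set s := Real.sin (θ / 2)
    set c := Real.cos (θ / 2)
    -- Passing to exponentials reduces the identity to a linear one in `log 2`, `log s` and `log c`.
    rw [Real.rpow_def_of_pos (by positivity : (0 : ℝ) < 2 * s ^ 2),
      Real.rpow_def_of_pos (by positivity : (0 : ℝ) < 2 * c ^ 2),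
      Real.rpow_def_of_pos (by positivity : (0 : ℝ) < 2 * s),
      Real.rpow_def_of_pos (by positivity : (0 : ℝ) < 2 * c),
      Real.rpow_def_of_pos (by positivity : (0 : ℝ) < 2 * s * c),
      Real.rpow_def_of_pos (by positivity : (0 : ℝ) < 2 * (2 * s * c)),
      Real.rpow_def_of_pos two_pos, Real.rpow_def_of_pos two_pos,
      Real.log_mul two_ne_zero (pow_ne_zero 2 hs2.ne'),
      Real.log_mul two_ne_zero (pow_ne_zero 2 hc2.ne'),
      Real.log_mul two_ne_zero (by positivity : 2 * s * c ≠ 0),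
      Real.log_mul (by positivity : 2 * s ≠ 0) hc2.ne', Real.log_mul two_ne_zero hs2.ne',
      Real.log_mul two_ne_zero hc2.ne', Real.log_pow, Real.log_pow]
    have : ∀ x : ℝ, 2 * Real.exp x = Real.exp (Real.log 2 + x) := fun x => by
      rw [Real.exp_add, Real.exp_log two_pos]
    rw [this]
    simp only [← Real.exp_add]
    congr 1
    push_cast
    ring
  have hpi' : 2 / Real.pi * Real.sqrt Real.pi = 2 / Real.sqrt Real.pi := by
    rw [div_mul_eq_mul_div, mul_div_assoc, Real.sqrt_div_self, ← div_eq_mul_inv]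
  have hsp : Real.sqrt Real.pi ≠ 0 := (Real.sqrt_pos.2 Real.pi_pos).ne'
  rw [ampInterior, h1, h2, h3, hsin, mul_assoc (Real.Gamma (σ + 1)), key]
  set X := (2 * Real.sin (θ / 2)) ^ α * (2 * Real.cos (θ / 2)) ^ β *
            (2 * Real.sin (θ / 2) * Real.cos (θ / 2)) ^ σ *
              (2 * (2 * Real.sin (θ / 2) * Real.cos (θ / 2))) ^ (1 / 2 : ℝ)
  have hp2 : (2 : ℝ) ^ ((α + β - 3) / 2) ≠ 0 := by positivity
  have hR : 2 ^ (-(α + β)) * Real.sqrt Real.pi *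
      (-(2 / Real.pi * Real.Gamma (σ + 1) * Real.sin (Real.pi * σ / 2)) * X) =
      -(2 ^ (-(α + β)) * (2 / Real.sqrt Real.pi) * Real.Gamma (σ + 1) *
        Real.sin (Real.pi * σ / 2) * X) := by
    rw [← hpi']; ring
  rw [hR]
  set S := Real.sin (Real.pi * σ / 2)
  field_simp

/-! ### Assembly for an interior singularity. -/

theorem hasJacobiCoeffs_abs_rpow_mul {α β σ ξ : ℝ} (hα : -1 < α) (hβ : -1 < β) (hσ : -1 < σ)
    (hξ : ξ ∈ Set.Ioo (-1 : ℝ) 1) {f : ℝ → ℝ} (hf : ContinuousOn f (Set.Icc (-1) 1)) :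
    HasJacobiCoeffs α β fun x => |x - ξ| ^ σ * f x := fun k => by
  have h := (intervalIntegrable_abs_sub_rpow_mul_jacobiWeight hα hβ hσ hξ).mul_continuousOn
    (g := fun x => f x * jacobiP α β k x) (by
      rw [Set.uIcc_of_le (by norm_num)]
      exact hf.mul (continuous_jacobiP α β k).continuousOn)
  exact h.congr_uIoo fun x _ => by ring

/-- Puts the Taylor terms in the one-sided form with `A = 1`, `B = (-1) ^ j`. At `x = ξ` with `j ≥
1` both sides vanish because `σ + j > 0`. -/
theorem abs_rpow_mul_pow_eq {σ : ℝ} (hσ : -1 < σ) (j : ℕ) (ξ x : ℝ) :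
    |x - ξ| ^ σ * (x - ξ) ^ j = |x - ξ| ^ (σ + j) * if ξ < x then 1 else (-1) ^ j := by
  rcases j.eq_zero_or_pos with rfl | hj
  · simp
  have hj1 : (1 : ℝ) ≤ j := by exact_mod_cast hj
  rcases lt_trichotomy ξ x with h | rfl | h
  · rw [if_pos h, abs_of_pos (sub_pos.2 h), Real.rpow_add_natCast (sub_pos.2 h).ne', mul_one]
  · simp [hj.ne', Real.zero_rpow (by linarith : σ + j ≠ 0)]
  · rw [if_neg h.le.not_gt, abs_of_neg (sub_neg.2 h), Real.rpow_add_natCast (by linarith),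
      mul_assoc, ← mul_pow]
    congr 2; ring

/-- An even power removes the absolute value: the remainder becomes a high power of the smooth
nonnegative `y²`. This is why the Taylor order below is even. -/
theorem abs_rpow_mul_pow_two_mul {σ : ℝ} {M : ℕ} (hM : 0 < σ + 2 * M) (hM0 : M ≠ 0) (y : ℝ) :
    |y| ^ σ * y ^ (2 * M) = (y ^ 2) ^ ((σ + 2 * M) / 2) := by
  rcases eq_or_ne y 0 with rfl | h
  · simp [hM0, Real.zero_rpow (by linarith : (σ + 2 * M) / 2 ≠ 0)]
  · rw [pow_mul, ← sq_abs, ← pow_mul, ← Real.rpow_add_natCast (abs_ne_zero.2 h),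
      ← Real.rpow_natCast, ← Real.rpow_mul (abs_nonneg y)]
    congr 1; push_cast; ring

/-- The term of index `j` is of order `k ^ (-(σ + j + 1/2))`, so the constant is needed explicitly
only for `j = 0`. For odd `σ` the exponents `σ + j` are integers, which is where the logarithmic
case enters. -/
theorem asymptotics_jacobiCoeff_interior {α β σ ξ : ℝ} (hα : -1 < α) (hβ : -1 < β)
    (hξ : ξ ∈ Set.Ioo (-1 : ℝ) 1) (hσ : -1 < σ) (hσn : ∀ m : ℤ, σ ≠ 2 * (m : ℝ)) {g : ℝ → ℝ}
    (hg : AnalyticOnNhd ℝ g (Set.Icc (-1) 1)) :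
    HasJacobiCoeffs α β (modelFun σ ξ g) ∧
      (fun k : ℕ => jacobiCoeff α β (modelFun σ ξ g) k -
          ampInterior α β σ ξ g * (Real.cos (k * Real.arccos ξ - psiPhase α β ξ) /
            (k : ℝ) ^ (σ + 1 / 2)))
        =O[atTop] (fun k : ℕ => 1 / (k : ℝ) ^ (σ + 3 / 2)) := by
  refine ⟨hasJacobiCoeffs_abs_rpow_mul hα hβ hσ hξ hg.continuousOn, ?_⟩
  set θ := Real.arccos ξ with hθdef
  have hθ : θ ∈ Set.Ioo 0 Real.pi := by
    refine ⟨Real.arccos_pos.2 hξ.2, lt_of_le_of_ne (Real.arccos_le_pi ξ) fun h => ?_⟩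
    have := Real.arccos_eq_pi.1 h
    linarith [hξ.1]
  have hcos : Real.cos θ = ξ := Real.cos_arccos hξ.1.le hξ.2.le
  -- The choice of `m` makes `1 - m ≤ -(σ + 3/2)`; the choice of `M` makes `(σ + 2 (M + 1)) / 2 ≥
  -- m`, so that the remainder is `C^m`.
  obtain ⟨m, hm⟩ := exists_nat_ge (σ + 5 / 2)
  obtain ⟨M, hM⟩ := exists_nat_ge (m + 1 - σ / 2)
  obtain ⟨c, r, hr, hc0, hgexp⟩ := exists_taylor_expansion (Set.Ioo_subset_Icc_self hξ) hg
    (2 * (M + 1))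
  have hdec : modelFun σ ξ g = fun x => (g ξ * (|x - ξ| ^ σ * (x - ξ) ^ 0) +
      ∑ j ∈ Finset.range (2 * M + 1), c (j + 1) * (|x - ξ| ^ σ * (x - ξ) ^ (j + 1))) +
        |x - ξ| ^ σ * ((x - ξ) ^ (2 * (M + 1)) * r x) := by
    ext x
    rw [modelFun, hgexp x, show 2 * (M + 1) = 2 * M + 1 + 1 by ring, Finset.sum_range_succ', hc0,
      mul_add, mul_add, Finset.mul_sum]
    have : ∀ j, |x - ξ| ^ σ * (c (j + 1) * (x - ξ) ^ (j + 1)) =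
      c (j + 1) * (|x - ξ| ^ σ * (x - ξ) ^ (j + 1)) := fun j => by ring
    simp only [this]
    ring
  have hpow : ∀ j : ℕ, HasJacobiCoeffs α β fun x => |x - ξ| ^ σ * (x - ξ) ^ j := fun j =>
    hasJacobiCoeffs_abs_rpow_mul hα hβ hσ hξ (by fun_prop)
  have hR : HasJacobiCoeffs α β fun x => |x - ξ| ^ σ * ((x - ξ) ^ (2 * (M + 1)) * r x) :=
    hasJacobiCoeffs_abs_rpow_mul hα hβ hσ hξ ((by fun_prop : ContinuousOn
      (fun x => (x - ξ) ^ (2 * (M + 1))) _).mul hr.continuousOn)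
  have hS := HasJacobiCoeffs.sum (Finset.range (2 * M + 1))
    (fun j (_ : j ∈ Finset.range (2 * M + 1)) => (hpow (j + 1)).const_mul (c (j + 1)))
  have hRO : (fun k => jacobiCoeff α β
      (fun x => |x - ξ| ^ σ * ((x - ξ) ^ (2 * (M + 1)) * r x)) k) =O[atTop]
      fun k : ℕ => (k : ℝ) ^ (-(σ + 3 / 2)) := by
    have h1 : ContDiff ℝ m fun x : ℝ => ((x - ξ) ^ 2) ^ ((σ + 2 * (M + 1 : ℕ)) / 2) :=
      (Real.contDiff_rpow_const_of_le (by push_cast; linarith)).comp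
        ((contDiff_id.sub contDiff_const).pow 2)
    have h2 := jacobiCoeff_isBigO_of_contDiffOn hα hβ m
      (h1.contDiffOn.mul (hr.contDiffOn (uniqueDiffOn_Icc (by norm_num))))
    refine (h2.trans (natCast_rpow_isBigO (by linarith))).congr_left fun k => ?_
    refine jacobiCoeff_congr α β (fun x _ => ?_) k
    have hm0 : (0 : ℝ) ≤ m := m.cast_nonneg
    rw [← mul_assoc, abs_rpow_mul_pow_two_mul (by push_cast; linarith) M.succ_ne_zero]
  have hterm : ∀ j : ℕ, ∃ κ : ℂ, (j = 0 →
        κ = -(2 / Real.pi * Real.Gamma (σ + 1) * Real.sin (Real.pi * σ / 2) : ℝ) *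
          Complex.exp ((-(Real.pi * σ / 2) : ℝ) * Complex.I)) ∧
      (fun k : ℕ => jacobiCoeff α β (fun x => |x - ξ| ^ σ * (x - ξ) ^ j) k -
          2 ^ (-(α + β)) * Real.sqrt Real.pi *
            (κ * saddleAmp α β (σ + j) θ 0 * Complex.exp (θ * Complex.I) ^ k).re *
              (k : ℝ) ^ (-(σ + j + 1 / 2))) =O[atTop] fun k : ℕ => (k : ℝ) ^ (-(σ + j + 3 / 2)) := by
    intro j
    obtain ⟨κ, h1, h2⟩ := exists_jacobiCoeff_abs_rpow (τ := σ + j)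
      (by linarith [(j.cast_nonneg : (0 : ℝ) ≤ j)]) 1 ((-1) ^ j)
    refine ⟨κ, ?_, ?_⟩
    · rintro rfl
      simp only [CharP.cast_eq_zero, add_zero, pow_zero] at h1
      exact h1 trivial trivial hσn
    · have h3 := h2 hα hβ hθ
      rw [hcos] at h3
      simpa only [← abs_rpow_mul_pow_eq hσ] using h3
  have hSO : (fun k => ∑ j ∈ Finset.range (2 * M + 1), c (j + 1) *
      jacobiCoeff α β (fun x => |x - ξ| ^ σ * (x - ξ) ^ (j + 1)) k) =O[atTop]
      fun k : ℕ => (k : ℝ) ^ (-(σ + 3 / 2)) := by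
    refine IsBigO.fun_sum fun j _ => IsBigO.const_mul_left ?_ _
    obtain ⟨κ, -, h⟩ := hterm (j + 1)
    have hj : (0 : ℝ) ≤ j := j.cast_nonneg
    have h1 := h.trans (natCast_rpow_isBigO (q := -(σ + 3 / 2)) (by push_cast; linarith))
    have h2 : (fun k : ℕ => 2 ^ (-(α + β)) * Real.sqrt Real.pi *
            (κ * saddleAmp α β (σ + (j + 1 : ℕ)) θ 0 * Complex.exp (θ * Complex.I) ^ k).re *
              (k : ℝ) ^ (-(σ + (j + 1 : ℕ) + 1 / 2))) =O[atTop]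
        fun k : ℕ => (k : ℝ) ^ (-(σ + 3 / 2)) := by
      refine IsBigO.trans (IsBigO.of_bound (2 ^ (-(α + β)) * Real.sqrt Real.pi *
        ‖κ * saddleAmp α β (σ + (j + 1 : ℕ)) θ 0‖) (Eventually.of_forall fun k => ?_))
        (natCast_rpow_isBigO (p := -(σ + (j + 1 : ℕ) + 1 / 2)) (by push_cast; linarith))
      rw [norm_mul, norm_mul, Real.norm_of_nonneg (by positivity : (0 : ℝ) ≤ 2 ^ (-(α + β)) *
        Real.sqrt Real.pi), Real.norm_eq_abs]
      gcongr
      exact abs_re_mul_exp_pow_le _ θ k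
    refine (h1.add h2).congr_left fun k => ?_
    ring
  obtain ⟨κ, hκ, h0⟩ := hterm 0
  simp only [CharP.cast_eq_zero, add_zero] at h0
  have hmain := ((h0.const_mul_left (g ξ)).add hSO).add hRO
  refine hmain.congr (fun k => ?_) fun k => by
    rw [one_div, ← Real.rpow_neg k.cast_nonneg]
  -- The phase `-πσ / 2` of `κ` cancels the `πσ / 2` of the amplitude; the other phases add up to
  -- `-ψ`.
  have hre : (κ * saddleAmp α β σ θ 0 * Complex.exp (θ * Complex.I) ^ k).re =
      -(2 / Real.pi * Real.Gamma (σ + 1) * Real.sin (Real.pi * σ / 2)) *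
          ((2 * Real.sin (θ / 2)) ^ α * (2 * Real.cos (θ / 2)) ^ β *
            Real.sin θ ^ σ * (2 * Real.sin θ) ^ (1 / 2 : ℝ)) *
        Real.cos (k * θ - psiPhase α β ξ) := by
    rw [hκ rfl, saddleAmp_zero α β σ hθ, ← Complex.exp_nat_mul]
    set X := (2 * Real.sin (θ / 2)) ^ α * (2 * Real.cos (θ / 2)) ^ β *
            Real.sin θ ^ σ * (2 * Real.sin θ) ^ (1 / 2 : ℝ)
    set Y := 2 / Real.pi * Real.Gamma (σ + 1) * Real.sin (Real.pi * σ / 2)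
    rw [← Complex.exp_ofReal_mul_I_re, ← Complex.re_ofReal_mul]
    congr 1
    rw [psiPhase, ← hθdef, show ((k * θ - ((2 * α + 1) * Real.pi / 4 - (α + β + 1) * θ / 2) : ℝ) : ℂ) *
        Complex.I = ((-(Real.pi * σ / 2) : ℝ) * Complex.I) +
        (((θ - Real.pi) / 2 * α + θ / 2 * β + Real.pi / 2 * σ +
          (θ - Real.pi / 2) * (1 / 2) : ℝ) * Complex.I) + (k * (θ * Complex.I)) by push_cast; ring,
      Complex.exp_add, Complex.exp_add]
    push_cast
    ring
  rw [hdec, jacobiCoeff_add (((hpow 0).const_mul _).add hS) hR,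
    jacobiCoeff_add ((hpow 0).const_mul _) hS, jacobiCoeff_const_mul,
    jacobiCoeff_sum _ (fun j (_ : j ∈ Finset.range (2 * M + 1)) =>
      (hpow (j + 1)).const_mul (c (j + 1)))]
  simp only [jacobiCoeff_const_mul]
  rw [hre, show ampInterior α β σ ξ g = ampInterior α β σ (Real.cos θ) g by rw [hcos],
    ampInterior_eq α β σ hθ, hcos, Real.rpow_neg k.cast_nonneg (σ + 1 / 2)]
  ring
theorem theorem2p1 (α β : ℝ) (hα : -1 < α) (hβ : -1 < β) (σ : ℝ) (g : ℝ → ℝ)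
    (hg : AnalyticOnNhd ℝ g (Set.Icc (-1) 1)) :
    -- interior singularity
    (∀ ξ ∈ Set.Ioo (-1 : ℝ) 1, -1 < σ → (∀ m : ℤ, σ ≠ 2 * (m : ℝ)) →
      HasJacobiCoeffs α β (modelFun σ ξ g) ∧
      (fun k : ℕ => jacobiCoeff α β (modelFun σ ξ g) k -
          ampInterior α β σ ξ g * (Real.cos (k * Real.arccos ξ - psiPhase α β ξ) /
            (k : ℝ) ^ (σ + 1 / 2)))
        =O[atTop] (fun k : ℕ => 1 / (k : ℝ) ^ (σ + 3 / 2))) ∧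
    -- singularity at the left endpoint
    (-β - 1 < σ → (∀ m : ℤ, σ ≠ (m : ℝ)) →
      HasJacobiCoeffs α β (modelFun σ (-1) g) ∧
      (fun k : ℕ => jacobiCoeff α β (modelFun σ (-1) g) k -
          (-1) ^ k * ampLeft β σ g / (k : ℝ) ^ (2 * σ + β + 1))
        =O[atTop] (fun k : ℕ => 1 / (k : ℝ) ^ (2 * σ + β + 2))) ∧
    -- singularity at the right endpoint
    (-α - 1 < σ → (∀ m : ℤ, σ ≠ (m : ℝ)) →
      HasJacobiCoeffs α β (modelFun σ 1 g) ∧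
      (fun k : ℕ => jacobiCoeff α β (modelFun σ 1 g) k -
          ampRight α σ g / (k : ℝ) ^ (2 * σ + α + 1))
        =O[atTop] (fun k : ℕ => 1 / (k : ℝ) ^ (2 * σ + α + 2))) := by
  refine ⟨fun ξ hξ hσ hσn => asymptotics_jacobiCoeff_interior hα hβ hξ hσ hσn hg,
    fun hσ hσn => asymptotics_jacobiCoeff_left hα hβ hσ hσn hg, fun hσ hσn => ?_⟩
  obtain ⟨h1, h2⟩ := asympPow_jacobiCoeff_right hα hβ hσ hσn hg
  exact ⟨h1, h2.isBigO_one_div (by ring)⟩
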